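/- Let $n\ge 1$ and let $Q,B$ be real $n\times n$ matrices such that $Q$ is symmetric and positive definite and all eigenvalues of $B$ have negative real parts. For $t\in(0,\infty]$ let $Q_t=\int_0^t e^{sB}Qe^{sB^*}\,ds$, let $R(x)=\frac12\langle Q_\infty^{-1}x,x\rangle$, let $d\gamma_\infty(x)=(2\pi)^{-n/2}(\det Q_\infty)^{-1/2}e^{-R(x)}\,dx$ on $\mathbb R^n$, let $D_t=Q_\infty e^{-tB^*}Q_\infty^{-1}$, and for $0<t<\infty$ let $$K_t(x,u)=\Big(\frac{\det Q_\infty}{\det Q_t}\Big)^{1/2}e^{R(x)}\exp\Big[-\tfrac12\big\langle (Q_t^{-1}-Q_\infty^{-1})(u-D_tx),\,u-D_tx\big\rangle\Big],\qquad x,u\in\mathbb R^n,$$ be the Mehler kernel, that is, the kernel with respect to $\gamma_\infty$ of the Ornstein–Uhlenbeck semigroup with covariance $Q$ and drift $B$. For $i,j\in\{1,\dots,n\}$ consider the parts coming from $t>1$ of the kernels of the first- and second-order Riesz transforms, $$\mathcal R_{j,\infty}(x,u)=\frac1{\sqrt\pi}\int_1^\infty t^{-1/2}\,\partial_{x_j}K_t(x,u)\,dt,\qquad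 \mathcal R_{ij,\infty}(x,u)=\int_1^\infty \partial^2_{x_ix_j}K_t(x,u)\,dt .$$ These integrals converge absolutely for all $x,u\in\mathbb R^n$, and for every $f\in L^1(\gamma_\infty)$ and every $x\in\mathbb R^n$ the integrals $\int \mathcal R_{j,\infty}(x,u)f(u)\,d\gamma_\infty(u)$ and $\int \mathcal R_{ij,\infty}(x,u)f(u)\,d\gamma_\infty(u)$ converge absolutely. There is a constant $C=C(n,Q,B)>0$ such that for all nonnegative $f\in L^1(\gamma_\infty)$ with $\|f\|_{L^1(\gamma_\infty)}=1$, all $i,j\in\{1,\dots,n\}$ and all $\lambda>2$, $$\gamma_\infty\Big\{x:\int \mathcal R_{j,\infty}(x,u)f(u)\,d\gamma_\infty(u)>\lambda\Big\}\le\frac{C}{\lambda\sqrt{\log\lambda}} \quad\text{and}\quad \gamma_\infty\Big\{x:\int \mathcal R_{ij,\infty}(x,u)f(u)\,d\gamma_\infty(u)>\lambda\Big\}\le\frac{C}{\lambda}.$$ In particular, the operators with kernels $\mathcal R_{j,\infty}$ and $\mathcal R_{ij,\infty}$ (integrated against $\gamma_\infty$) are of weak type $(1,1)$ with respect to $\gamma_\infty$: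 each such operator $T$ satisfies, for some $C<\infty$, $\gamma_\infty\{x:|Tf(x)|>\lambda\}\le \frac{C}{\lambda}\|f\|_{L^1(\gamma_\infty)}$ for all $f\in L^1(\gamma_\infty)$ and all $\lambda>0$. -/

import Mathlib

open MeasureTheory
open scoped Matrix

namespace OrnsteinUhlenbeck

noncomputable section

variable {n : ℕ}

/-- The covariance matrix `Q_t = ∫₀ᵗ e^{sB} Q e^{sB*} ds` for finite `t`, integrated entrywise. -/
def covariance (Q B : Matrix (Fin n) (Fin n) ℝ) (t : ℝ) : Matrix (Fin n) (Fin n) ℝ :=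
  Matrix.of fun k l =>
    ∫ s : ℝ in Set.Ioc 0 t, (NormedSpace.exp (s • B) * Q * NormedSpace.exp (s • Bᵀ)) k l

/-- The covariance matrix `Q_∞ = ∫₀^∞ e^{sB} Q e^{sB*} ds`, integrated entrywise. -/
def covarianceInf (Q B : Matrix (Fin n) (Fin n) ℝ) : Matrix (Fin n) (Fin n) ℝ :=
  Matrix.of fun k l =>
    ∫ s : ℝ in Set.Ioi 0, (NormedSpace.exp (s • B) * Q * NormedSpace.exp (s • Bᵀ)) k l

/-- The quadratic form `R(x) = ½ ⟨Q_∞⁻¹ x, x⟩`. -/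
def quadForm (Q B : Matrix (Fin n) (Fin n) ℝ) (x : Fin n → ℝ) : ℝ :=
  (1 / 2) * (((covarianceInf Q B)⁻¹ *ᵥ x) ⬝ᵥ x)

/-- The invariant measure `γ_∞`: the centred Gaussian measure on `ℝⁿ` with covariance `Q_∞`. -/
def gammaInf (Q B : Matrix (Fin n) (Fin n) ℝ) : Measure (Fin n → ℝ) :=
  (volume : Measure (Fin n → ℝ)).withDensity fun x =>
    ENNReal.ofReal ((2 * Real.pi) ^ (-(n : ℝ) / 2) * (covarianceInf Q B).det ^ (-(1 / 2) : ℝ)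
      * Real.exp (-quadForm Q B x))

/-- The matrices `D_t = Q_∞ e^{-tB*} Q_∞⁻¹`. -/
def flow (Q B : Matrix (Fin n) (Fin n) ℝ) (t : ℝ) : Matrix (Fin n) (Fin n) ℝ :=
  covarianceInf Q B * NormedSpace.exp ((-t) • Bᵀ) * (covarianceInf Q B)⁻¹

/-- The Mehler kernel `K_t(x, u)`, the integral kernel of the Ornstein-Uhlenbeck semigroup
with respect to `γ_∞`. -/
def mehlerKernel (Q B : Matrix (Fin n) (Fin n) ℝ) (t : ℝ) (x u : Fin n → ℝ) : ℝ :=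
  ((covarianceInf Q B).det / (covariance Q B t).det) ^ (1 / 2 : ℝ)
    * Real.exp (quadForm Q B x)
    * Real.exp (-(1 / 2) *
        ((((covariance Q B t)⁻¹ - (covarianceInf Q B)⁻¹) *ᵥ (u - flow Q B t *ᵥ x))
          ⬝ᵥ (u - flow Q B t *ᵥ x)))

/-- The partial derivative `∂_{x_j} g (x)` of a function on `ℝⁿ`. -/
def partialDeriv (j : Fin n) (g : (Fin n → ℝ) → ℝ) (x : Fin n → ℝ) : ℝ :=
  lineDeriv ℝ g x (Pi.single j 1)

/-- The integrand `t^{-1/2} ∂_{x_j} K_t(x, u)` of the first-order Riesz kernel. -/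
def rieszIntegrand₁ (Q B : Matrix (Fin n) (Fin n) ℝ) (j : Fin n) (x u : Fin n → ℝ) (t : ℝ) : ℝ :=
  t ^ (-(1 / 2) : ℝ) * partialDeriv j (fun y => mehlerKernel Q B t y u) x

/-- The integrand `∂²_{x_i x_j} K_t(x, u)` of the second-order Riesz kernel. -/
def rieszIntegrand₂ (Q B : Matrix (Fin n) (Fin n) ℝ) (i j : Fin n) (x u : Fin n → ℝ) (t : ℝ) : ℝ :=
  partialDeriv i (fun z => partialDeriv j (fun y => mehlerKernel Q B t y u) z) x

/-- The part of the kernel of the first-order Riesz transform `R_j` coming from `t > 1`. -/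
def rieszKernelInf₁ (Q B : Matrix (Fin n) (Fin n) ℝ) (j : Fin n) (x u : Fin n → ℝ) : ℝ :=
  (1 / Real.sqrt Real.pi) * ∫ t : ℝ in Set.Ioi 1, rieszIntegrand₁ Q B j x u t

/-- The part of the kernel of the second-order Riesz transform `R_{ij}` coming from `t > 1`. -/
def rieszKernelInf₂ (Q B : Matrix (Fin n) (Fin n) ℝ) (i j : Fin n) (x u : Fin n → ℝ) : ℝ :=
  ∫ t : ℝ in Set.Ioi 1, rieszIntegrand₂ Q B i j x u t

/-- The operator with integral kernel `k`, in the sense of integration against `μ`. -/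
def kernelOperator {X : Type*} [MeasurableSpace X] (μ : Measure X) (k : X → X → ℝ)
    (f : X → ℝ) (x : X) : ℝ :=
  ∫ u, k x u * f u ∂μ

/-- `T` is of weak type `(1,1)` with respect to `μ`: for some constant `C`,
`μ {|T f| > a} ≤ (C / a) ‖f‖_{L¹(μ)}` for all `f ∈ L¹(μ)` and all `a > 0`. -/
def IsWeakTypeOneOne {X : Type*} [MeasurableSpace X] (μ : Measure X)
    (T : (X → ℝ) → X → ℝ) : Prop :=
  ∃ C : ℝ, 0 < C ∧ ∀ f : X → ℝ, Integrable f μ → ∀ a : ℝ, 0 < a →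
    μ {x | a < |T f x|} ≤ ENNReal.ofReal (C / a * ∫ u, |f u| ∂μ)

end

end OrnsteinUhlenbeck

/-! Write w_t = D_{-t} u and ρ² = 2R. Since Q_∞ = Q_t + e^{tB} Q_∞ e^{tB*}, the exponent of the
Mehler kernel is R(x) − R(w_t − x) minus half the nonnegative quadratic form of N_t = e^{tB*} Q_t⁻¹
e^{tB} at w_t − x, and N_t decays exponentially (`IsStable.mehlerKernel_eq`). An x-derivative brings
down Q_∞⁻¹ w_t + N_t (w_t − x). The Gaussian absorbs powers of ρ(w_t − x), so for t ≥ 1 both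
integrands are bounded, up to a constant, by e^{R(x)} exp(−ρ(w_t − x)²/8) (ρ(w_t) + e^{-ct}), with
an extra factor 1 + ρ(x) in the second-order case (`IsStable.exists_rieszFormula_le`). From there on
no cancellation is used: f enters the level set estimates only through the measure |f| dγ_∞ of mass
one.

The geometric input is the Lyapunov equation B Q_∞ + Q_∞ B* = −Q. It gives d/ds R(D_s x) = ½⟨Qz, z⟩
with z = Q_∞⁻¹ D_s x, so along every nonzero orbit the derivative of ρ lies between aρ and bρ
(`IsStable.isExpandingFlow`). Hence ρ(w_t) dt is dominated by dρ/a, and the time integral of the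
majorant reduces to a one-dimensional Gaussian integral and an integrable exponential, bounded
uniformly in x and u.

Let Ψ be the potential of the measure, that is, the time integral of the majorant without the
prefactors in x, integrated in u. The heart is that in the annulus r/2 ≤ ρ ≤ 2r the set {e^R Ψ > m}
has Gaussian measure O(1/(rm)) (`exists_lintegral_levelSet_le`). Each point of the annulus is
carried by the flow, within bounded time, into the shell r ≤ ρ ≤ r + 1, where it spends time at
least of order 1/r; averaging over that time costs a factor r. After a linear change of variables a
point y of the shell is fixed and s varies. Along its orbit Ψ is dominated by a comparable potential
Φ(y), so the level set condition forces e^{-R(D_s y)} < Φ(y)/m; as R grows at speed at least of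
order r² there, the Gaussian mass of that part of the orbit is O(Φ(y)/(r² m)). Finally the integral
of Φ over the unit shell is bounded independently of r.

With level e^{r²/2}, the region ρ > 2r is a Gaussian tail, and ρ < r/2 contributes only for bounded
r since Ψ is bounded (`exists_lintegral_superlevel_le`). For first order the result is 1/(λ r), with
r of order √(log λ); for second order the factor 1 + ρ(x), of size r, leaves 1/λ. Weak type follows
by scaling. -/

namespace OrnsteinUhlenbeck

variable {n : ℕ}

/-! ### Exponential decay of e^{tB} from the spectral condition on B -/

section ExponentialDecay

open scoped Matrix.Norms.Operator
open NormedSpace (exp)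

theorem exp_mulVec_of_eigenvector (A : Matrix (Fin n) (Fin n) ℂ) (z : ℂ) (v : Fin n → ℂ)
    (hv : A *ᵥ v = z • v) : exp A *ᵥ v = Complex.exp z • v := by
  have hpow : ∀ k : ℕ, (A ^ k) *ᵥ v = z ^ k • v := by
    intro k
    induction k with
    | zero => simp
    | succ k ih => rw [pow_succ, ← Matrix.mulVec_mulVec, hv, Matrix.mulVec_smul, ih, smul_smul,
        pow_succ']
  have h1 := NormedSpace.exp_series_hasSum_exp' (𝕂 := ℂ) A
  have h2 := NormedSpace.exp_series_hasSum_exp' (𝕂 := ℂ) z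
  have h3 : HasSum (fun k : ℕ => ((k.factorial : ℂ)⁻¹ • A ^ k) *ᵥ v) (exp A *ᵥ v) := by
    have hc : Continuous (fun M : Matrix (Fin n) (Fin n) ℂ => M *ᵥ v) :=
      continuous_id.matrix_mulVec continuous_const
    exact h1.map ((Matrix.mulVec.addMonoidHomLeft v)) hc
  have h4 : HasSum (fun k : ℕ => ((k.factorial : ℂ)⁻¹ • z ^ k) • v) (exp z • v) :=
    h2.smul_const v
  rw [← Complex.exp_eq_exp_ℂ] at h4
  refine h3.unique ?_
  convert h4 using 2 with k
  rw [Matrix.smul_mulVec, hpow, smul_smul, smul_eq_mul]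

/-- Since A commutes with `exp A`, it preserves the w-eigenspace of `exp A`; over ℂ the restriction
has an eigenvector, on which `exp A` acts both as w and as e^z. This is the half of the spectral
mapping theorem that is needed. -/
theorem exists_eigenvalue_of_mem_spectrum_exp (A : Matrix (Fin n) (Fin n) ℂ) (w : ℂ)
    (hw : w ∈ spectrum ℂ (exp A)) :
    ∃ z, Module.End.HasEigenvalue (Matrix.toLin' A) z ∧ w = Complex.exp z := by
  rw [← Matrix.spectrum_toLin', ← Module.End.hasEigenvalue_iff_mem_spectrum] at hw
  set W := Module.End.eigenspace (Matrix.toLin' (exp A)) w with hW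
  have hcomm : Commute A (exp A) := (Commute.refl A).exp_right
  have hmaps : ∀ x ∈ W, Matrix.toLin' A x ∈ W := by
    intro x hx
    rw [hW, Module.End.mem_eigenspace_iff] at hx ⊢
    rw [Matrix.toLin'_apply] at hx
    rw [Matrix.toLin'_apply, Matrix.toLin'_apply, Matrix.mulVec_mulVec, ← hcomm.eq,
      ← Matrix.mulVec_mulVec, hx, Matrix.mulVec_smul]
  have : Nontrivial W := Submodule.nontrivial_iff_ne_bot.2 hw
  obtain ⟨z, hz⟩ := Module.End.exists_eigenvalue ((Matrix.toLin' A).restrict hmaps)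
  obtain ⟨⟨v, hvW⟩, hv⟩ := hz.exists_hasEigenvector
  have hv0 : v ≠ 0 := fun h => hv.2 (by simpa using h)
  have hAv : Matrix.toLin' A v = z • v := by
    have := congrArg Subtype.val hv.apply_eq_smul
    simpa using this
  refine ⟨z, Module.End.hasEigenvalue_of_hasEigenvector
    (Module.End.hasEigenvector_iff.2 ⟨Module.End.mem_eigenspace_iff.2 hAv, hv0⟩), ?_⟩
  have h1 := exp_mulVec_of_eigenvector A z v (by simpa using hAv)
  rw [hW, Module.End.mem_eigenspace_iff, Matrix.toLin'_apply, h1] at hvW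
  exact (smul_left_injective ℂ hv0 hvW).symm

/-- Gelfand's formula gives ‖M^k‖ ≤ q^k with q < 1 for all large k; the finitely many remaining
powers are absorbed in the constant. -/
theorem exists_norm_pow_le (M : Matrix (Fin n) (Fin n) ℂ)
    (hM : ∀ z ∈ spectrum ℂ M, ‖z‖ < 1) :
    ∃ c : ℝ, 0 < c ∧ ∃ C : ℝ, ∀ k : ℕ, ‖M ^ k‖ ≤ C * Real.exp (-c * k) := by
  rcases Nat.eq_zero_or_pos n with rfl | hn
  · refine ⟨1, one_pos, 0, fun k => ?_⟩
    have : M ^ k = 0 := Subsingleton.elim _ _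
    simp [this]
  have : NeZero n := ⟨hn.ne'⟩
  have hlt : spectralRadius ℂ M < (1 : NNReal) :=
    spectrum.spectralRadius_lt_of_forall_lt M fun z hz => by
      simpa [← NNReal.coe_lt_coe] using hM z hz
  obtain ⟨θ, hθ1, hθ2⟩ := ENNReal.lt_iff_exists_nnreal_btwn.1 hlt
  have hθ2' : (θ : ℝ) < 1 := by exact_mod_cast hθ2
  -- The maximum with 1/2 keeps q positive, so that −log q can serve as the decay rate even for a
  -- vanishing spectral radius.
  set q : ℝ := max θ (1/2) with hq
  have hq0 : 0 < q := lt_of_lt_of_le (by norm_num) (le_max_right _ _)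
  have hq1 : q < 1 := max_lt hθ2' (by norm_num)
  have htend := spectrum.pow_norm_pow_one_div_tendsto_nhds_spectralRadius M
  have hev := htend.eventually (gt_mem_nhds hθ1)
  obtain ⟨K, hK⟩ := Filter.eventually_atTop.1 hev
  have hbound : ∀ k ≥ max K 1, ‖M ^ k‖ ≤ q ^ k := by
    intro k hk
    have hk1 : 1 ≤ k := (le_max_right _ _).trans hk
    have h1 := hK k ((le_max_left _ _).trans hk)
    rw [← ENNReal.ofReal_coe_nnreal, ENNReal.ofReal_lt_ofReal_iff_of_nonneg (by positivity)] at h1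
    have h2 : ‖M ^ k‖ ^ (1 / (k : ℝ)) ≤ q := h1.le.trans (le_max_left _ _)
    have h3 := pow_le_pow_left₀ (by positivity) h2 k
    rwa [← Real.rpow_natCast, ← Real.rpow_mul (norm_nonneg _), one_div, inv_mul_cancel₀ (by positivity),
      Real.rpow_one] at h3
  refine ⟨-Real.log q, by simpa using Real.log_neg hq0 hq1,
    1 + ∑ k ∈ Finset.range (max K 1), ‖M ^ k‖ / q ^ k, fun k => ?_⟩
  have hexp : Real.exp (-(-Real.log q) * k) = q ^ k := by
    rw [neg_neg, mul_comm, Real.exp_nat_mul, Real.exp_log hq0]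
  rw [hexp]
  have hs : ∀ s : Finset ℕ, 0 ≤ ∑ k ∈ s, ‖M ^ k‖ / q ^ k := fun s =>
    Finset.sum_nonneg fun i _ => by positivity
  rcases le_or_gt (max K 1) k with hk | hk
  · refine (hbound k hk).trans (le_mul_of_one_le_left (by positivity) ?_)
    linarith [hs (Finset.range (max K 1))]
  · rw [← div_le_iff₀ (by positivity)]
    have := Finset.single_le_sum (f := fun k => ‖M ^ k‖ / q ^ k)
      (fun i _ => by positivity) (Finset.mem_range.2 hk)
    linarith

theorem exp_add_smul (A : Matrix (Fin n) (Fin n) ℝ) (s t : ℝ) :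
    exp ((s + t) • A) = exp (s • A) * exp (t • A) := by
  rw [add_smul, Matrix.exp_add_of_commute]
  exact ((Commute.refl A).smul_left s).smul_right t

theorem hasDerivAt_exp_smul (A : Matrix (Fin n) (Fin n) ℝ) (t : ℝ) :
    HasDerivAt (fun s : ℝ => exp (s • A)) (A * exp (t • A)) t :=
  hasDerivAt_exp_smul_const' A t

theorem continuous_exp_smul (A : Matrix (Fin n) (Fin n) ℝ) :
    Continuous (fun s : ℝ => exp (s • A)) :=
  continuous_iff_continuousAt.2 fun t => (hasDerivAt_exp_smul A t).continuousAt

theorem norm_map_ofReal (A : Matrix (Fin n) (Fin n) ℝ) :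
    ‖A.map (fun r : ℝ => (r : ℂ))‖ = ‖A‖ := by
  simp [Matrix.linfty_opNorm_def]

theorem exp_map_ofReal (A : Matrix (Fin n) (Fin n) ℝ) :
    exp (A.map (fun r : ℝ => (r : ℂ))) = (exp A).map (fun r : ℝ => (r : ℂ)) := by
  have hc : Continuous (Complex.ofRealHom.mapMatrix : Matrix (Fin n) (Fin n) ℝ →+* _) :=
    continuous_id.matrix_map Complex.continuous_ofReal
  exact (NormedSpace.map_exp (Complex.ofRealHom.mapMatrix : Matrix (Fin n) (Fin n) ℝ →+* _)
    hc A).symm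

/-- If all eigenvalues of `B` have negative real parts, then `e^{tB}` decays exponentially. -/
theorem exists_norm_exp_le (B : Matrix (Fin n) (Fin n) ℝ)
    (hB : ∀ z : ℂ, Module.End.HasEigenvalue
      (Matrix.toLin' (B.map (fun r : ℝ => (r : ℂ)))) z → z.re < 0) :
    ∃ c : ℝ, 0 < c ∧ ∃ C : ℝ, 0 < C ∧ ∀ t : ℝ, 0 ≤ t → ‖exp (t • B)‖ ≤ C * Real.exp (-c * t) := by
  obtain ⟨c, hc, C, hC⟩ := exists_norm_pow_le (exp (B.map (fun r : ℝ => (r : ℂ)))) (by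
    intro w hw
    obtain ⟨z, hz, rfl⟩ := exists_eigenvalue_of_mem_spectrum_exp _ w hw
    rw [Complex.norm_exp]
    rw [← Real.exp_zero]
    exact Real.exp_lt_exp.2 (hB z hz))
  obtain ⟨M, hM⟩ := (isCompact_Icc (a := (0:ℝ)) (b := 1)).exists_bound_of_continuousOn
    (continuous_exp_smul B).continuousOn
  have hM0 : 0 ≤ M := (norm_nonneg _).trans (hM 0 (by simp))
  refine ⟨c, hc, |C| * Real.exp c * M + 1, by positivity, fun t ht => ?_⟩
  -- Integer times are powers of e^B, controlled after complexification; the fractional part stays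
  -- in the compact interval [0, 1].
  have hsplit : t • B = ((⌊t⌋₊ : ℝ) + (t - ⌊t⌋₊)) • B := by ring_nf
  have hfl := Nat.floor_le ht
  have hfl' := (Nat.lt_floor_add_one t).le
  have h1 : ‖exp ((⌊t⌋₊ : ℝ) • B)‖ ≤ C * Real.exp (-c * ⌊t⌋₊) := by
    have := hC ⌊t⌋₊
    rw [exp_map_ofReal] at this
    have h2 : exp ((⌊t⌋₊ : ℝ) • B) = exp B ^ ⌊t⌋₊ := by
      rw [← Matrix.exp_nsmul, Nat.cast_smul_eq_nsmul]
    rw [h2, ← norm_map_ofReal]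
    convert this using 2
    exact map_pow (Complex.ofRealHom.mapMatrix : Matrix (Fin n) (Fin n) ℝ →+* _) (exp B) _
  have h2 : ‖exp ((t - ⌊t⌋₊) • B)‖ ≤ M := hM _ ⟨by linarith, by linarith⟩
  have h3 : Real.exp (-c * ⌊t⌋₊) ≤ Real.exp c * Real.exp (-c * t) := by
    rw [← Real.exp_add]; apply Real.exp_le_exp.2; nlinarith
  calc ‖exp (t • B)‖ ≤ ‖exp ((⌊t⌋₊ : ℝ) • B)‖ * ‖exp ((t - ⌊t⌋₊) • B)‖ := by
        rw [hsplit, exp_add_smul]; exact norm_mul_le _ _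
    _ ≤ (|C| * (Real.exp c * Real.exp (-c * t))) * M := by
        refine mul_le_mul (h1.trans ?_) h2 (norm_nonneg _) (by positivity)
        exact mul_le_mul (le_abs_self C) h3 (Real.exp_nonneg _) (abs_nonneg C)
    _ ≤ (|C| * Real.exp c * M + 1) * Real.exp (-c * t) := by
        have := Real.exp_nonneg (-c * t)
        nlinarith

end ExponentialDecay

end OrnsteinUhlenbeck

namespace OrnsteinUhlenbeck

variable {n : ℕ}

/-! ### Covariance matrices: semigroup identity, uniform coercivity, Lyapunov equation -/

section Covariance

open scoped Matrix.Norms.Operator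
open NormedSpace (exp)

/-- The semigroup `e^{tB}` decays exponentially. -/
def IsStable (B : Matrix (Fin n) (Fin n) ℝ) : Prop :=
  ∃ c : ℝ, 0 < c ∧ ∃ C : ℝ, 0 < C ∧ ∀ t : ℝ, 0 ≤ t → ‖exp (t • B)‖ ≤ C * Real.exp (-c * t)

theorem norm_transpose_le (A : Matrix (Fin n) (Fin n) ℝ) : ‖Aᵀ‖ ≤ n * ‖A‖ := by
  rw [Matrix.linfty_opNorm_def, Matrix.linfty_opNorm_def]
  norm_cast
  refine Finset.sup_le fun i _ => ?_
  calc ∑ j, ‖Aᵀ i j‖₊ ≤ ∑ _j : Fin n, (Finset.univ : Finset (Fin n)).sup fun i => ∑ j, ‖A i j‖₊ := by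
        refine Finset.sum_le_sum fun j _ => ?_
        refine le_trans ?_ (Finset.le_sup (f := fun i => ∑ j, ‖A i j‖₊) (Finset.mem_univ j))
        exact Finset.single_le_sum (f := fun i => ‖A j i‖₊) (fun _ _ => zero_le) (Finset.mem_univ i)
    _ = _ := by simp

theorem abs_apply_le_norm (A : Matrix (Fin n) (Fin n) ℝ) (i j : Fin n) : |A i j| ≤ ‖A‖ := by
  rw [Matrix.linfty_opNorm_def, ← Real.norm_eq_abs, ← coe_nnnorm]
  norm_cast
  refine le_trans ?_ (Finset.le_sup (f := fun i => ∑ j, ‖A i j‖₊) (Finset.mem_univ i))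
  exact Finset.single_le_sum (f := fun j => ‖A i j‖₊) (fun _ _ => zero_le) (Finset.mem_univ j)

theorem exp_smul_transpose (B : Matrix (Fin n) (Fin n) ℝ) (t : ℝ) :
    exp (t • Bᵀ) = (exp (t • B))ᵀ := by
  rw [← Matrix.exp_transpose, Matrix.transpose_smul]

theorem exp_smul_mul_neg (B : Matrix (Fin n) (Fin n) ℝ) (t : ℝ) :
    exp (t • B) * exp ((-t) • B) = 1 := by
  rw [← exp_add_smul]; simp

theorem exp_neg_smul_mul (B : Matrix (Fin n) (Fin n) ℝ) (t : ℝ) :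
    exp ((-t) • B) * exp (t • B) = 1 := by
  rw [← exp_add_smul]; simp

theorem continuous_covarianceIntegrand (Q B : Matrix (Fin n) (Fin n) ℝ) :
    Continuous fun s : ℝ => exp (s • B) * Q * exp (s • Bᵀ) :=
  ((continuous_exp_smul B).mul continuous_const).mul (continuous_exp_smul Bᵀ)

theorem IsStable.exists_norm_conj_le {B : Matrix (Fin n) (Fin n) ℝ} (hB : IsStable B)
    (Q : Matrix (Fin n) (Fin n) ℝ) :
    ∃ c : ℝ, 0 < c ∧ ∃ C : ℝ, ∀ t : ℝ, 0 ≤ t →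
      ‖exp (t • B) * Q * exp (t • Bᵀ)‖ ≤ C * Real.exp (-c * t) := by
  obtain ⟨c, hc, C, hC0, hC⟩ := hB
  refine ⟨2 * c, by positivity, C * ‖Q‖ * (n * C), fun t ht => ?_⟩
  have h1 := hC t ht
  have h2 : ‖exp (t • Bᵀ)‖ ≤ n * (C * Real.exp (-c * t)) := by
    rw [exp_smul_transpose]
    exact (norm_transpose_le _).trans (by gcongr)
  have h3 : Real.exp (-(2 * c) * t) = Real.exp (-c * t) * Real.exp (-c * t) := by
    rw [← Real.exp_add]; ring_nf
  calc _ ≤ ‖exp (t • B)‖ * ‖Q‖ * ‖exp (t • Bᵀ)‖ :=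
        (norm_mul_le _ _).trans (by gcongr; exact norm_mul_le _ _)
    _ ≤ (C * Real.exp (-c * t)) * ‖Q‖ * (n * (C * Real.exp (-c * t))) := by gcongr
    _ = _ := by rw [h3]; ring

theorem IsStable.integrableOn {B : Matrix (Fin n) (Fin n) ℝ} (hB : IsStable B)
    (Q : Matrix (Fin n) (Fin n) ℝ) (k l : Fin n) :
    IntegrableOn (fun s : ℝ => (exp (s • B) * Q * exp (s • Bᵀ)) k l) (Set.Ioi 0) := by
  obtain ⟨c, hc, C, hC⟩ := hB.exists_norm_conj_le Q
  have hi : IntegrableOn (fun s : ℝ => C * Real.exp (-c * s)) (Set.Ioi 0) :=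
    (integrableOn_exp_mul_Ioi (neg_lt_zero.2 hc) 0).const_mul C
  refine Integrable.mono' hi
    ((continuous_covarianceIntegrand Q B).matrix_elem k l).aestronglyMeasurable ?_
  filter_upwards [ae_restrict_mem measurableSet_Ioi] with s hs
  exact (abs_apply_le_norm _ k l).trans (hC s (le_of_lt hs))

theorem mul_integral_mul {S : Set ℝ} (M N : Matrix (Fin n) (Fin n) ℝ)
    (F : ℝ → Matrix (Fin n) (Fin n) ℝ)
    (hF : ∀ k l, IntegrableOn (fun s => F s k l) S) (k l : Fin n) :
    (M * (Matrix.of fun k l => ∫ s in S, F s k l) * N) k l = ∫ s in S, (M * F s * N) k l := by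
  simp only [Matrix.mul_apply, Matrix.of_apply]
  rw [integral_finsetSum]
  · refine Finset.sum_congr rfl fun j _ => ?_
    rw [integral_mul_const, integral_finsetSum]
    · simp_rw [integral_const_mul]
    · exact fun i _ => (hF i j).const_mul _
  · exact fun j _ => (integrable_finsetSum _ fun i _ => (hF i j).const_mul _).mul_const _

theorem dotProduct_integral_mulVec {S : Set ℝ} (F : ℝ → Matrix (Fin n) (Fin n) ℝ)
    (hF : ∀ k l, IntegrableOn (fun s => F s k l) S) (x y : Fin n → ℝ) :
    x ⬝ᵥ ((Matrix.of fun k l => ∫ s in S, F s k l) *ᵥ y) = ∫ s in S, x ⬝ᵥ (F s *ᵥ y) := by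
  simp only [dotProduct, Matrix.mulVec, Matrix.of_apply]
  rw [integral_finsetSum]
  · refine Finset.sum_congr rfl fun j _ => ?_
    rw [integral_const_mul, integral_finsetSum]
    · simp_rw [integral_mul_const]
    · exact fun i _ => (hF j i).mul_const _
  · exact fun j _ => (integrable_finsetSum _ fun i _ => (hF j i).mul_const _).const_mul _

/-- Split the integral at t and translate the tail by t. All later algebra linking Q_t and Q_∞ rests
on this identity. -/
theorem IsStable.covarianceInf_eq {B : Matrix (Fin n) (Fin n) ℝ} (hB : IsStable B)
    (Q : Matrix (Fin n) (Fin n) ℝ) {t : ℝ} (ht : 0 ≤ t) :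
    covarianceInf Q B = covariance Q B t + exp (t • B) * covarianceInf Q B * exp (t • Bᵀ) := by
  ext k l
  have hint := hB.integrableOn Q
  have h1 : (exp (t • B) * covarianceInf Q B * exp (t • Bᵀ)) k l
      = ∫ s in Set.Ioi t, (exp (s • B) * Q * exp (s • Bᵀ)) k l := by
    rw [covarianceInf, mul_integral_mul _ _ _ hint]
    have h2 := (measurePreserving_add_right (volume : Measure ℝ) t).setIntegral_preimage_emb
      (measurableEmbedding_addRight t)
      (fun s : ℝ => (exp (s • B) * Q * exp (s • Bᵀ)) k l) (Set.Ioi t)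
    rw [Set.preimage_add_const_Ioi, sub_self] at h2
    rw [← h2]
    refine integral_congr_ae (Filter.Eventually.of_forall fun s => ?_)
    simp only [add_comm s t]
    rw [exp_add_smul B, add_comm t s, exp_add_smul Bᵀ]
    simp only [Matrix.mul_assoc]
  rw [Matrix.add_apply, h1]
  simp only [covarianceInf, covariance, Matrix.of_apply]
  rw [← setIntegral_union _ measurableSet_Ioi, Set.Ioc_union_Ioi_eq_Ioi ht]
  · exact (hint k l).mono_set Set.Ioc_subset_Ioi_self
  · exact (hint k l).mono_set (Set.Ioi_subset_Ioi ht)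
  · exact Set.Ioc_disjoint_Ioi le_rfl

theorem exists_le_dotProduct_mulVec {A : Matrix (Fin n) (Fin n) ℝ} (hA : A.PosDef) :
    ∃ c : ℝ, 0 < c ∧ ∀ x : Fin n → ℝ, c * ‖x‖ ^ 2 ≤ x ⬝ᵥ (A *ᵥ x) := by
  have hcont : Continuous fun x : Fin n → ℝ => x ⬝ᵥ (A *ᵥ x) :=
    continuous_id.dotProduct (continuous_const.matrix_mulVec continuous_id)
  rcases (Metric.sphere (0 : Fin n → ℝ) 1).eq_empty_or_nonempty with hS | hS
  · refine ⟨1, one_pos, fun x => ?_⟩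
    by_cases hx : x = 0
    · simp [hx]
    · exfalso
      have : (‖x‖⁻¹ • x) ∈ Metric.sphere (0 : Fin n → ℝ) 1 := by
        simp [norm_smul, hx]
      rw [hS] at this; exact this
  obtain ⟨x₀, hx₀, hmin⟩ := (isCompact_sphere (0 : Fin n → ℝ) 1).exists_isMinOn hS
    hcont.continuousOn
  have hx₀0 : x₀ ≠ 0 := by
    rintro rfl; simp at hx₀
  refine ⟨_, by simpa using hA.dotProduct_mulVec_pos hx₀0, fun x => ?_⟩
  by_cases hx : x = 0
  · simp [hx]
  have hn : 0 < ‖x‖ := norm_pos_iff.2 hx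
  have h1 := hmin (show (‖x‖⁻¹ • x) ∈ Metric.sphere (0 : Fin n → ℝ) 1 by simp [norm_smul, hx])
  simp only [Set.mem_ofPred_eq, Matrix.mulVec_smul, dotProduct_smul, smul_dotProduct,
    smul_eq_mul] at h1
  calc _ ≤ (‖x‖⁻¹ * (‖x‖⁻¹ * x ⬝ᵥ (A *ᵥ x))) * ‖x‖ ^ 2 := by gcongr
    _ = _ := by field_simp

theorem abs_dotProduct_le (x y : Fin n → ℝ) : |x ⬝ᵥ y| ≤ n * (‖x‖ * ‖y‖) := by
  calc |x ⬝ᵥ y| ≤ ∑ i, |x i * y i| := Finset.abs_sum_le_sum_abs _ _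
    _ ≤ ∑ _i : Fin n, ‖x‖ * ‖y‖ := by
        refine Finset.sum_le_sum fun i _ => ?_
        rw [abs_mul]
        exact mul_le_mul (norm_le_pi_norm x i) (norm_le_pi_norm y i) (abs_nonneg _) (norm_nonneg _)
    _ = _ := by simp

theorem dotProduct_conj_mulVec (M Q : Matrix (Fin n) (Fin n) ℝ) (x y : Fin n → ℝ) :
    x ⬝ᵥ ((M * Q * Mᵀ) *ᵥ y) = (Mᵀ *ᵥ x) ⬝ᵥ (Q *ᵥ (Mᵀ *ᵥ y)) := by
  rw [← Matrix.mulVec_mulVec, ← Matrix.mulVec_mulVec, Matrix.dotProduct_mulVec,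
    ← Matrix.mulVec_transpose]

/-- Only the times in (0, 1] are used for the lower bound, where e^{sB*} has a bounded inverse. The
constant is therefore the same for Q_∞ and for every Q_t with t ≥ 1, which makes the later kernel
bounds uniform in t. -/
theorem IsStable.exists_le_dotProduct_integral {Q B : Matrix (Fin n) (Fin n) ℝ}
    (hB : IsStable B) (hQ : Q.PosDef) :
    ∃ c : ℝ, 0 < c ∧ ∀ S : Set ℝ, Set.Ioc 0 1 ⊆ S → S ⊆ Set.Ioi 0 → ∀ x : Fin n → ℝ,
      c * ‖x‖ ^ 2 ≤ x ⬝ᵥ ((Matrix.of fun k l =>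
        ∫ s in S, (exp (s • B) * Q * exp (s • Bᵀ)) k l) *ᵥ x) := by
  obtain ⟨c, hc, hcQ⟩ := exists_le_dotProduct_mulVec hQ
  obtain ⟨M, hM⟩ := (isCompact_Icc (a := (0:ℝ)) (b := 1)).exists_bound_of_continuousOn
    ((continuous_exp_smul Bᵀ).comp continuous_neg).continuousOn
  have hM0 : 0 ≤ M := (norm_nonneg _).trans (hM 0 (by simp))
  refine ⟨c / (M + 1) ^ 2, by positivity, fun S hS1 hS2 x => ?_⟩
  have hint : ∀ k l, IntegrableOn (fun s : ℝ => (exp (s • B) * Q * exp (s • Bᵀ)) k l) S :=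
    fun k l => (hB.integrableOn Q k l).mono_set hS2
  rw [dotProduct_integral_mulVec _ hint]
  have hlow : ∀ s : ℝ, c * ‖exp (s • Bᵀ) *ᵥ x‖ ^ 2
      ≤ x ⬝ᵥ ((exp (s • B) * Q * exp (s • Bᵀ)) *ᵥ x) := by
    intro s
    rw [exp_smul_transpose, dotProduct_conj_mulVec]
    exact hcQ _
  have hi : IntegrableOn (fun s : ℝ => x ⬝ᵥ ((exp (s • B) * Q * exp (s • Bᵀ)) *ᵥ x)) S := by
    simp only [dotProduct, Matrix.mulVec]
    exact integrable_finsetSum _ fun i _ =>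
      (integrable_finsetSum _ fun j _ => (hint i j).mul_const _).const_mul _
  calc c / (M + 1) ^ 2 * ‖x‖ ^ 2 = ∫ s in Set.Ioc (0:ℝ) 1, c / (M + 1) ^ 2 * ‖x‖ ^ 2 := by simp
    _ ≤ ∫ s in Set.Ioc (0:ℝ) 1, x ⬝ᵥ ((exp (s • B) * Q * exp (s • Bᵀ)) *ᵥ x) := by
        refine setIntegral_mono_on (integrableOn_const (by simp)) (hi.mono_set hS1) measurableSet_Ioc fun s hs => ?_
        refine le_trans ?_ (hlow s)
        have h1 : ‖x‖ ≤ (M + 1) * ‖exp (s • Bᵀ) *ᵥ x‖ := by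
          calc ‖x‖ = ‖exp ((-s) • Bᵀ) *ᵥ (exp (s • Bᵀ) *ᵥ x)‖ := by
                rw [Matrix.mulVec_mulVec, exp_neg_smul_mul, Matrix.one_mulVec]
            _ ≤ ‖exp ((-s) • Bᵀ)‖ * ‖exp (s • Bᵀ) *ᵥ x‖ := Matrix.linfty_opNorm_mulVec _ _
            _ ≤ _ := by
                gcongr
                exact (hM s ⟨hs.1.le, hs.2⟩).trans (by linarith)
        calc c / (M + 1) ^ 2 * ‖x‖ ^ 2
            ≤ c / (M + 1) ^ 2 * ((M + 1) * ‖exp (s • Bᵀ) *ᵥ x‖) ^ 2 := by gcongr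
          _ = _ := by field_simp
    _ ≤ _ := by
        refine setIntegral_mono_set hi (Filter.Eventually.of_forall fun s => ?_)
          (Filter.Eventually.of_forall hS1)
        exact le_trans (by positivity) (hlow s)

theorem conj_transpose {Q : Matrix (Fin n) (Fin n) ℝ} (hQ : Qᵀ = Q)
    (B : Matrix (Fin n) (Fin n) ℝ) (s : ℝ) :
    (exp (s • B) * Q * exp (s • Bᵀ))ᵀ = exp (s • B) * Q * exp (s • Bᵀ) := by
  rw [exp_smul_transpose, Matrix.transpose_mul, Matrix.transpose_mul, hQ,
    Matrix.transpose_transpose, Matrix.mul_assoc]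

theorem covariance_transpose {Q : Matrix (Fin n) (Fin n) ℝ} (hQ : Qᵀ = Q)
    (B : Matrix (Fin n) (Fin n) ℝ) (t : ℝ) : (covariance Q B t)ᵀ = covariance Q B t := by
  ext k l
  simp only [covariance, Matrix.transpose_apply, Matrix.of_apply]
  refine integral_congr_ae (Filter.Eventually.of_forall fun s => ?_)
  simp only
  conv_lhs => rw [← conj_transpose hQ, Matrix.transpose_apply]

theorem covarianceInf_transpose {Q : Matrix (Fin n) (Fin n) ℝ} (hQ : Qᵀ = Q)
    (B : Matrix (Fin n) (Fin n) ℝ) : (covarianceInf Q B)ᵀ = covarianceInf Q B := by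
  ext k l
  simp only [covarianceInf, Matrix.transpose_apply, Matrix.of_apply]
  refine integral_congr_ae (Filter.Eventually.of_forall fun s => ?_)
  simp only
  conv_lhs => rw [← conj_transpose hQ, Matrix.transpose_apply]

theorem posDef_of_le {A : Matrix (Fin n) (Fin n) ℝ} (hA : Aᵀ = A) {c : ℝ} (hc : 0 < c)
    (h : ∀ x : Fin n → ℝ, c * ‖x‖ ^ 2 ≤ x ⬝ᵥ (A *ᵥ x)) : A.PosDef := by
  refine Matrix.PosDef.of_dotProduct_mulVec_pos (by rw [Matrix.IsHermitian, Matrix.conjTranspose_eq_transpose_of_trivial, hA]) fun x hx => ?_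
  have := norm_pos_iff.2 hx
  simpa using lt_of_lt_of_le (by positivity) (h x)

theorem posDef_transpose_eq {Q : Matrix (Fin n) (Fin n) ℝ} (hQ : Q.PosDef) : Qᵀ = Q := by
  simpa using hQ.isHermitian.eq

theorem IsStable.posDef_covarianceInf {Q B : Matrix (Fin n) (Fin n) ℝ}
    (hB : IsStable B) (hQ : Q.PosDef) : (covarianceInf Q B).PosDef := by
  obtain ⟨c, hc, h⟩ := hB.exists_le_dotProduct_integral hQ
  exact posDef_of_le (covarianceInf_transpose (posDef_transpose_eq hQ) B) hc
    (h _ Set.Ioc_subset_Ioi_self subset_rfl)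

theorem IsStable.posDef_covariance {Q B : Matrix (Fin n) (Fin n) ℝ}
    (hB : IsStable B) (hQ : Q.PosDef) {t : ℝ} (ht : 1 ≤ t) : (covariance Q B t).PosDef := by
  obtain ⟨c, hc, h⟩ := hB.exists_le_dotProduct_integral hQ
  exact posDef_of_le (covariance_transpose (posDef_transpose_eq hQ) B t) hc
    (h _ (Set.Ioc_subset_Ioc_right ht) Set.Ioc_subset_Ioi_self)

/-- The Lyapunov equation for `Q_∞`. -/
theorem IsStable.lyapunov {B : Matrix (Fin n) (Fin n) ℝ} (hB : IsStable B)
    (Q : Matrix (Fin n) (Fin n) ℝ) :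
    B * covarianceInf Q B + covarianceInf Q B * Bᵀ = -Q := by
  ext k l
  have hint := hB.integrableOn Q
  have h1 := mul_integral_mul B 1 _ hint k l
  have h2 := mul_integral_mul 1 Bᵀ _ hint k l
  simp only [Matrix.mul_one, Matrix.one_mul] at h1 h2
  rw [Matrix.add_apply, covarianceInf, h1, h2]
  have hi1 : IntegrableOn (fun s : ℝ => (B * (exp (s • B) * Q * exp (s • Bᵀ))) k l) (Set.Ioi 0) := by
    have := integrable_finsetSum Finset.univ fun j _ => (hint j l).const_mul (B k j)
    exact this
  have hi2 : IntegrableOn (fun s : ℝ => (exp (s • B) * Q * exp (s • Bᵀ) * Bᵀ) k l) (Set.Ioi 0) := by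
    have := integrable_finsetSum Finset.univ fun j _ => (hint k j).mul_const (Bᵀ j l)
    exact this
  refine (integral_add hi1 hi2).symm.trans ?_
  -- The integrand is the derivative of e^{sB} Q e^{sB*}, which runs from Q at s = 0 to 0 at
  -- infinity.
  have hderiv : ∀ s : ℝ, HasDerivAt (fun s : ℝ => (exp (s • B) * Q * exp (s • Bᵀ)) k l)
      ((B * (exp (s • B) * Q * exp (s • Bᵀ))) k l
        + (exp (s • B) * Q * exp (s • Bᵀ) * Bᵀ) k l) s := by
    intro s
    have h := ((hasDerivAt_exp_smul B s).mul_const Q).mul (hasDerivAt_exp_smul Bᵀ s)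
    have h' := (hasDerivAt_pi.1 ((hasDerivAt_pi.1 h) k)) l
    refine HasDerivAt.congr_deriv h' ?_
    rw [← Matrix.add_apply]
    have hcomm : Commute Bᵀ (exp (s • Bᵀ)) := ((Commute.refl Bᵀ).smul_right s).exp_right
    rw [hcomm.eq]
    simp only [Matrix.mul_assoc]
  have htend : Filter.Tendsto (fun s : ℝ => (exp (s • B) * Q * exp (s • Bᵀ)) k l) Filter.atTop
      (nhds 0) := by
    obtain ⟨c, hc, C, hC⟩ := hB.exists_norm_conj_le Q
    have h0 : Filter.Tendsto (fun s : ℝ => C * Real.exp (-c * s)) Filter.atTop (nhds 0) := by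
      have h3 : Filter.Tendsto (fun s : ℝ => -c * s) Filter.atTop Filter.atBot :=
        Filter.tendsto_id.const_mul_atTop_of_neg (neg_lt_zero.2 hc)
      simpa using (Real.tendsto_exp_atBot.comp h3).const_mul C
    refine squeeze_zero_norm' ?_ h0
    filter_upwards [Filter.eventually_ge_atTop 0] with s hs
    exact (abs_apply_le_norm _ k l).trans (hC s hs)
  rw [integral_Ioi_of_hasDerivAt_of_tendsto' (fun s _ => hderiv s) (hi1.add hi2) htend]
  simp

end Covariance

end OrnsteinUhlenbeck

/-! ### Exponential expansion of ρ by the flow D_t -/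

namespace OrnsteinUhlenbeck

variable {n : ℕ}


/-- A one-parameter group of matrices that expands the norm-like function `ρ` at an exponential
rate between `a` and `b`. -/
structure IsExpandingFlow (ρ : (Fin n → ℝ) → ℝ) (D : ℝ → Matrix (Fin n) (Fin n) ℝ) (a b : ℝ) :
    Prop where
  pos_left : 0 < a
  left_le_right : a ≤ b
  continuous_norm : Continuous ρ
  norm_zero : ρ 0 = 0
  norm_neg : ∀ x, ρ (-x) = ρ x
  norm_add_le : ∀ x y, ρ (x + y) ≤ ρ x + ρ y
  exists_le_norm : ∃ c : ℝ, 0 < c ∧ ∀ x, c * ‖x‖ ≤ ρ x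
  continuous_flow : Continuous D
  flow_zero : D 0 = 1
  flow_add : ∀ s t, D (s + t) = D s * D t
  exists_hasDerivAt : ∀ x, x ≠ 0 → ∀ s, ∃ d, HasDerivAt (fun s => ρ (D s *ᵥ x)) d s ∧
    a * ρ (D s *ᵥ x) ≤ d ∧ d ≤ b * ρ (D s *ᵥ x)

/-- The norm `ρ(x) = ⟨Q_∞⁻¹ x, x⟩^{1/2}`. -/
noncomputable def rho (Q B : Matrix (Fin n) (Fin n) ℝ) (x : Fin n → ℝ) : ℝ :=
  Real.sqrt (2 * quadForm Q B x)

section GramFactorization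

open scoped MatrixOrder Matrix.Norms.L2Operator

/-- Kept apart because the C*-algebra structure requires the L² operator norm on matrices, whereas
the surrounding sections use the ℓ^∞ operator norm. -/
theorem exists_eq_conjTranspose_mul_self {G : Matrix (Fin n) (Fin n) ℝ} (hG : G.PosDef) :
    ∃ S : Matrix (Fin n) (Fin n) ℝ, G = Sᴴ * S :=
  CStarAlgebra.nonneg_iff_eq_star_mul_self.mp hG.posSemidef.nonneg

end GramFactorization

section Flow

open scoped Matrix.Norms.Operator
open NormedSpace (exp)

/-- This presents ρ as a Euclidean norm after a linear map, which is where its triangle inequality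
comes from. -/
theorem exists_sqrt_dotProduct_eq_norm {G : Matrix (Fin n) (Fin n) ℝ} (hG : G.PosDef) :
    ∃ S : Matrix (Fin n) (Fin n) ℝ, ∀ x : Fin n → ℝ,
      (G *ᵥ x) ⬝ᵥ x = ‖WithLp.toLp 2 (S *ᵥ x)‖ ^ 2 := by
  obtain ⟨S, hS⟩ := exists_eq_conjTranspose_mul_self hG
  refine ⟨S, fun x => ?_⟩
  rw [EuclideanSpace.norm_sq_eq, hS, ← Matrix.mulVec_mulVec, dotProduct_comm,
    Matrix.dotProduct_mulVec, Matrix.vecMul_conjTranspose]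
  simp [dotProduct, sq]

variable {Q B : Matrix (Fin n) (Fin n) ℝ}

theorem IsStable.posDef_inv (hB : IsStable B) (hQ : Q.PosDef) : (covarianceInf Q B)⁻¹.PosDef :=
  (hB.posDef_covarianceInf hQ).inv

theorem IsStable.isUnit_det (hB : IsStable B) (hQ : Q.PosDef) : IsUnit (covarianceInf Q B).det :=
  (hB.posDef_covarianceInf hQ).det_pos.ne'.isUnit

theorem IsStable.quadForm_nonneg (hB : IsStable B) (hQ : Q.PosDef) (x : Fin n → ℝ) :
    0 ≤ quadForm Q B x := by
  obtain ⟨S, hS⟩ := exists_sqrt_dotProduct_eq_norm (hB.posDef_inv hQ)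
  rw [quadForm, hS]; positivity

theorem IsStable.rho_sq (hB : IsStable B) (hQ : Q.PosDef) (x : Fin n → ℝ) :
    rho Q B x ^ 2 = 2 * quadForm Q B x :=
  Real.sq_sqrt (by have := hB.quadForm_nonneg hQ x; positivity)

theorem continuous_quadForm : Continuous (quadForm Q B) :=
  continuous_const.mul ((continuous_const.matrix_mulVec continuous_id).dotProduct continuous_id)

theorem IsStable.exists_rho_eq (hB : IsStable B) (hQ : Q.PosDef) :
    ∃ S : Matrix (Fin n) (Fin n) ℝ, ∀ x, rho Q B x = ‖WithLp.toLp 2 (S *ᵥ x)‖ := by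
  obtain ⟨S, hS⟩ := exists_sqrt_dotProduct_eq_norm (hB.posDef_inv hQ)
  refine ⟨S, fun x => ?_⟩
  rw [rho, quadForm, ← mul_assoc, hS]
  norm_num

theorem IsStable.exists_le_rho (hB : IsStable B) (hQ : Q.PosDef) :
    ∃ c : ℝ, 0 < c ∧ ∀ x, c * ‖x‖ ≤ rho Q B x := by
  obtain ⟨c, hc, h⟩ := exists_le_dotProduct_mulVec (hB.posDef_inv hQ)
  refine ⟨Real.sqrt c, by positivity, fun x => ?_⟩
  refine Real.le_sqrt_of_sq_le ?_
  rw [mul_pow, Real.sq_sqrt hc.le, quadForm, ← mul_assoc, dotProduct_comm]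
  simpa using h x

theorem IsStable.flow_zero (hB : IsStable B) (hQ : Q.PosDef) : flow Q B 0 = 1 := by
  simp [flow, Matrix.mul_nonsing_inv _ (hB.isUnit_det hQ)]

theorem IsStable.flow_add (hB : IsStable B) (hQ : Q.PosDef) (s t : ℝ) :
    flow Q B (s + t) = flow Q B s * flow Q B t := by
  have h := Matrix.nonsing_inv_mul _ (hB.isUnit_det hQ)
  have h' : ∀ M : Matrix (Fin n) (Fin n) ℝ, (covarianceInf Q B)⁻¹ * (covarianceInf Q B * M) = M :=
    fun M => by rw [← Matrix.mul_assoc, h, Matrix.one_mul]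
  simp only [flow, neg_add, exp_add_smul, Matrix.mul_assoc, h']

theorem continuous_flow : Continuous (flow Q B) :=
  (continuous_const.mul ((continuous_exp_smul Bᵀ).comp continuous_neg)).mul continuous_const

theorem IsStable.hasDerivAt_flow (hB : IsStable B) (hQ : Q.PosDef) (x : Fin n → ℝ) (s : ℝ) :
    HasDerivAt (fun s => flow Q B s *ᵥ x)
      (-(covarianceInf Q B *ᵥ (Bᵀ *ᵥ ((covarianceInf Q B)⁻¹ *ᵥ (flow Q B s *ᵥ x))))) s := by
  have h1 := ((hasDerivAt_exp_smul Bᵀ (-s)).scomp s (hasDerivAt_neg s))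
  have h2 := (h1.const_mul (covarianceInf Q B)).mul_const (covarianceInf Q B)⁻¹
  let L : Matrix (Fin n) (Fin n) ℝ →L[ℝ] (Fin n → ℝ) :=
    LinearMap.toContinuousLinearMap
      { toFun := fun M => M *ᵥ x
        map_add' := fun M N => Matrix.add_mulVec M N x
        map_smul' := fun c M => Matrix.smul_mulVec c M x }
  have h3 := L.hasFDerivAt.comp_hasDerivAt s h2
  refine HasDerivAt.congr_deriv h3 ?_
  change (covarianceInf Q B * ((-1 : ℝ) • (Bᵀ * exp ((-s) • Bᵀ))) * (covarianceInf Q B)⁻¹) *ᵥ x = _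
  have h := Matrix.nonsing_inv_mul _ (hB.isUnit_det hQ)
  have h' : ∀ M : Matrix (Fin n) (Fin n) ℝ, (covarianceInf Q B)⁻¹ * (covarianceInf Q B * M) = M :=
    fun M => by rw [← Matrix.mul_assoc, h, Matrix.one_mul]
  simp only [Matrix.mulVec_mulVec, flow, Matrix.mul_assoc, h', neg_smul, one_smul,
    Matrix.neg_mul, Matrix.mul_neg, Matrix.neg_mulVec]

theorem dotProduct_mulVec_comm {A : Matrix (Fin n) (Fin n) ℝ} (hA : Aᵀ = A) (x y : Fin n → ℝ) :
    (A *ᵥ x) ⬝ᵥ y = (A *ᵥ y) ⬝ᵥ x := by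
  rw [dotProduct_comm, Matrix.dotProduct_mulVec, ← Matrix.mulVec_transpose, hA]

theorem IsStable.inv_transpose (hQ : Q.PosDef) :
    ((covarianceInf Q B)⁻¹)ᵀ = (covarianceInf Q B)⁻¹ := by
  rw [Matrix.transpose_nonsing_inv, covarianceInf_transpose (posDef_transpose_eq hQ)]

/-- With z = Q_∞⁻¹ D_s x the chain rule gives −⟨z, Q_∞ B* z⟩. Symmetrizing turns this into −½⟨z, (B
Q_∞ + Q_∞ B*) z⟩, and the Lyapunov equation makes it ½⟨z, Qz⟩, a positive quantity whatever the
symmetric part of B. -/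
theorem IsStable.hasDerivAt_quadForm_flow (hB : IsStable B) (hQ : Q.PosDef) (x : Fin n → ℝ)
    (s : ℝ) :
    HasDerivAt (fun s => quadForm Q B (flow Q B s *ᵥ x))
      (1 / 2 * (((covarianceInf Q B)⁻¹ *ᵥ (flow Q B s *ᵥ x)) ⬝ᵥ
        (Q *ᵥ ((covarianceInf Q B)⁻¹ *ᵥ (flow Q B s *ᵥ x))))) s := by
  set G := (covarianceInf Q B)⁻¹ with hG
  have hGT : Gᵀ = G := inv_transpose hQ
  have h1 := hB.hasDerivAt_flow hQ x s
  rw [← hG] at h1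
  set y := flow Q B s *ᵥ x with hy
  set y' := -(covarianceInf Q B *ᵥ (Bᵀ *ᵥ (G *ᵥ y))) with hy'
  have hGy : HasDerivAt (fun s => G *ᵥ (flow Q B s *ᵥ x)) (G *ᵥ y') s := by
    let L : (Fin n → ℝ) →L[ℝ] (Fin n → ℝ) := LinearMap.toContinuousLinearMap (Matrix.mulVecLin G)
    exact L.hasFDerivAt.comp_hasDerivAt s h1
  have hdot : HasDerivAt (fun s => (G *ᵥ (flow Q B s *ᵥ x)) ⬝ᵥ (flow Q B s *ᵥ x))
      ((G *ᵥ y') ⬝ᵥ y + (G *ᵥ y) ⬝ᵥ y') s := by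
    simp only [dotProduct]
    rw [← Finset.sum_add_distrib]
    exact HasDerivAt.fun_sum fun i _ => ((hasDerivAt_pi.1 hGy) i).mul ((hasDerivAt_pi.1 h1) i)
  refine (hdot.const_mul (1 / 2)).congr_deriv ?_
  rw [dotProduct_mulVec_comm hGT y' y, hy']
  set z := G *ᵥ y
  set P := covarianceInf Q B with hP
  have hPT : Pᵀ = P := covarianceInf_transpose (posDef_transpose_eq hQ) B
  have hly : (B * P + P * Bᵀ) = -Q := hB.lyapunov Q
  have h3 : z ⬝ᵥ ((B * P) *ᵥ z) = z ⬝ᵥ ((P * Bᵀ) *ᵥ z) := by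
    rw [Matrix.dotProduct_mulVec, ← Matrix.mulVec_transpose, Matrix.transpose_mul, hPT,
      dotProduct_comm]
  have h4 : z ⬝ᵥ ((B * P + P * Bᵀ) *ᵥ z) = z ⬝ᵥ ((-Q) *ᵥ z) := by rw [hly]
  rw [Matrix.add_mulVec, dotProduct_add, h3, Matrix.neg_mulVec, dotProduct_neg] at h4
  rw [Matrix.mulVec_mulVec, dotProduct_neg]
  linarith

/-- Both ρ² = ⟨Q_∞ z, z⟩ and the derivative ½⟨Qz, z⟩ of R are comparable to ‖z‖², hence to each
other; dividing by ρ bounds the logarithmic derivative of ρ from both sides. -/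
theorem IsStable.isExpandingFlow (hB : IsStable B) (hQ : Q.PosDef) :
    ∃ a b : ℝ, IsExpandingFlow (rho Q B) (flow Q B) a b := by
  obtain ⟨c₁, hc₁, hQlow⟩ := exists_le_dotProduct_mulVec hQ
  obtain ⟨c₂, hc₂, hPlow⟩ := exists_le_dotProduct_mulVec (hB.posDef_covarianceInf hQ)
  have hup : ∀ (A : Matrix (Fin n) (Fin n) ℝ) (z : Fin n → ℝ),
      z ⬝ᵥ (A *ᵥ z) ≤ n * ‖A‖ * ‖z‖ ^ 2 := fun A z => by
    refine (le_abs_self _).trans ((abs_dotProduct_le _ _).trans ?_)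
    calc n * (‖z‖ * ‖A *ᵥ z‖) ≤ n * (‖z‖ * (‖A‖ * ‖z‖)) := by
          gcongr; exact Matrix.linfty_opNorm_mulVec _ _
      _ = _ := by ring
  have hsq : ∀ y, rho Q B y ^ 2 = ((covarianceInf Q B)⁻¹ *ᵥ y) ⬝ᵥ
      (covarianceInf Q B *ᵥ ((covarianceInf Q B)⁻¹ *ᵥ y)) := fun y => by
    rw [hB.rho_sq hQ, quadForm, Matrix.mulVec_mulVec, Matrix.mul_nonsing_inv _ (hB.isUnit_det hQ),
      Matrix.one_mulVec]
    ring
  set KP := n * ‖covarianceInf Q B‖ + 1 with hKP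
  set KQ := n * ‖Q‖ + 1 with hKQ
  have hKP0 : 0 < KP := by positivity
  have hKQ0 : 0 < KQ := by positivity
  have hlow : ∀ y, c₁ / (2 * KP) * rho Q B y ^ 2 ≤ 1 / 2 * (((covarianceInf Q B)⁻¹ *ᵥ y) ⬝ᵥ
        (Q *ᵥ ((covarianceInf Q B)⁻¹ *ᵥ y))) := fun y => by
    rw [hsq]
    set z := (covarianceInf Q B)⁻¹ *ᵥ y
    have h1 : z ⬝ᵥ (covarianceInf Q B *ᵥ z) ≤ KP * ‖z‖ ^ 2 :=
      (hup _ z).trans (by gcongr; simp [hKP])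
    calc _ ≤ c₁ / (2 * KP) * (KP * ‖z‖ ^ 2) := by gcongr
      _ = 1 / 2 * (c₁ * ‖z‖ ^ 2) := by field_simp
      _ ≤ _ := by gcongr; exact hQlow z
  have hupp : ∀ y, 1 / 2 * (((covarianceInf Q B)⁻¹ *ᵥ y) ⬝ᵥ
        (Q *ᵥ ((covarianceInf Q B)⁻¹ *ᵥ y))) ≤ KQ / (2 * c₂) * rho Q B y ^ 2 := fun y => by
    rw [hsq]
    set z := (covarianceInf Q B)⁻¹ *ᵥ y
    have h1 : z ⬝ᵥ (Q *ᵥ z) ≤ KQ * ‖z‖ ^ 2 := (hup _ z).trans (by gcongr; simp [hKQ])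
    calc _ ≤ 1 / 2 * (KQ * ‖z‖ ^ 2) := by gcongr
      _ = KQ / (2 * c₂) * (c₂ * ‖z‖ ^ 2) := by field_simp
      _ ≤ _ := by gcongr; exact hPlow z
  obtain ⟨c, hc, hclow⟩ := hB.exists_le_rho hQ
  obtain ⟨S, hS⟩ := hB.exists_rho_eq hQ
  -- The minimum gives a ≤ b without comparing the two constants.
  refine ⟨min (c₁ / (2 * KP)) (KQ / (2 * c₂)), KQ / (2 * c₂),
    { pos_left := by positivity
      left_le_right := min_le_right _ _
      continuous_norm := (continuous_const.mul continuous_quadForm).sqrt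
      norm_zero := by simp [rho, quadForm]
      norm_neg := fun x => by simp [hS, Matrix.mulVec_neg]
      norm_add_le := fun x y => by
        simp only [hS, Matrix.mulVec_add]
        exact norm_add_le (WithLp.toLp 2 (S *ᵥ x)) (WithLp.toLp 2 (S *ᵥ y))
      exists_le_norm := ⟨c, hc, hclow⟩
      continuous_flow := continuous_flow
      flow_zero := hB.flow_zero hQ
      flow_add := hB.flow_add hQ
      exists_hasDerivAt := fun x hx s => ?_ }⟩
  set y := flow Q B s *ᵥ x with hy
  have hy0 : y ≠ 0 := by
    intro h0
    apply hx
    have : flow Q B (-s) *ᵥ y = x := by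
      rw [hy, Matrix.mulVec_mulVec, ← hB.flow_add hQ, neg_add_cancel, hB.flow_zero hQ,
        Matrix.one_mulVec]
    rw [← this, h0, Matrix.mulVec_zero]
  have hρ : 0 < rho Q B y := lt_of_lt_of_le (by positivity) (hclow y)
  have h2R : 2 * quadForm Q B y ≠ 0 := by rw [← hB.rho_sq hQ]; positivity
  have hd := ((hB.hasDerivAt_quadForm_flow hQ x s).const_mul 2).sqrt h2R
  refine ⟨_, hd, ?_, ?_⟩
  · rw [← hy]
    change _ ≤ _ / (2 * rho Q B y)
    rw [le_div_iff₀ (by positivity)]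
    have := hlow y
    have h5 : min (c₁ / (2 * KP)) (KQ / (2 * c₂)) * rho Q B y ^ 2
      ≤ c₁ / (2 * KP) * rho Q B y ^ 2 := by gcongr; exact min_le_left _ _
    linarith
  · rw [← hy]
    change _ / (2 * rho Q B y) ≤ _
    rw [div_le_iff₀ (by positivity)]
    have := hupp y
    linarith

end Flow

end OrnsteinUhlenbeck

namespace OrnsteinUhlenbeck

variable {n : ℕ}

/-! ### The Mehler kernel in the variable w = D_{-t} u, its derivatives and measurability -/

section Kernel

open scoped Matrix.Norms.Operator
open NormedSpace (exp)

/-- `Q_∞ - e^{tB} Q_∞ e^{tB*}`, which is `Q_t` for `t ≥ 0`. -/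
noncomputable def covarianceDiff (Q B : Matrix (Fin n) (Fin n) ℝ) (t : ℝ) :
    Matrix (Fin n) (Fin n) ℝ :=
  covarianceInf Q B - exp (t • B) * covarianceInf Q B * exp (t • Bᵀ)

/-- The matrix `e^{tB*} Q_t⁻¹ e^{tB}`. -/
noncomputable def corrMatrix (Q B : Matrix (Fin n) (Fin n) ℝ) (t : ℝ) :
    Matrix (Fin n) (Fin n) ℝ :=
  exp (t • Bᵀ) * (covarianceDiff Q B t)⁻¹ * exp (t • B)

/-- The Mehler kernel in terms of `w = D_{-t} u`. -/
noncomputable def mehlerFormula (Q B : Matrix (Fin n) (Fin n) ℝ) (t : ℝ) (x w : Fin n → ℝ) : ℝ :=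
  ((covarianceInf Q B).det / (covarianceDiff Q B t).det) ^ (1 / 2 : ℝ) *
    Real.exp (quadForm Q B x - quadForm Q B (w - x)
      - 1 / 2 * ((corrMatrix Q B t *ᵥ (w - x)) ⬝ᵥ (w - x)))

/-- The logarithmic derivative of the Mehler kernel in the direction `e`. -/
noncomputable def mehlerLogDeriv (Q B : Matrix (Fin n) (Fin n) ℝ) (t : ℝ) (e x w : Fin n → ℝ) :
    ℝ :=
  ((covarianceInf Q B)⁻¹ *ᵥ w + corrMatrix Q B t *ᵥ (w - x)) ⬝ᵥ e

variable {Q B : Matrix (Fin n) (Fin n) ℝ}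

theorem IsStable.covarianceDiff_eq (hB : IsStable B) {t : ℝ} (ht : 0 ≤ t) :
    covarianceDiff Q B t = covariance Q B t :=
  sub_eq_of_eq_add (hB.covarianceInf_eq Q ht)

theorem corrMatrix_transpose (hQ : Qᵀ = Q) (t : ℝ) :
    (corrMatrix Q B t)ᵀ = corrMatrix Q B t := by
  have h : (covarianceDiff Q B t)ᵀ = covarianceDiff Q B t := by
    rw [covarianceDiff, Matrix.transpose_sub, conj_transpose (covarianceInf_transpose hQ B),
      covarianceInf_transpose hQ]
  rw [corrMatrix, Matrix.transpose_mul, Matrix.transpose_mul, Matrix.transpose_nonsing_inv, h,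
    exp_smul_transpose, Matrix.transpose_transpose, Matrix.mul_assoc]

/-- Put P = Q_∞, S = Q_t, E = e^{tB}, F = e^{tB*}. From P = S + EPF one gets S⁻¹ − P⁻¹ =
S⁻¹(EPF)P⁻¹, so (S⁻¹ − P⁻¹) D_t = S⁻¹E; then P S⁻¹ = 1 + EPF S⁻¹ finishes. The growing matrices D_t
cancel, leaving Q_∞⁻¹ plus an exponentially small term. -/
theorem IsStable.flow_transpose_mul (hB : IsStable B) (hQ : Q.PosDef) {t : ℝ} (ht : 1 ≤ t) :
    (flow Q B t)ᵀ * ((covariance Q B t)⁻¹ - (covarianceInf Q B)⁻¹) * flow Q B t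
      = (covarianceInf Q B)⁻¹ + corrMatrix Q B t := by
  have hP := hB.isUnit_det hQ
  have hQt : IsUnit (covariance Q B t).det := (hB.posDef_covariance hQ ht).det_pos.ne'.isUnit
  have hPT := covarianceInf_transpose (posDef_transpose_eq hQ) B
  have hEq := hB.covarianceInf_eq Q (zero_le_one.trans ht)
  rw [corrMatrix, hB.covarianceDiff_eq (zero_le_one.trans ht)]
  have hflT : (flow Q B t)ᵀ = (covarianceInf Q B)⁻¹ * exp ((-t) • B) * covarianceInf Q B := by
    rw [flow, Matrix.transpose_mul, Matrix.transpose_mul, Matrix.transpose_nonsing_inv, hPT,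
      exp_smul_transpose, Matrix.transpose_transpose, Matrix.mul_assoc]
  have hfl : flow Q B t = covarianceInf Q B * exp ((-t) • Bᵀ) * (covarianceInf Q B)⁻¹ := rfl
  have e1 := exp_smul_mul_neg Bᵀ t
  have e2 := exp_neg_smul_mul B t
  rw [hflT, hfl]
  set P := covarianceInf Q B
  set S := covariance Q B t
  set E := exp (t • B)
  set F := exp (t • Bᵀ)
  set E' := exp ((-t) • B)
  set F' := exp ((-t) • Bᵀ)
  have p1 : P * P⁻¹ = 1 := Matrix.mul_nonsing_inv _ hP
  have p2 : P⁻¹ * P = 1 := Matrix.nonsing_inv_mul _ hP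
  have s1 : S * S⁻¹ = 1 := Matrix.mul_nonsing_inv _ hQt
  have s2 : S⁻¹ * S = 1 := Matrix.nonsing_inv_mul _ hQt
  have hM : S⁻¹ - P⁻¹ = S⁻¹ * (E * P * F) * P⁻¹ := by
    have : E * P * F = P - S := by rw [eq_sub_iff_add_eq, add_comm]; exact hEq.symm
    rw [this, Matrix.mul_sub, Matrix.sub_mul, s2, Matrix.mul_assoc, p1, Matrix.mul_one,
      Matrix.one_mul]
  have hMD : (S⁻¹ - P⁻¹) * (P * F' * P⁻¹) = S⁻¹ * E := by
    calc (S⁻¹ - P⁻¹) * (P * F' * P⁻¹) = S⁻¹ * (E * P * F) * (P⁻¹ * P) * F' * P⁻¹ := by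
          rw [hM]; simp only [Matrix.mul_assoc]
      _ = S⁻¹ * E * P * (F * F') * P⁻¹ := by rw [p2]; simp only [Matrix.mul_assoc, Matrix.mul_one]
      _ = S⁻¹ * E * (P * P⁻¹) := by rw [e1]; simp only [Matrix.mul_assoc, Matrix.mul_one]
      _ = _ := by rw [p1, Matrix.mul_one]
  calc P⁻¹ * E' * P * (S⁻¹ - P⁻¹) * (P * F' * P⁻¹)
      = P⁻¹ * E' * P * ((S⁻¹ - P⁻¹) * (P * F' * P⁻¹)) := by simp only [Matrix.mul_assoc]
    _ = P⁻¹ * E' * (P * S⁻¹) * E := by rw [hMD]; simp only [Matrix.mul_assoc]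
    _ = P⁻¹ * E' * (1 + E * P * F * S⁻¹) * E := by
        congr 2
        conv_lhs => rw [hEq]
        rw [Matrix.add_mul, s1]
    _ = P⁻¹ * (E' * E) + P⁻¹ * (E' * E) * P * F * S⁻¹ * E := by
        simp only [Matrix.mul_add, Matrix.add_mul, Matrix.mul_assoc, Matrix.one_mul]
    _ = P⁻¹ + F * S⁻¹ * E := by
        rw [e2, Matrix.mul_one, p2, Matrix.one_mul]

theorem IsStable.mehlerKernel_eq (hB : IsStable B) (hQ : Q.PosDef) {t : ℝ} (ht : 1 ≤ t)
    (x u : Fin n → ℝ) :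
    mehlerKernel Q B t x u = mehlerFormula Q B t x (flow Q B (-t) *ᵥ u) := by
  set w := flow Q B (-t) *ᵥ u with hw
  have hu : u - flow Q B t *ᵥ x = flow Q B t *ᵥ (w - x) := by
    rw [Matrix.mulVec_sub, hw, Matrix.mulVec_mulVec, ← hB.flow_add hQ, add_neg_cancel,
      hB.flow_zero hQ, Matrix.one_mulVec]
  rw [mehlerKernel, mehlerFormula, hu, mul_assoc, ← Real.exp_add,
    hB.covarianceDiff_eq (zero_le_one.trans ht)]
  congr 2
  have h := hB.flow_transpose_mul hQ ht
  have h2 : (((covariance Q B t)⁻¹ - (covarianceInf Q B)⁻¹) *ᵥ (flow Q B t *ᵥ (w - x)))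
      ⬝ᵥ (flow Q B t *ᵥ (w - x))
      = (((covarianceInf Q B)⁻¹ + corrMatrix Q B t) *ᵥ (w - x)) ⬝ᵥ (w - x) := by
    rw [← h, Matrix.dotProduct_mulVec, ← Matrix.mulVec_transpose, Matrix.mulVec_mulVec,
      Matrix.mulVec_mulVec, Matrix.mul_assoc]
  rw [h2, Matrix.add_mulVec, add_dotProduct]
  simp only [quadForm]
  ring

/-- The terms R(x) and −R(w − x) contribute Q_∞⁻¹x and Q_∞⁻¹(w − x), whose sum is Q_∞⁻¹w: the main
factor depends on the orbit point w alone, and this is what the time integration needs. -/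
theorem hasLineDerivAt_mehlerFormula (hQ : Q.PosDef) (t : ℝ) (e x w : Fin n → ℝ) :
    HasLineDerivAt ℝ (fun y => mehlerFormula Q B t y w)
      (mehlerFormula Q B t x w * mehlerLogDeriv Q B t e x w) x e := by
  have hG : ((covarianceInf Q B)⁻¹)ᵀ = (covarianceInf Q B)⁻¹ := IsStable.inv_transpose hQ
  have hN : (corrMatrix Q B t)ᵀ = corrMatrix Q B t := corrMatrix_transpose (posDef_transpose_eq hQ) t
  set G := (covarianceInf Q B)⁻¹ with hGdef
  set N := corrMatrix Q B t with hNdef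
  have hexp : ∀ s : ℝ, quadForm Q B (x + s • e) - quadForm Q B (w - (x + s • e))
      - 1 / 2 * ((N *ᵥ (w - (x + s • e))) ⬝ᵥ (w - (x + s • e)))
      = (quadForm Q B x - quadForm Q B (w - x) - 1 / 2 * ((N *ᵥ (w - x)) ⬝ᵥ (w - x)))
        + s * mehlerLogDeriv Q B t e x w + s ^ 2 * (-(1 / 2) * ((N *ᵥ e) ⬝ᵥ e)) := by
    intro s
    have hwx : w - (x + s • e) = (w - x) - s • e := by abel
    rw [hwx]
    simp only [quadForm, mehlerLogDeriv, ← hGdef, ← hNdef, Matrix.mulVec_add, Matrix.mulVec_sub,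
      Matrix.mulVec_smul, add_dotProduct, dotProduct_add, sub_dotProduct, dotProduct_sub,
      smul_dotProduct, dotProduct_smul, smul_eq_mul]
    rw [dotProduct_mulVec_comm hG e x, dotProduct_mulVec_comm hG e w,
      dotProduct_mulVec_comm hN e x, dotProduct_mulVec_comm hN e w]
    ring
  have hd : HasDerivAt (fun s : ℝ => (quadForm Q B x - quadForm Q B (w - x)
      - 1 / 2 * ((N *ᵥ (w - x)) ⬝ᵥ (w - x)))
        + s * mehlerLogDeriv Q B t e x w + s ^ 2 * (-(1 / 2) * ((N *ᵥ e) ⬝ᵥ e)))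
      (mehlerLogDeriv Q B t e x w) 0 := by
    have := ((hasDerivAt_const (0:ℝ) (quadForm Q B x - quadForm Q B (w - x)
      - 1 / 2 * ((N *ᵥ (w - x)) ⬝ᵥ (w - x)))).add
        ((hasDerivAt_id (0:ℝ)).mul_const (mehlerLogDeriv Q B t e x w))).add
        ((hasDerivAt_pow 2 (0:ℝ)).mul_const (-(1 / 2) * ((N *ᵥ e) ⬝ᵥ e)))
    refine (this.congr_deriv ?_)
    simp
  rw [HasLineDerivAt]
  have := (hd.exp).const_mul
    (((covarianceInf Q B).det / (covarianceDiff Q B t).det) ^ (1 / 2 : ℝ))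
  simp only [← hexp] at this
  refine (this.congr_deriv ?_)
  simp [mehlerFormula, ← hNdef, mul_assoc]

theorem hasLineDerivAt_mehlerLogDeriv (t : ℝ) (e e' x w : Fin n → ℝ) :
    HasLineDerivAt ℝ (fun y => mehlerLogDeriv Q B t e y w)
      (-((corrMatrix Q B t *ᵥ e') ⬝ᵥ e)) x e' := by
  rw [HasLineDerivAt]
  have hexp : ∀ s : ℝ, mehlerLogDeriv Q B t e (x + s • e') w
      = mehlerLogDeriv Q B t e x w + s * (-((corrMatrix Q B t *ᵥ e') ⬝ᵥ e)) := by
    intro s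
    have hwx : w - (x + s • e') = (w - x) - s • e' := by abel
    simp only [mehlerLogDeriv, hwx, Matrix.mulVec_sub _ (w - x), Matrix.mulVec_smul,
      add_dotProduct, sub_dotProduct, smul_dotProduct, smul_eq_mul]
    ring
  simp only [hexp]
  simpa using ((hasDerivAt_id (0:ℝ)).mul_const
    (-((corrMatrix Q B t *ᵥ e') ⬝ᵥ e))).const_add (mehlerLogDeriv Q B t e x w)

/-- `t^{-1/2} ∂_{x_j} K_t(x, u)` in terms of `w = D_{-t} u`. -/
noncomputable def rieszFormula₁ (Q B : Matrix (Fin n) (Fin n) ℝ) (j : Fin n) (x u : Fin n → ℝ)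
    (t : ℝ) : ℝ :=
  t ^ (-(1 / 2) : ℝ) * (mehlerFormula Q B t x (flow Q B (-t) *ᵥ u) *
    mehlerLogDeriv Q B t (Pi.single j 1) x (flow Q B (-t) *ᵥ u))

/-- `∂²_{x_i x_j} K_t(x, u)` in terms of `w = D_{-t} u`. -/
noncomputable def rieszFormula₂ (Q B : Matrix (Fin n) (Fin n) ℝ) (i j : Fin n) (x u : Fin n → ℝ)
    (t : ℝ) : ℝ :=
  mehlerFormula Q B t x (flow Q B (-t) *ᵥ u) *
    (mehlerLogDeriv Q B t (Pi.single i 1) x (flow Q B (-t) *ᵥ u) *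
      mehlerLogDeriv Q B t (Pi.single j 1) x (flow Q B (-t) *ᵥ u)
      - (corrMatrix Q B t *ᵥ (Pi.single i 1)) ⬝ᵥ (Pi.single j 1))

theorem IsStable.partialDeriv_mehlerKernel (hB : IsStable B) (hQ : Q.PosDef) {t : ℝ} (ht : 1 ≤ t)
    (j : Fin n) (x u : Fin n → ℝ) :
    partialDeriv j (fun y => mehlerKernel Q B t y u) x
      = mehlerFormula Q B t x (flow Q B (-t) *ᵥ u) *
        mehlerLogDeriv Q B t (Pi.single j 1) x (flow Q B (-t) *ᵥ u) := by
  simp only [hB.mehlerKernel_eq hQ ht]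
  exact (hasLineDerivAt_mehlerFormula hQ t _ x _).lineDeriv

theorem IsStable.rieszIntegrand₁_eq (hB : IsStable B) (hQ : Q.PosDef) {t : ℝ} (ht : 1 ≤ t)
    (j : Fin n) (x u : Fin n → ℝ) :
    rieszIntegrand₁ Q B j x u t = rieszFormula₁ Q B j x u t := by
  rw [rieszIntegrand₁, rieszFormula₁, hB.partialDeriv_mehlerKernel hQ ht]

theorem IsStable.rieszIntegrand₂_eq (hB : IsStable B) (hQ : Q.PosDef) {t : ℝ} (ht : 1 ≤ t)
    (i j : Fin n) (x u : Fin n → ℝ) :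
    rieszIntegrand₂ Q B i j x u t = rieszFormula₂ Q B i j x u t := by
  rw [rieszIntegrand₂]
  simp only [hB.partialDeriv_mehlerKernel hQ ht]
  set w := flow Q B (-t) *ᵥ u with hw
  have h1 := hasLineDerivAt_mehlerFormula (B := B) hQ t (Pi.single i 1) x w
  have h2 := hasLineDerivAt_mehlerLogDeriv (Q := Q) (B := B) t (Pi.single j 1) (Pi.single i 1) x w
  have h3 : HasLineDerivAt ℝ
      (fun z => mehlerFormula Q B t z w * mehlerLogDeriv Q B t (Pi.single j 1) z w)
      (rieszFormula₂ Q B i j x u t) x (Pi.single i 1) := by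
    have := HasDerivAt.mul h1 h2
    refine (HasDerivAt.congr_deriv this ?_)
    simp only [zero_smul, add_zero, rieszFormula₂, ← hw]
    ring
  exact h3.lineDeriv

theorem continuous_covarianceDiff : Continuous (covarianceDiff Q B) :=
  continuous_const.sub (((continuous_exp_smul B).mul continuous_const).mul
    (continuous_exp_smul Bᵀ))

/-- The inverse is the inverted determinant times the adjugate, measurable at all real t, including
those where the determinant vanishes and its inverse takes the default value 0. -/
theorem measurable_covarianceDiff_inv (i j : Fin n) :
    Measurable fun t => (covarianceDiff Q B t)⁻¹ i j := by
  simp only [Matrix.inv_def, Ring.inverse_eq_inv', Matrix.smul_apply, smul_eq_mul]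
  exact (continuous_covarianceDiff.matrix_det.measurable.inv).mul
    ((continuous_covarianceDiff.matrix_adjugate).matrix_elem i j).measurable

theorem measurable_corrMatrix (i j : Fin n) : Measurable fun t => corrMatrix Q B t i j := by
  simp only [corrMatrix, Matrix.mul_apply]
  exact Finset.measurable_fun_sum _ fun k _ => (Finset.measurable_fun_sum _ fun l _ =>
    ((continuous_exp_smul Bᵀ).matrix_elem i l).measurable.mul
      (measurable_covarianceDiff_inv l k)).mul ((continuous_exp_smul B).matrix_elem k j).measurable

theorem continuous_flow_neg_mulVec :
    Continuous fun p : (Fin n → ℝ) × ℝ => flow Q B (-p.2) *ᵥ p.1 :=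
  (continuous_flow.comp continuous_snd.neg).matrix_mulVec continuous_fst

theorem measurable_corrMatrix_mulVec_dotProduct {α : Type*} [MeasurableSpace α] {τ : α → ℝ}
    (hτ : Measurable τ) {v w : α → Fin n → ℝ} (hv : Measurable v) (hw : Measurable w) :
    Measurable fun p => (corrMatrix Q B (τ p) *ᵥ v p) ⬝ᵥ w p := by
  simp only [dotProduct, Matrix.mulVec]
  exact Finset.measurable_fun_sum _ fun i _ => (Finset.measurable_fun_sum _ fun j _ =>
    ((measurable_corrMatrix i j).comp hτ).mul ((measurable_pi_apply j).comp hv)).mul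
      ((measurable_pi_apply i).comp hw)

theorem measurable_mehlerFormula (x : Fin n → ℝ) :
    Measurable fun p : (Fin n → ℝ) × ℝ => mehlerFormula Q B p.2 x (flow Q B (-p.2) *ᵥ p.1) := by
  have hw := (continuous_flow_neg_mulVec (Q := Q) (B := B)).measurable
  have hwx := hw.sub_const x
  refine Measurable.mul ?_ (Real.measurable_exp.comp (Measurable.sub (Measurable.sub
    measurable_const (continuous_quadForm.measurable.comp hwx))
    ((measurable_corrMatrix_mulVec_dotProduct measurable_snd hwx hwx).const_mul _)))
  exact ((continuous_covarianceDiff.matrix_det.measurable.comp measurable_snd).const_div _).pow_const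
    _

theorem measurable_mehlerLogDeriv (e x : Fin n → ℝ) :
    Measurable fun p : (Fin n → ℝ) × ℝ => mehlerLogDeriv Q B p.2 e x (flow Q B (-p.2) *ᵥ p.1) := by
  have hw := (continuous_flow_neg_mulVec (Q := Q) (B := B))
  have hwx := hw.measurable.sub_const x
  simp only [mehlerLogDeriv, add_dotProduct]
  exact Measurable.add ((continuous_const.matrix_mulVec hw).dotProduct continuous_const).measurable
    (measurable_corrMatrix_mulVec_dotProduct measurable_snd hwx measurable_const)

theorem measurable_rieszFormula₁ (j : Fin n) (x : Fin n → ℝ) :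
    Measurable fun p : (Fin n → ℝ) × ℝ => rieszFormula₁ Q B j x p.1 p.2 :=
  (measurable_snd.pow_const _).mul ((measurable_mehlerFormula x).mul
    (measurable_mehlerLogDeriv _ x))

theorem measurable_rieszFormula₂ (i j : Fin n) (x : Fin n → ℝ) :
    Measurable fun p : (Fin n → ℝ) × ℝ => rieszFormula₂ Q B i j x p.1 p.2 :=
  (measurable_mehlerFormula x).mul (((measurable_mehlerLogDeriv _ x).mul
    (measurable_mehlerLogDeriv _ x)).sub
    (measurable_corrMatrix_mulVec_dotProduct measurable_snd measurable_const measurable_const))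

end Kernel

end OrnsteinUhlenbeck

namespace OrnsteinUhlenbeck

variable {n : ℕ}

/-! ### Pointwise bounds for the Riesz integrands -/

section KernelBounds

open scoped Matrix.Norms.Operator
open NormedSpace (exp)

/-- The majorant `exp(-k ρ(w_t - x)²) (ρ(w_t) + e^{-c|t|})`, `w_t = D_{-t} u`, of the Riesz
integrands. -/
noncomputable def orbitKernel (ρ : (Fin n → ℝ) → ℝ) (D : ℝ → Matrix (Fin n) (Fin n) ℝ) (c k : ℝ)
    (x u : Fin n → ℝ) (t : ℝ) : ℝ :=
  Real.exp (-k * ρ (D (-t) *ᵥ u - x) ^ 2) * (ρ (D (-t) *ᵥ u) + Real.exp (-c * |t|))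

variable {Q B : Matrix (Fin n) (Fin n) ℝ}

theorem norm_inv_mulVec_le {A : Matrix (Fin n) (Fin n) ℝ} (hA : IsUnit A.det) {c : ℝ} (hc : 0 < c)
    (h : ∀ x : Fin n → ℝ, c * ‖x‖ ^ 2 ≤ x ⬝ᵥ (A *ᵥ x)) (x : Fin n → ℝ) :
    ‖A⁻¹ *ᵥ x‖ ≤ n / c * ‖x‖ := by
  set z := A⁻¹ *ᵥ x with hz
  have hAz : A *ᵥ z = x := by
    rw [hz, Matrix.mulVec_mulVec, Matrix.mul_nonsing_inv _ hA, Matrix.one_mulVec]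
  have h1 := h z
  rw [hAz] at h1
  have h2 := h1.trans ((le_abs_self _).trans (abs_dotProduct_le z x))
  rcases eq_or_lt_of_le (norm_nonneg z) with h0 | h0
  · rw [← h0]; positivity
  · rw [div_mul_eq_mul_div, le_div_iff₀ hc]
    have : ‖z‖ * (‖z‖ * c) ≤ ‖z‖ * (n * ‖x‖) := by linarith
    exact le_of_mul_le_mul_left this h0

theorem IsStable.exists_le_covariance (hB : IsStable B) (hQ : Q.PosDef) :
    ∃ c : ℝ, 0 < c ∧ ∀ t : ℝ, 1 ≤ t → ∀ x : Fin n → ℝ,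
      c * ‖x‖ ^ 2 ≤ x ⬝ᵥ (covarianceDiff Q B t *ᵥ x) := by
  obtain ⟨c, hc, h⟩ := hB.exists_le_dotProduct_integral hQ
  refine ⟨c, hc, fun t ht x => ?_⟩
  rw [hB.covarianceDiff_eq (zero_le_one.trans ht)]
  exact h _ (Set.Ioc_subset_Ioc_right ht) Set.Ioc_subset_Ioi_self x

theorem IsStable.posDef_covarianceDiff (hB : IsStable B) (hQ : Q.PosDef) {t : ℝ} (ht : 1 ≤ t) :
    (covarianceDiff Q B t).PosDef := by
  rw [hB.covarianceDiff_eq (zero_le_one.trans ht)]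
  exact hB.posDef_covariance hQ ht

/-- Both outer factors e^{tB*} and e^{tB} decay while Q_t⁻¹ stays bounded for t ≥ 1; one of the two
exponentials is discarded. -/
theorem IsStable.exists_norm_corrMatrix_mulVec_le (hB : IsStable B) (hQ : Q.PosDef) :
    ∃ c : ℝ, 0 < c ∧ ∃ C : ℝ, 0 < C ∧ ∀ t : ℝ, 1 ≤ t → ∀ x : Fin n → ℝ,
      ‖corrMatrix Q B t *ᵥ x‖ ≤ C * Real.exp (-c * t) * ‖x‖ := by
  obtain ⟨c₀, hc₀, hlow⟩ := hB.exists_le_covariance hQ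
  obtain ⟨c, hc, C, hC0, hC⟩ := hB
  refine ⟨c, hc, n * C * (n / c₀) * C + 1, by positivity, fun t ht x => ?_⟩
  have ht0 : 0 ≤ t := zero_le_one.trans ht
  have hC1 := hC t ht0
  have h1 : ‖exp (t • Bᵀ)‖ ≤ n * (C * Real.exp (-c * t)) := by
    rw [exp_smul_transpose]
    exact (norm_transpose_le _).trans (by gcongr)
  have hu : IsUnit (covarianceDiff Q B t).det :=
    (IsStable.posDef_covarianceDiff ⟨c, hc, C, hC0, hC⟩ hQ ht).det_pos.ne'.isUnit
  have he : Real.exp (-c * t) ≤ 1 := Real.exp_le_one_iff.2 (by nlinarith)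
  rw [corrMatrix, ← Matrix.mulVec_mulVec, ← Matrix.mulVec_mulVec]
  calc _ ≤ ‖exp (t • Bᵀ)‖ * ‖(covarianceDiff Q B t)⁻¹ *ᵥ (exp (t • B) *ᵥ x)‖ :=
        Matrix.linfty_opNorm_mulVec _ _
    _ ≤ (n * (C * Real.exp (-c * t))) * (n / c₀ * ((C * Real.exp (-c * t)) * ‖x‖)) := by
        gcongr
        refine (norm_inv_mulVec_le hu hc₀ (hlow t ht) _).trans ?_
        gcongr
        exact (Matrix.linfty_opNorm_mulVec _ _).trans (by gcongr)
    _ = n * C * (n / c₀) * C * Real.exp (-c * t) * Real.exp (-c * t) * ‖x‖ := by ring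
    _ ≤ n * C * (n / c₀) * C * Real.exp (-c * t) * 1 * ‖x‖ := by gcongr
    _ ≤ (n * C * (n / c₀) * C + 1) * Real.exp (-c * t) * ‖x‖ := by
        rw [mul_one]; gcongr; linarith

theorem IsStable.corrMatrix_nonneg (hB : IsStable B) (hQ : Q.PosDef) {t : ℝ} (ht : 1 ≤ t)
    (x : Fin n → ℝ) : 0 ≤ (corrMatrix Q B t *ᵥ x) ⬝ᵥ x := by
  have h := (hB.posDef_covarianceDiff hQ ht).inv.posSemidef.dotProduct_mulVec_nonneg
    (exp (t • B) *ᵥ x)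
  rw [corrMatrix, dotProduct_comm, exp_smul_transpose]
  have h2 := dotProduct_conj_mulVec (exp (t • B))ᵀ (covarianceDiff Q B t)⁻¹ x x
  rw [Matrix.transpose_transpose] at h2
  rw [h2]
  simpa using h

/-- Uniform coercivity bounds the entries of Q_t⁻¹, hence its determinant, hence the normalizing
factor of the kernel. -/
theorem IsStable.exists_det_ratio_le (hB : IsStable B) (hQ : Q.PosDef) :
    ∃ C : ℝ, 0 < C ∧ ∀ t : ℝ, 1 ≤ t →
      |((covarianceInf Q B).det / (covarianceDiff Q B t).det) ^ (1 / 2 : ℝ)| ≤ C := by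
  obtain ⟨c, hc, hlow⟩ := hB.exists_le_covariance hQ
  refine ⟨((covarianceInf Q B).det * ((n.factorial : ℝ) * (n / c) ^ n)) ^ (1 / 2 : ℝ) + 1,
    by have := (hB.posDef_covarianceInf hQ).det_pos; positivity, fun t ht => ?_⟩
  have hP := (hB.posDef_covarianceInf hQ).det_pos
  have hS := (hB.posDef_covarianceDiff hQ ht).det_pos
  have h1 : ∀ i j, |(covarianceDiff Q B t)⁻¹ i j| ≤ n / c := fun i j => by
    have h := norm_inv_mulVec_le hS.ne'.isUnit hc (hlow t ht) (Pi.single j 1)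
    rw [Matrix.mulVec_single_one, Pi.norm_single, norm_one, mul_one] at h
    exact (norm_le_pi_norm ((covarianceDiff Q B t)⁻¹.col j) i).trans h
  have h2 := Matrix.det_le (abv := AbsoluteValue.abs) h1
  have h3 : ((covarianceDiff Q B t).det)⁻¹ ≤ (n.factorial : ℝ) * (n / c) ^ n := by
    rw [← Ring.inverse_eq_inv', ← Matrix.det_nonsing_inv]
    refine (le_abs_self _).trans (h2.trans_eq ?_)
    simp
  rw [abs_of_nonneg (by positivity)]
  have : (covarianceInf Q B).det / (covarianceDiff Q B t).det ≤
      (covarianceInf Q B).det * ((n.factorial : ℝ) * (n / c) ^ n) := by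
    rw [div_eq_mul_inv]; gcongr
  have h4 := Real.rpow_le_rpow (by positivity) this (show (0:ℝ) ≤ 1 / 2 by norm_num)
  linarith

theorem IsStable.exists_mehlerFormula_le (hB : IsStable B) (hQ : Q.PosDef) :
    ∃ C : ℝ, 0 < C ∧ ∀ t : ℝ, 1 ≤ t → ∀ x w : Fin n → ℝ,
      |mehlerFormula Q B t x w| ≤
        C * Real.exp (quadForm Q B x) * Real.exp (-(1 / 2) * rho Q B (w - x) ^ 2) := by
  obtain ⟨C, hC, h⟩ := hB.exists_det_ratio_le hQ
  refine ⟨C, hC, fun t ht x w => ?_⟩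
  rw [mehlerFormula, abs_mul, Real.abs_exp, mul_assoc, ← Real.exp_add]
  refine mul_le_mul (h t ht) (Real.exp_le_exp.2 ?_) (Real.exp_nonneg _) hC.le
  rw [hB.rho_sq hQ]
  have := hB.corrMatrix_nonneg hQ ht (w - x)
  linarith

theorem IsStable.exists_mehlerLogDeriv_le (hB : IsStable B) (hQ : Q.PosDef) :
    ∃ c : ℝ, 0 < c ∧ ∃ C : ℝ, 0 < C ∧ ∀ t : ℝ, 1 ≤ t →
      (∀ (j : Fin n) (x w : Fin n → ℝ), |mehlerLogDeriv Q B t (Pi.single j 1) x w| ≤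
        C * (rho Q B w + Real.exp (-c * t) * rho Q B (w - x))) ∧
      (∀ i j : Fin n, |(corrMatrix Q B t *ᵥ (Pi.single i 1)) ⬝ᵥ (Pi.single j 1)| ≤
        C * Real.exp (-c * t)) := by
  obtain ⟨c, hc, C, hC0, hC⟩ := hB.exists_norm_corrMatrix_mulVec_le hQ
  obtain ⟨c₁, hc₁, hρ⟩ := hB.exists_le_rho hQ
  set K := ‖(covarianceInf Q B)⁻¹‖ with hK
  have hKn : 0 ≤ K := norm_nonneg _
  refine ⟨c, hc, (K + C) / c₁ + C, by positivity, fun t ht => ⟨fun j x w => ?_, fun i j => ?_⟩⟩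
  · have hρ' : ∀ x, ‖x‖ ≤ rho Q B x / c₁ := fun x => by
      rw [le_div_iff₀ hc₁, mul_comm]; exact hρ x
    have hr : ∀ x, 0 ≤ rho Q B x := fun x => Real.sqrt_nonneg _
    rw [mehlerLogDeriv, dotProduct_single_one]
    refine (norm_le_pi_norm _ j).trans ((norm_add_le
      ((covarianceInf Q B)⁻¹ *ᵥ w) (corrMatrix Q B t *ᵥ (w - x))).trans ?_)
    calc _ ≤ K * ‖w‖ + C * Real.exp (-c * t) * ‖w - x‖ :=
          add_le_add (Matrix.linfty_opNorm_mulVec _ _) (hC t ht _)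
      _ ≤ K * (rho Q B w / c₁) + C * Real.exp (-c * t) * (rho Q B (w - x) / c₁) := by
          gcongr <;> exact hρ' _
      _ ≤ _ := by
          have e0 := Real.exp_nonneg (-c * t)
          have h1 : 0 ≤ C / c₁ * rho Q B w := mul_nonneg (by positivity) (hr _)
          have h2 : 0 ≤ K / c₁ * (Real.exp (-c * t) * rho Q B (w - x)) :=
            mul_nonneg (by positivity) (mul_nonneg e0 (hr _))
          have h3 : 0 ≤ C * (rho Q B w + Real.exp (-c * t) * rho Q B (w - x)) :=
            mul_nonneg hC0.le (add_nonneg (hr _) (mul_nonneg e0 (hr _)))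
          have h4 : ((K + C) / c₁ + C) * (rho Q B w + Real.exp (-c * t) * rho Q B (w - x))
            = (K * (rho Q B w / c₁) + C * Real.exp (-c * t) * (rho Q B (w - x) / c₁))
              + C / c₁ * rho Q B w + K / c₁ * (Real.exp (-c * t) * rho Q B (w - x))
              + C * (rho Q B w + Real.exp (-c * t) * rho Q B (w - x)) := by
            field_simp; ring
          linarith
  · rw [dotProduct_single_one]
    refine (norm_le_pi_norm _ j).trans ((hC t ht _).trans ?_)
    rw [Pi.norm_single, norm_one, mul_one]
    gcongr
    have : 0 ≤ (K + C) / c₁ := by positivity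
    linarith

/-- At most three factors 1 + v occur, with v = ρ(w − x): one from each logarithmic derivative and
one from trading ρ(w) for ρ(x). Absorbing them lowers the Gaussian constant from 1/2 to 1/8. -/
theorem exp_mul_one_add_pow_le {v : ℝ} (hv : 0 ≤ v) :
    Real.exp (-(1 / 2) * v ^ 2) * (1 + v) ^ 3 ≤ Real.exp 6 * Real.exp (-(1 / 8) * v ^ 2) := by
  have h1 : (1 + v) ^ 3 ≤ Real.exp (3 * v) := by
    have := Real.add_one_le_exp v
    rw [show 3 * v = ((3 : ℕ) : ℝ) * v by norm_num, Real.exp_nat_mul]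
    gcongr; linarith
  calc _ ≤ Real.exp (-(1 / 2) * v ^ 2) * Real.exp (3 * v) := by gcongr
    _ = Real.exp (-(1 / 2) * v ^ 2 + 3 * v) := by rw [Real.exp_add]
    _ ≤ Real.exp (6 + -(1 / 8) * v ^ 2) := Real.exp_le_exp.2 (by nlinarith [sq_nonneg (v - 4)])
    _ = _ := by rw [Real.exp_add]

/-- The Riesz integrands are controlled by the kernel `orbitKernel`. -/
theorem IsStable.exists_rieszFormula_le (hB : IsStable B) (hQ : Q.PosDef) :
    ∃ c : ℝ, 0 < c ∧ ∃ C : ℝ, 0 < C ∧ ∀ t : ℝ, 1 ≤ t → ∀ x u : Fin n → ℝ,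
      (∀ j, |rieszFormula₁ Q B j x u t| ≤ C * Real.exp (quadForm Q B x) *
        orbitKernel (rho Q B) (flow Q B) c (1 / 8) x u t) ∧
      (∀ i j, |rieszFormula₂ Q B i j x u t| ≤
        C * (1 + rho Q B x) * Real.exp (quadForm Q B x) *
          orbitKernel (rho Q B) (flow Q B) c (1 / 8) x u t) := by
  obtain ⟨C₁, hC₁, hK⟩ := hB.exists_mehlerFormula_le hQ
  obtain ⟨c, hc, C₂, hC₂, hP⟩ := hB.exists_mehlerLogDeriv_le hQ
  obtain ⟨a, b, hflow⟩ := hB.isExpandingFlow hQ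
  refine ⟨c, hc, C₁ * (C₂ + C₂ ^ 2) * Real.exp 6, by positivity, fun t ht x u => ?_⟩
  set w := flow Q B (-t) *ᵥ u with hw
  obtain ⟨hP1, hP2⟩ := hP t ht
  have hv : 0 ≤ rho Q B (w - x) := Real.sqrt_nonneg _
  have hp : 0 ≤ rho Q B w := Real.sqrt_nonneg _
  have hx : 0 ≤ rho Q B x := Real.sqrt_nonneg _
  have hwx : rho Q B w ≤ rho Q B x + rho Q B (w - x) := by
    have := hflow.norm_add_le x (w - x)
    simpa using this
  have hε : Real.exp (-c * t) ≤ 1 := Real.exp_le_one_iff.2 (by nlinarith)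
  have hε0 := Real.exp_pos (-c * t)
  have hkap : orbitKernel (rho Q B) (flow Q B) c (1 / 8) x u t
      = Real.exp (-(1 / 8) * rho Q B (w - x) ^ 2) * (rho Q B w + Real.exp (-c * t)) := by
    rw [orbitKernel, abs_of_nonneg (zero_le_one.trans ht)]
  have hK' := hK t ht x w
  rw [hkap]
  have hcub := exp_mul_one_add_pow_le hv
  set v := rho Q B (w - x)
  set p := rho Q B w
  set r := rho Q B x
  set ε := Real.exp (-c * t)
  set g := Real.exp (-(1 / 2) * v ^ 2)
  set g' := Real.exp (-(1 / 8) * v ^ 2)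
  set ER := Real.exp (quadForm Q B x)
  have hER : 0 < ER := Real.exp_pos _
  have hg : 0 < g := Real.exp_pos _
  have hpe : p + ε * v ≤ (1 + v) * (p + ε) := by nlinarith [mul_nonneg hp hv]
  have hpe0 : 0 ≤ p + ε * v := by positivity
  -- The second-order integrand carries two factors p + ε, but the time integration uses just one
  -- power of ρ(w_t) as dρ. The other is traded for 1 + ρ(x), the only loss relative to first order.
  have hpe' : p + ε ≤ (1 + v) * (1 + r) := by nlinarith [mul_nonneg hv hx]
  refine ⟨fun j => ?_, fun i j => ?_⟩
  · have ht1 : |t ^ (-(1 / 2) : ℝ)| ≤ 1 := by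
      rw [abs_of_nonneg (by positivity)]
      exact Real.rpow_le_one_of_one_le_of_nonpos ht (by norm_num)
    rw [rieszFormula₁, abs_mul, abs_mul, ← hw]
    calc _ ≤ 1 * ((C₁ * ER * g) * (C₂ * (p + ε * v))) := by
          gcongr; exact hP1 j x w
      _ ≤ 1 * ((C₁ * ER * g) * (C₂ * ((1 + v) ^ 3 * (p + ε)))) := by
          gcongr
          refine hpe.trans ?_
          gcongr
          nlinarith [pow_nonneg hv 2, pow_nonneg hv 3]
      _ = C₁ * C₂ * ER * (g * (1 + v) ^ 3) * (p + ε) := by ring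
      _ ≤ C₁ * (C₂ + C₂ ^ 2) * ER * (Real.exp 6 * g') * (p + ε) := by
          gcongr
          nlinarith
      _ = _ := by ring
  · rw [rieszFormula₂, abs_mul, ← hw]
    have hb : |mehlerLogDeriv Q B t (Pi.single i 1) x w * mehlerLogDeriv Q B t (Pi.single j 1) x w
        - (corrMatrix Q B t *ᵥ (Pi.single i 1)) ⬝ᵥ (Pi.single j 1)|
        ≤ (C₂ + C₂ ^ 2) * ((1 + v) ^ 3 * (1 + r) * (p + ε)) := by
      refine (abs_sub _ _).trans ?_
      rw [abs_mul]
      calc _ ≤ (C₂ * (p + ε * v)) * (C₂ * (p + ε * v)) + C₂ * ε := by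
            gcongr
            · exact hP1 i x w
            · exact hP1 j x w
            · exact hP2 i j
        _ = C₂ ^ 2 * ((p + ε * v) * (p + ε * v)) + C₂ * ε := by ring
        _ ≤ C₂ ^ 2 * (((1 + v) * (p + ε)) * ((1 + v) * ((1 + v) * (1 + r)))) +
              C₂ * ((1 + v) ^ 3 * (1 + r) * (p + ε)) := by
            gcongr
            · exact hpe.trans (by gcongr)
            · have : 1 ≤ (1 + v) ^ 3 * (1 + r) := by
                have h1 : 1 ≤ (1 + v) ^ 3 := one_le_pow₀ (by linarith)
                nlinarith
              nlinarith
        _ = _ := by ring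
    calc _ ≤ (C₁ * ER * g) * ((C₂ + C₂ ^ 2) * ((1 + v) ^ 3 * (1 + r) * (p + ε))) := by gcongr
      _ = C₁ * (C₂ + C₂ ^ 2) * (1 + r) * ER * (g * (1 + v) ^ 3) * (p + ε) := by ring
      _ ≤ C₁ * (C₂ + C₂ ^ 2) * (1 + r) * ER * (Real.exp 6 * g') * (p + ε) := by gcongr
      _ = _ := by ring

end KernelBounds

end OrnsteinUhlenbeck

namespace OrnsteinUhlenbeck

variable {n : ℕ}

/-! ### Orbits of an expanding flow: time integrals, level crossings, shells -/

namespace IsExpandingFlow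

variable {ρ : (Fin n → ℝ) → ℝ} {D : ℝ → Matrix (Fin n) (Fin n) ℝ} {a b : ℝ}

theorem nonneg (h : IsExpandingFlow ρ D a b) (x : Fin n → ℝ) : 0 ≤ ρ x := by
  obtain ⟨c, hc, hx⟩ := h.exists_le_norm
  exact le_trans (by positivity) (hx x)

theorem abs_sub_le (h : IsExpandingFlow ρ D a b) (x y : Fin n → ℝ) :
    |ρ x - ρ y| ≤ ρ (x - y) := by
  rw [abs_le]
  have h1 := h.norm_add_le (x - y) y
  have h2 := h.norm_add_le (y - x) x
  have h3 := h.norm_neg (x - y)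
  rw [neg_sub] at h3
  rw [sub_add_cancel] at h1 h2
  constructor <;> linarith

theorem flow_neg_mulVec (h : IsExpandingFlow ρ D a b) (s : ℝ) (x : Fin n → ℝ) :
    D (-s) *ᵥ (D s *ᵥ x) = x := by
  rw [Matrix.mulVec_mulVec, ← h.flow_add, neg_add_cancel, h.flow_zero, Matrix.one_mulVec]

theorem flow_mulVec_neg (h : IsExpandingFlow ρ D a b) (s : ℝ) (x : Fin n → ℝ) :
    D s *ᵥ (D (-s) *ᵥ x) = x := by
  rw [Matrix.mulVec_mulVec, ← h.flow_add, add_neg_cancel, h.flow_zero, Matrix.one_mulVec]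

theorem continuous_flow_mulVec (h : IsExpandingFlow ρ D a b) (x : Fin n → ℝ) :
    Continuous fun s => D s *ᵥ x :=
  h.continuous_flow.matrix_mulVec continuous_const

theorem exists_deriv (h : IsExpandingFlow ρ D a b) {x : Fin n → ℝ} (hx : x ≠ 0) :
    ∃ d : ℝ → ℝ, ∀ s, HasDerivAt (fun s => ρ (D s *ᵥ x)) (d s) s ∧
      a * ρ (D s *ᵥ x) ≤ d s ∧ d s ≤ b * ρ (D s *ᵥ x) :=
  ⟨fun s => (h.exists_hasDerivAt x hx s).choose,
    fun s => (h.exists_hasDerivAt x hx s).choose_spec⟩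

theorem pos_right (h : IsExpandingFlow ρ D a b) : 0 < b := h.pos_left.trans_le h.left_le_right

theorem exp_mul_le (h : IsExpandingFlow ρ D a b) {s : ℝ} (hs : 0 ≤ s) (x : Fin n → ℝ) :
    Real.exp (a * s) * ρ x ≤ ρ (D s *ᵥ x) := by
  by_cases hx : x = 0
  · simp [hx, h.norm_zero]
  obtain ⟨d, hd⟩ := h.exists_deriv hx
  have hmono : Monotone fun s => Real.exp (-a * s) * ρ (D s *ᵥ x) := by
    refine monotone_of_hasDerivAt_nonneg
      (fun s => (((hasDerivAt_id s).const_mul (-a)).exp).mul (hd s).1) fun s => ?_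
    simp only [id, mul_one, Pi.zero_apply]
    have := mul_le_mul_of_nonneg_left (hd s).2.1 (Real.exp_nonneg (-a * s))
    linarith
  have h1 := hmono hs
  simp only [mul_zero, Real.exp_zero, one_mul, h.flow_zero, Matrix.one_mulVec] at h1
  calc _ ≤ Real.exp (a * s) * (Real.exp (-a * s) * ρ (D s *ᵥ x)) := by gcongr
    _ = _ := by rw [← mul_assoc, ← Real.exp_add]; simp

theorem le_exp_mul (h : IsExpandingFlow ρ D a b) {s : ℝ} (hs : 0 ≤ s) (x : Fin n → ℝ) :
    ρ (D s *ᵥ x) ≤ Real.exp (b * s) * ρ x := by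
  by_cases hx : x = 0
  · simp [hx, h.norm_zero]
  obtain ⟨d, hd⟩ := h.exists_deriv hx
  have hmono : Monotone fun s => -(Real.exp (-b * s) * ρ (D s *ᵥ x)) := by
    refine monotone_of_hasDerivAt_nonneg
      (fun s => ((((hasDerivAt_id s).const_mul (-b)).exp).mul (hd s).1).neg) fun s => ?_
    simp only [id, mul_one, Pi.zero_apply]
    have := mul_le_mul_of_nonneg_left (hd s).2.2 (Real.exp_nonneg (-b * s))
    linarith
  have h1 := neg_le_neg_iff.1 (hmono hs)
  simp only [mul_zero, Real.exp_zero, one_mul, h.flow_zero, Matrix.one_mulVec] at h1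
  calc _ = Real.exp (b * s) * (Real.exp (-b * s) * ρ (D s *ᵥ x)) := by
        rw [← mul_assoc, ← Real.exp_add]; simp
    _ ≤ _ := by gcongr

theorem le_exp_abs_mul (h : IsExpandingFlow ρ D a b) {s L : ℝ} (hs : |s| ≤ L) (x : Fin n → ℝ) :
    ρ (D s *ᵥ x) ≤ Real.exp (b * L) * ρ x := by
  have hb := h.pos_right
  have hL : 0 ≤ L := (abs_nonneg s).trans hs
  rcases le_total 0 s with h0 | h0
  · refine (h.le_exp_mul h0 x).trans ?_
    have := h.nonneg x
    gcongr
    rwa [abs_of_nonneg h0] at hs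
  · have h1 := h.exp_mul_le (neg_nonneg.2 h0) (D s *ᵥ x)
    rw [h.flow_neg_mulVec] at h1
    have h2 : 1 ≤ Real.exp (a * -s) :=
      Real.one_le_exp (mul_nonneg h.pos_left.le (neg_nonneg.2 h0))
    have h3 : 1 ≤ Real.exp (b * L) := Real.one_le_exp (by positivity)
    have h4 := h.nonneg (D s *ᵥ x)
    have h5 := h.nonneg x
    nlinarith

theorem monotone_norm_flow (h : IsExpandingFlow ρ D a b) (x : Fin n → ℝ) :
    Monotone fun s => ρ (D s *ᵥ x) := by
  by_cases hx : x = 0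
  · simp [hx, monotone_const]
  obtain ⟨d, hd⟩ := h.exists_deriv hx
  refine monotone_of_hasDerivAt_nonneg (fun s => (hd s).1) fun s => ?_
  exact le_trans (mul_nonneg h.pos_left.le (h.nonneg _)) (hd s).2.1

/-- An orbit spends little time near a given level, uniformly in the orbit and the level. -/
theorem exists_lintegral_radial_le (h : IsExpandingFlow ρ D a b) {k : ℝ} (hk : 0 < k) :
    ∃ C : ℝ, 0 < C ∧ ∀ (u : Fin n → ℝ) (r : ℝ),
      ∫⁻ t : ℝ, ENNReal.ofReal (ρ (D (-t) *ᵥ u) * Real.exp (-k * (ρ (D (-t) *ᵥ u) - r) ^ 2))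
        ≤ ENNReal.ofReal C := by
  have ha := h.pos_left
  refine ⟨1 / a * Real.sqrt (Real.pi / k), by positivity, fun u r => ?_⟩
  have hneg := lintegral_neg_eq_self (μ := (volume : Measure ℝ)) fun t =>
    ENNReal.ofReal (ρ (D t *ᵥ u) * Real.exp (-k * (ρ (D t *ᵥ u) - r) ^ 2))
  rw [hneg]
  by_cases hu : u = 0
  · simp [hu, h.norm_zero]
  obtain ⟨d, hd⟩ := h.exists_deriv hu
  -- Substitute z = ρ(D_t u), which is increasing with ρ ≤ (dρ/dt)/a; a Gaussian integral over the
  -- line remains, independent of the orbit and of r.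
  have hcov := lintegral_image_eq_lintegral_deriv_mul_of_monotoneOn MeasurableSet.univ
    (fun s _ => (hd s).1.hasDerivWithinAt) ((h.monotone_norm_flow u).monotoneOn _)
    (fun z => ENNReal.ofReal (Real.exp (-k * (z - r) ^ 2)))
  have hgauss : ∫⁻ z : ℝ, ENNReal.ofReal (Real.exp (-k * (z - r) ^ 2))
      = ENNReal.ofReal (Real.sqrt (Real.pi / k)) := by
    rw [lintegral_sub_right_eq_self (fun z : ℝ => ENNReal.ofReal (Real.exp (-k * z ^ 2))),
      ← ofReal_integral_eq_lintegral_ofReal (integrable_exp_neg_mul_sq hk)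
        (Filter.Eventually.of_forall fun _ => Real.exp_nonneg _), integral_gaussian]
  calc _ ≤ ∫⁻ t : ℝ, ENNReal.ofReal (1 / a) * (ENNReal.ofReal (d t) *
          ENNReal.ofReal (Real.exp (-k * (ρ (D t *ᵥ u) - r) ^ 2))) := by
        refine lintegral_mono fun t => ?_
        rw [← mul_assoc, ← ENNReal.ofReal_mul (by positivity), ← ENNReal.ofReal_mul']
        · refine ENNReal.ofReal_le_ofReal ?_
          gcongr
          rw [one_div, ← div_eq_inv_mul, le_div_iff₀ ha, mul_comm]
          exact (hd t).2.1
        · exact Real.exp_nonneg _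
    _ = ENNReal.ofReal (1 / a) * ∫⁻ z in (fun s => ρ (D s *ᵥ u)) '' Set.univ,
          ENNReal.ofReal (Real.exp (-k * (z - r) ^ 2)) := by
        rw [lintegral_const_mul' _ _ ENNReal.ofReal_ne_top, hcov, Measure.restrict_univ]
    _ ≤ ENNReal.ofReal (1 / a) * ENNReal.ofReal (Real.sqrt (Real.pi / k)) := by
        rw [← hgauss]
        gcongr
        exact Measure.restrict_le_self
    _ = _ := by rw [← ENNReal.ofReal_mul (by positivity)]

theorem integrable_exp_neg_mul_abs {c : ℝ} (hc : 0 < c) :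
    Integrable fun t : ℝ => Real.exp (-c * |t|) := by
  rw [← integrableOn_univ, ← Set.Iic_union_Ioi (a := (0:ℝ))]
  refine IntegrableOn.union ?_ ?_
  · refine (integrableOn_exp_mul_Iic hc 0).congr_fun (fun t ht => ?_) measurableSet_Iic
    simp only [abs_of_nonpos (Set.mem_Iic.1 ht), neg_mul_neg]
  · refine (integrableOn_exp_mul_Ioi (neg_lt_zero.2 hc) 0).congr_fun (fun t ht => ?_)
      measurableSet_Ioi
    simp only [abs_of_pos (Set.mem_Ioi.1 ht)]

theorem exists_lintegral_orbit_le (h : IsExpandingFlow ρ D a b) {k c : ℝ} (hk : 0 < k)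
    (hc : 0 < c) :
    ∃ C : ℝ, 0 < C ∧ ∀ (u : Fin n → ℝ) (r : ℝ),
      ∫⁻ t : ℝ, ENNReal.ofReal (Real.exp (-k * (ρ (D (-t) *ᵥ u) - r) ^ 2) *
        (ρ (D (-t) *ᵥ u) + Real.exp (-c * |t|))) ≤ ENNReal.ofReal C := by
  obtain ⟨C, hC, hrad⟩ := h.exists_lintegral_radial_le hk
  have hint := integrable_exp_neg_mul_abs hc
  have hI : 0 ≤ ∫ t : ℝ, Real.exp (-c * |t|) := integral_nonneg fun _ => Real.exp_nonneg _
  refine ⟨C + ∫ t : ℝ, Real.exp (-c * |t|), by positivity, fun u r => ?_⟩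
  rw [ENNReal.ofReal_add hC.le hI, ofReal_integral_eq_lintegral_ofReal hint
    (Filter.Eventually.of_forall fun _ => Real.exp_nonneg _)]
  refine le_trans ?_ (add_le_add_left (hrad u r) _)
  rw [← lintegral_add_right _ (by fun_prop)]
  refine lintegral_mono fun t => ?_
  rw [← ENNReal.ofReal_add (mul_nonneg (h.nonneg _) (Real.exp_nonneg _)) (Real.exp_nonneg _)]
  refine ENNReal.ofReal_le_ofReal ?_
  have h1 : Real.exp (-k * (ρ (D (-t) *ᵥ u) - r) ^ 2) ≤ 1 :=
    Real.exp_le_one_iff.2 (by have := sq_nonneg (ρ (D (-t) *ᵥ u) - r); nlinarith)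
  have h2 := mul_le_mul_of_nonneg_right h1 (Real.exp_nonneg (-c * |t|))
  linarith

/-- For 0 < M < ∞ the set is contained in the half-line z > −log M, over which e^{-z} has integral
M. -/
theorem lintegral_exp_neg_lt_le (M : ENNReal) :
    ∫⁻ z in {z : ℝ | ENNReal.ofReal (Real.exp (-z)) < M}, ENNReal.ofReal (Real.exp (-z)) ≤ M := by
  rcases eq_or_ne M ⊤ with rfl | hM
  · exact le_top
  lift M to NNReal using hM
  rcases eq_or_lt_of_le (zero_le : 0 ≤ M) with h0 | h0
  · simp [← h0]
  have hsub : {z : ℝ | ENNReal.ofReal (Real.exp (-z)) < M} ⊆ Set.Ioi (-Real.log M) := by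
    intro z hz
    rw [Set.mem_ofPred_eq, ← ENNReal.ofReal_coe_nnreal,
      ENNReal.ofReal_lt_ofReal_iff (by exact_mod_cast h0),
      ← Real.lt_log_iff_exp_lt (by exact_mod_cast h0)] at hz
    simp only [Set.mem_Ioi]; linarith
  refine (lintegral_mono_set hsub).trans ?_
  have hi : IntegrableOn (fun z : ℝ => Real.exp (-z)) (Set.Ioi (-Real.log M)) := by
    simpa using integrableOn_exp_mul_Ioi (neg_one_lt_zero) (-Real.log M)
  rw [← ofReal_integral_eq_lintegral_ofReal hi
    (Filter.Eventually.of_forall fun _ => Real.exp_nonneg _), integral_exp_neg_Ioi, neg_neg,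
    Real.exp_log (by exact_mod_cast h0), ENNReal.ofReal_coe_nnreal]

/-- The Gaussian mass of the part of an orbit that lies above a level set of the Gaussian. -/
theorem lintegral_exit_le (h : IsExpandingFlow ρ D a b) {r : ℝ} (hr : 0 < r) (y : Fin n → ℝ)
    (M : ENNReal) :
    ∫⁻ s in {s : ℝ | r / 2 ≤ ρ (D s *ᵥ y) ∧
        ENNReal.ofReal (Real.exp (-(1 / 2 * ρ (D s *ᵥ y) ^ 2))) < M},
      ENNReal.ofReal (Real.exp (-(1 / 2 * ρ (D s *ᵥ y) ^ 2)))
      ≤ ENNReal.ofReal (4 / (a * r ^ 2)) * M := by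
  have ha := h.pos_left
  by_cases hy : y = 0
  · have : {s : ℝ | r / 2 ≤ ρ (D s *ᵥ y) ∧
        ENNReal.ofReal (Real.exp (-(1 / 2 * ρ (D s *ᵥ y) ^ 2))) < M} = ∅ := by
      ext s
      simp only [hy, Matrix.mulVec_zero, h.norm_zero, Set.mem_ofPred_eq, Set.mem_empty_iff_false,
        iff_false, not_and]
      intro h; linarith
    rw [this]; simp
  obtain ⟨d, hd⟩ := h.exists_deriv hy
  set q : ℝ → ℝ := fun s => 1 / 2 * ρ (D s *ᵥ y) ^ 2 with hq
  set J := {s : ℝ | r / 2 ≤ ρ (D s *ᵥ y) ∧ ENNReal.ofReal (Real.exp (-q s)) < M} with hJ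
  have hcont : Continuous fun s => ρ (D s *ᵥ y) :=
    h.continuous_norm.comp (h.continuous_flow_mulVec y)
  have hqc : Continuous q := continuous_const.mul (hcont.pow 2)
  have hJm : MeasurableSet J :=
    (measurableSet_le measurable_const hcont.measurable).inter
      (measurableSet_lt (hqc.measurable.neg.exp.ennreal_ofReal) measurable_const)
  have hqd : ∀ s, HasDerivAt q (ρ (D s *ᵥ y) * d s) s := fun s => by
    refine (((hd s).1.pow 2).const_mul (1 / 2)).congr_deriv ?_
    push_cast; ring
  have hqm : Monotone q := fun s t hst => by
    have h1 := h.monotone_norm_flow y hst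
    have h2 := h.nonneg (D s *ᵥ y)
    simp only [hq] at h1 ⊢
    gcongr
  -- Substitute z = ρ(D_s y)²/2. Where ρ ≥ r/2 its derivative is at least aρ² ≥ a r²/4, hence the
  -- factor 4/(a r²).
  have hcov := lintegral_image_eq_lintegral_deriv_mul_of_monotoneOn hJm
    (fun s _ => (hqd s).hasDerivWithinAt) (hqm.monotoneOn _)
    (fun z => ENNReal.ofReal (Real.exp (-z)))
  calc _ ≤ ∫⁻ s in J, ENNReal.ofReal (4 / (a * r ^ 2)) * (ENNReal.ofReal (ρ (D s *ᵥ y) * d s) *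
          ENNReal.ofReal (Real.exp (-q s))) := by
        refine setLIntegral_mono' hJm fun s hs => ?_
        have h1 : r ^ 2 * a / 4 ≤ ρ (D s *ᵥ y) * d s := by
          have h2 : r / 2 ≤ ρ (D s *ᵥ y) := hs.1
          calc r ^ 2 * a / 4 = (r / 2) * (a * (r / 2)) := by ring
            _ ≤ ρ (D s *ᵥ y) * (a * ρ (D s *ᵥ y)) := by
              gcongr; exact h.nonneg _
            _ ≤ _ := mul_le_mul_of_nonneg_left (hd s).2.1 (h.nonneg _)
        have h3 : 1 ≤ 4 / (a * r ^ 2) * (ρ (D s *ᵥ y) * d s) := by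
          rw [div_mul_eq_mul_div, le_div_iff₀ (by positivity)]
          linarith
        rw [← mul_assoc, ← ENNReal.ofReal_mul (by positivity), ← ENNReal.ofReal_mul (by linarith)]
        exact ENNReal.ofReal_le_ofReal (le_mul_of_one_le_left (Real.exp_nonneg _) h3)
    _ = ENNReal.ofReal (4 / (a * r ^ 2)) * ∫⁻ z in q '' J, ENNReal.ofReal (Real.exp (-z)) := by
        rw [lintegral_const_mul' _ _ ENNReal.ofReal_ne_top, hcov]
    _ ≤ _ := by
        gcongr
        refine (lintegral_mono_set ?_).trans (lintegral_exp_neg_lt_le M)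
        rintro _ ⟨s, hs, rfl⟩
        exact hs.2

/-- The flow brings every point of an annulus into a unit shell, where it stays for a while. -/
theorem exists_time_in_shell (h : IsExpandingFlow ρ D a b) :
    ∃ L : ℝ, 0 < L ∧ ∃ K : ℝ, 0 < K ∧ ∀ r : ℝ, 1 ≤ r → ∀ x : Fin n → ℝ,
      r / 2 ≤ ρ x → ρ x ≤ 2 * r →
      1 ≤ ENNReal.ofReal (K * r) *
        volume ({s : ℝ | r ≤ ρ (D (-s) *ᵥ x) ∧ ρ (D (-s) *ᵥ x) ≤ r + 1} ∩ Set.Icc (-L) L) := by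
  have ha := h.pos_left
  have hb := h.pos_right
  -- In time L₀ the flow at least doubles ρ, so any orbit through the annulus meets the level r at
  -- some time τ with |τ| ≤ L₀.
  set L₀ := Real.log 2 / a with hL₀
  have hlog : 0 < Real.log 2 := Real.log_pos (by norm_num)
  have hL₀0 : 0 < L₀ := by positivity
  refine ⟨L₀ + 1 / (2 * b), by positivity, 2 * b, by positivity, fun r hr x hx1 hx2 => ?_⟩
  have he : Real.exp (a * L₀) = 2 := by
    rw [hL₀, mul_div_cancel₀ _ ha.ne', Real.exp_log (by norm_num)]
  have hcont : Continuous fun s => ρ (D s *ᵥ x) :=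
    h.continuous_norm.comp (h.continuous_flow_mulVec x)
  have hlow : ρ (D (-L₀) *ᵥ x) ≤ r := by
    have := h.exp_mul_le hL₀0.le (D (-L₀) *ᵥ x)
    rw [h.flow_mulVec_neg, he] at this
    linarith
  have hupp : r ≤ ρ (D L₀ *ᵥ x) := by
    have := h.exp_mul_le hL₀0.le x
    rw [he] at this
    linarith
  obtain ⟨τ, hτ, hτr⟩ := intermediate_value_Icc (by linarith : -L₀ ≤ L₀) hcont.continuousOn
    ⟨hlow, hupp⟩
  simp only at hτr
  -- Starting from level r, during time δ the flow multiplies ρ by at most e^{1/(2r)} ≤ 1 + 1/r, so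
  -- the orbit remains in the shell for a time of order 1/r.
  set δ := 1 / (2 * b * r) with hδ
  have hδ0 : 0 < δ := by positivity
  have hδ1 : δ ≤ 1 / (2 * b) := by
    rw [hδ]
    apply one_div_le_one_div_of_le (by positivity)
    nlinarith
  have hsub : Set.Icc (-τ - δ) (-τ) ⊆
      {s : ℝ | r ≤ ρ (D (-s) *ᵥ x) ∧ ρ (D (-s) *ᵥ x) ≤ r + 1}
        ∩ Set.Icc (-(L₀ + 1 / (2 * b))) (L₀ + 1 / (2 * b)) := by
    intro s hs
    have hs0 : 0 ≤ -s - τ := by linarith [hs.2]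
    have hsδ : -s - τ ≤ δ := by linarith [hs.1]
    have hD : D (-s) *ᵥ x = D (-s - τ) *ᵥ (D τ *ᵥ x) := by
      rw [Matrix.mulVec_mulVec, ← h.flow_add, sub_add_cancel]
    refine ⟨⟨?_, ?_⟩, by linarith [hs.1, hτ.2], by linarith [hs.2, hτ.1, hδ1, hδ0]⟩
    · rw [hD]
      refine le_trans ?_ (h.exp_mul_le hs0 _)
      rw [hτr]
      exact le_mul_of_one_le_left (by linarith) (Real.one_le_exp (by positivity))
    · rw [hD]
      refine (h.le_exp_mul hs0 _).trans ?_
      rw [hτr]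
      have h1 : b * (-s - τ) ≤ Real.log (1 + 1 / r) := by
        calc b * (-s - τ) ≤ b * δ := by gcongr
          _ = 1 / (2 * r) := by rw [hδ]; field_simp
          _ ≤ 1 / (r + 1) := one_div_le_one_div_of_le (by positivity) (by linarith)
          _ = 1 - (1 + 1 / r)⁻¹ := by field_simp; ring
          _ ≤ _ := Real.one_sub_inv_le_log_of_pos (by positivity)
      have h2 := Real.exp_le_exp.2 h1
      rw [Real.exp_log (by positivity)] at h2
      calc _ ≤ (1 + 1 / r) * r := by gcongr
        _ = r + 1 := by field_simp
  calc (1 : ENNReal) = ENNReal.ofReal (2 * b * r) * volume (Set.Icc (-τ - δ) (-τ)) := by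
        rw [Real.volume_Icc, ← ENNReal.ofReal_mul (by positivity), hδ]
        symm
        rw [ENNReal.ofReal_eq_one]
        field_simp; ring
    _ ≤ _ := by gcongr

/-- Linear change of variables along the flow, for bounded times. -/
theorem exists_lintegral_comp_flow_le (h : IsExpandingFlow ρ D a b) (L : ℝ) :
    ∃ C : ℝ, 0 < C ∧ ∀ s ∈ Set.Icc (-L) L, ∀ F : (Fin n → ℝ) → ENNReal, Measurable F →
      ∫⁻ x, F (D s *ᵥ x) ≤ ENNReal.ofReal C * ∫⁻ x, F x := by
  obtain ⟨C, hC⟩ := (isCompact_Icc (a := -L) (b := L)).exists_bound_of_continuousOn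
    ((h.continuous_flow.comp continuous_neg).matrix_det).continuousOn
  refine ⟨|C| + 1, by positivity, fun s hs F hF => ?_⟩
  have hdet : (D s).det * (D (-s)).det = 1 := by
    rw [← Matrix.det_mul, ← h.flow_add, add_neg_cancel, h.flow_zero, Matrix.det_one]
  have hne : (D s).det ≠ 0 := left_ne_zero_of_mul_eq_one hdet
  have hinv : ((D s).det)⁻¹ = (D (-s)).det := (eq_inv_of_mul_eq_one_right hdet).symm
  have hmap := Real.map_matrix_volume_pi_eq_smul_volume_pi hne
  have hmeas : Measurable (Matrix.toLin' (D s)) :=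
    (Matrix.toLin' (D s)).toContinuousLinearMap.continuous.measurable
  calc ∫⁻ x, F (D s *ᵥ x) = ∫⁻ x, F x ∂(Measure.map (Matrix.toLin' (D s)) volume) := by
        rw [lintegral_map hF hmeas]; simp
    _ = ENNReal.ofReal |(D (-s)).det| * ∫⁻ x, F x := by
        rw [hmap, lintegral_smul_measure, hinv, smul_eq_mul]
    _ ≤ _ := by
        gcongr
        exact (hC s hs).trans ((le_abs_self C).trans (by linarith))

theorem continuous_orbitKernel (h : IsExpandingFlow ρ D a b) (c k : ℝ) :
    Continuous fun p : (Fin n → ℝ) × (Fin n → ℝ) × ℝ => orbitKernel ρ D c k p.1 p.2.1 p.2.2 := by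
  have hw : Continuous fun p : (Fin n → ℝ) × (Fin n → ℝ) × ℝ => D (-p.2.2) *ᵥ p.2.1 :=
    (h.continuous_flow.comp continuous_snd.snd.neg).matrix_mulVec continuous_snd.fst
  have h1 := h.continuous_norm.comp (hw.sub continuous_fst)
  have h2 := h.continuous_norm.comp hw
  have h3 : Continuous fun p : (Fin n → ℝ) × (Fin n → ℝ) × ℝ => |p.2.2| := continuous_snd.snd.abs
  exact ((continuous_const.mul (h1.pow 2)).rexp).mul (h2.add (continuous_const.mul h3).rexp)

/-- The kernel `orbitKernel` has a uniformly bounded integral in time. -/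
theorem exists_lintegral_orbitKernel_le (h : IsExpandingFlow ρ D a b) {k c : ℝ} (hk : 0 < k)
    (hc : 0 < c) :
    ∃ C : ℝ, 0 < C ∧ ∀ x u : Fin n → ℝ,
      ∫⁻ t : ℝ, ENNReal.ofReal (orbitKernel ρ D c k x u t) ≤ ENNReal.ofReal C := by
  obtain ⟨C, hC, hb⟩ := h.exists_lintegral_orbit_le hk hc
  refine ⟨C, hC, fun x u => le_trans (lintegral_mono fun t => ENNReal.ofReal_le_ofReal ?_)
    (hb u (ρ x))⟩
  have h1 := h.abs_sub_le (D (-t) *ᵥ u) x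
  have h2 : (ρ (D (-t) *ᵥ u) - ρ x) ^ 2 ≤ ρ (D (-t) *ᵥ u - x) ^ 2 :=
    sq_le_sq.2 (h1.trans (le_abs_self _))
  have h3 := h.nonneg (D (-t) *ᵥ u)
  rw [orbitKernel]
  gcongr ?_ * _
  exact Real.exp_le_exp.2 (by nlinarith)

/-- Moving the base point along the flow for a bounded time essentially preserves the time
integral of `orbitKernel`. -/
theorem exists_lintegral_orbitKernel_flow_le (h : IsExpandingFlow ρ D a b) {k c L : ℝ}
    (hk : 0 < k) (hc : 0 < c) :
    ∃ k' : ℝ, 0 < k' ∧ ∃ C : ℝ, 0 < C ∧ ∀ s : ℝ, |s| ≤ L → ∀ y u : Fin n → ℝ,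
      ∫⁻ t : ℝ, ENNReal.ofReal (orbitKernel ρ D c k (D s *ᵥ y) u t)
        ≤ ENNReal.ofReal C * ∫⁻ t : ℝ, ENNReal.ofReal (orbitKernel ρ D c k' y u t) := by
  have hb := h.pos_right
  -- Translating t by s gives D_{-t}u = D_s D_{-(t+s)}u; nothing is lost because the time integral
  -- runs over all of ℝ. Since D_s distorts ρ by at most e^{bL} in either direction, k shrinks by
  -- e^{-2bL}, and the weight changes by at most e^{bL} or e^{cL}.
  refine ⟨k * Real.exp (-(b * L)) ^ 2, by positivity, Real.exp (b * L) + Real.exp (c * L),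
    by positivity, fun s hs y u => ?_⟩
  rw [← lintegral_const_mul' _ _ ENNReal.ofReal_ne_top,
    ← lintegral_add_right_eq_self (fun t : ℝ => ENNReal.ofReal _ * ENNReal.ofReal _) s]
  refine lintegral_mono fun t => ?_
  rw [← ENNReal.ofReal_mul (by positivity)]
  refine ENNReal.ofReal_le_ofReal ?_
  set z := D (-(t + s)) *ᵥ u with hz
  have hzt : D (-t) *ᵥ u = D s *ᵥ z := by
    rw [hz, Matrix.mulVec_mulVec, ← h.flow_add]; congr 2; ring_nf
  rw [orbitKernel, orbitKernel, hzt, ← Matrix.mulVec_sub, ← hz]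
  have h1 : Real.exp (-(b * L)) * ρ (z - y) ≤ ρ (D s *ᵥ (z - y)) := by
    have h2 := h.le_exp_abs_mul (s := -s) (L := L) (by rwa [abs_neg]) (D s *ᵥ (z - y))
    rw [h.flow_neg_mulVec] at h2
    calc _ ≤ Real.exp (-(b * L)) * (Real.exp (b * L) * ρ (D s *ᵥ (z - y))) := by gcongr
      _ = _ := by rw [← mul_assoc, ← Real.exp_add]; simp
  have h3 : Real.exp (-k * ρ (D s *ᵥ (z - y)) ^ 2)
      ≤ Real.exp (-(k * Real.exp (-(b * L)) ^ 2) * ρ (z - y) ^ 2) := by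
    apply Real.exp_le_exp.2
    have h4 : (Real.exp (-(b * L)) * ρ (z - y)) ^ 2 ≤ ρ (D s *ᵥ (z - y)) ^ 2 := by
      have := h.nonneg (z - y)
      gcongr
    rw [mul_pow] at h4
    nlinarith
  have h5 := h.le_exp_abs_mul hs z
  have h6 : Real.exp (-c * |t|) ≤ Real.exp (c * L) * Real.exp (-c * |t + s|) := by
    rw [← Real.exp_add]
    apply Real.exp_le_exp.2
    have h7 : |t + s| ≤ |t| + |s| := abs_add_le t s
    nlinarith
  have h8 := h.nonneg z
  have h9 := Real.exp_nonneg (b * L)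
  have h10 := Real.exp_nonneg (c * L)
  have h11 := Real.exp_nonneg (-c * |t + s|)
  calc _ ≤ Real.exp (-(k * Real.exp (-(b * L)) ^ 2) * ρ (z - y) ^ 2) *
        ((Real.exp (b * L) + Real.exp (c * L)) * (ρ z + Real.exp (-c * |t + s|))) := by
        refine mul_le_mul h3 ?_ (add_nonneg (h.nonneg _) (Real.exp_nonneg _)) (Real.exp_nonneg _)
        nlinarith [mul_nonneg h9 h11, mul_nonneg h10 h8]
    _ = _ := by ring

theorem integrable_exp_neg_mul_norm_sq {k : ℝ} (hk : 0 < k) :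
    Integrable fun z : Fin n → ℝ => Real.exp (-k * ‖z‖ ^ 2) := by
  -- The Gaussian in the sup norm is dominated by a product of one-dimensional ones; n + 1 instead
  -- of n avoids dividing by zero when n = 0.
  have hprod : Integrable fun z : Fin n → ℝ => ∏ i, Real.exp (-(k / (n + 1)) * z i ^ 2) :=
    Integrable.fintype_prod fun _ => integrable_exp_neg_mul_sq (by positivity)
  refine hprod.mono' (by fun_prop) (Filter.Eventually.of_forall fun z => ?_)
  rw [Real.norm_eq_abs, Real.abs_exp, ← Real.exp_sum]
  apply Real.exp_le_exp.2
  rw [← Finset.mul_sum]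
  have h1 : ∑ i, z i ^ 2 ≤ n * ‖z‖ ^ 2 := by
    calc ∑ i, z i ^ 2 ≤ ∑ _i : Fin n, ‖z‖ ^ 2 := Finset.sum_le_sum fun i _ => by
          rw [← sq_abs]
          gcongr
          exact norm_le_pi_norm z i
      _ = _ := by simp
  have h2 : k / (n + 1) * ∑ i, z i ^ 2 ≤ k * ‖z‖ ^ 2 := by
    calc _ ≤ k / (n + 1) * ((n + 1) * ‖z‖ ^ 2) := by
          gcongr; refine h1.trans ?_; gcongr; linarith
      _ = _ := by field_simp
  linarith

theorem integrable_exp_neg_mul_sq_norm (h : IsExpandingFlow ρ D a b) {k : ℝ} (hk : 0 < k) :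
    Integrable fun z : Fin n → ℝ => Real.exp (-k * ρ z ^ 2) := by
  obtain ⟨c, hc, hcρ⟩ := h.exists_le_norm
  refine (integrable_exp_neg_mul_norm_sq (n := n) (k := k * c ^ 2) (by positivity)).mono'
    (continuous_const.mul (h.continuous_norm.pow 2)).rexp.aestronglyMeasurable
    (Filter.Eventually.of_forall fun z => ?_)
  rw [Real.norm_eq_abs, Real.abs_exp]
  apply Real.exp_le_exp.2
  have h1 : (c * ‖z‖) ^ 2 ≤ ρ z ^ 2 := by gcongr; exact hcρ z
  rw [mul_pow] at h1
  nlinarith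

/-- The integral of `orbitKernel` over a unit shell and all times is uniformly bounded. -/
theorem exists_lintegral_shell_le (h : IsExpandingFlow ρ D a b) {k c : ℝ} (hk : 0 < k)
    (hc : 0 < c) :
    ∃ C : ℝ, 0 < C ∧ ∀ (r : ℝ) (u : Fin n → ℝ),
      ∫⁻ y in {y | r ≤ ρ y ∧ ρ y ≤ r + 1}, ∫⁻ t : ℝ, ENNReal.ofReal (orbitKernel ρ D c k y u t)
        ≤ ENNReal.ofReal C := by
  obtain ⟨C, hC, horb⟩ := h.exists_lintegral_orbit_le (k := k / 4) (by positivity) hc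
  have hg := h.integrable_exp_neg_mul_sq_norm (k := k / 2) (by positivity)
  set I := ∫ z, Real.exp (-(k / 2) * ρ z ^ 2) with hI
  have hI0 : 0 ≤ I := integral_nonneg fun _ => Real.exp_nonneg _
  refine ⟨Real.exp (k / 2) * (I + 1) * C, by positivity, fun r u => ?_⟩
  have hmeas : Measurable fun p : (Fin n → ℝ) × ℝ => ENNReal.ofReal (orbitKernel ρ D c k p.1 u p.2) :=
    ((h.continuous_orbitKernel c k).comp (continuous_fst.prodMk
      (continuous_const.prodMk continuous_snd))).measurable.ennreal_ofReal
  have hS : MeasurableSet {y | r ≤ ρ y ∧ ρ y ≤ r + 1} :=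
    (measurableSet_le measurable_const h.continuous_norm.measurable).inter
      (measurableSet_le h.continuous_norm.measurable measurable_const)
  -- For fixed t, half of the Gaussian pays for the integration in y. In the other half ρ(y) is
  -- within 1 of r, so it becomes a Gaussian in ρ(w_t) − r with constant k/4, at the cost of
  -- e^{k/2}; the orbit estimate then bounds the time integral.
  rw [lintegral_lintegral_swap hmeas.aemeasurable]
  have hGauss : ∀ w : Fin n → ℝ, ∫⁻ y, ENNReal.ofReal (Real.exp (-(k / 2) * ρ (w - y) ^ 2))
      = ENNReal.ofReal I := fun w => by
    rw [lintegral_sub_left_eq_self (fun z => ENNReal.ofReal (Real.exp (-(k / 2) * ρ z ^ 2))) w,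
      hI, ofReal_integral_eq_lintegral_ofReal hg
        (Filter.Eventually.of_forall fun _ => Real.exp_nonneg _)]
  calc _ ≤ ∫⁻ t : ℝ, ENNReal.ofReal (Real.exp (k / 2) * (I + 1)) *
        ENNReal.ofReal (Real.exp (-(k / 4) * (ρ (D (-t) *ᵥ u) - r) ^ 2) *
          (ρ (D (-t) *ᵥ u) + Real.exp (-c * |t|))) := by
        refine lintegral_mono fun t => ?_
        set w := D (-t) *ᵥ u with hw
        set A := Real.exp (-(k / 4) * (ρ w - r) ^ 2) * (ρ w + Real.exp (-c * |t|)) with hA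
        have hA0 : 0 ≤ A :=
          mul_nonneg (Real.exp_nonneg _) (add_nonneg (h.nonneg _) (Real.exp_nonneg _))
        calc _ ≤ ∫⁻ y in {y | r ≤ ρ y ∧ ρ y ≤ r + 1}, ENNReal.ofReal (Real.exp (k / 2) * A) *
              ENNReal.ofReal (Real.exp (-(k / 2) * ρ (w - y) ^ 2)) := by
              refine setLIntegral_mono' hS fun y hy => ?_
              rw [← ENNReal.ofReal_mul (by positivity)]
              refine ENNReal.ofReal_le_ofReal ?_
              rw [orbitKernel, ← hw, hA]
              have h1 := h.abs_sub_le w y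
              have h2 : (ρ w - ρ y) ^ 2 ≤ ρ (w - y) ^ 2 := sq_le_sq.2 (h1.trans (le_abs_self _))
              have h3 : (ρ y - r) ^ 2 ≤ 1 := by nlinarith [hy.1, hy.2]
              have h4 : (ρ w - r) ^ 2 ≤ 2 * ρ (w - y) ^ 2 + 2 := by
                nlinarith [sq_nonneg ((ρ w - ρ y) - (ρ y - r))]
              have h5 : Real.exp (-k * ρ (w - y) ^ 2) ≤ Real.exp (k / 2) *
                  Real.exp (-(k / 4) * (ρ w - r) ^ 2) * Real.exp (-(k / 2) * ρ (w - y) ^ 2) := by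
                rw [← Real.exp_add, ← Real.exp_add]
                apply Real.exp_le_exp.2
                nlinarith
              have h6 := add_nonneg (h.nonneg w) (Real.exp_nonneg (-c * |t|))
              calc _ ≤ _ := mul_le_mul_of_nonneg_right h5 h6
                _ = _ := by ring
          _ ≤ ENNReal.ofReal (Real.exp (k / 2) * A) * ENNReal.ofReal I := by
              rw [lintegral_const_mul' _ _ ENNReal.ofReal_ne_top, ← hGauss w]
              gcongr
              exact Measure.restrict_le_self
          _ ≤ _ := by
              rw [← ENNReal.ofReal_mul (by positivity), ← ENNReal.ofReal_mul (by positivity)]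
              refine ENNReal.ofReal_le_ofReal ?_
              have := Real.exp_nonneg (k / 2)
              nlinarith [mul_nonneg this hA0]
    _ ≤ _ := by
        rw [lintegral_const_mul' _ _ ENNReal.ofReal_ne_top,
          ENNReal.ofReal_mul (q := C) (by positivity)]
        exact mul_le_mul' le_rfl (horb u r)

end IsExpandingFlow

end OrnsteinUhlenbeck

/-! ### Potentials of measures and the level set estimate in an annulus -/

namespace OrnsteinUhlenbeck

variable {n : ℕ}

/-- The potential of a measure `μ` with respect to the time integral of `orbitKernel`. -/
noncomputable def orbitPotential (ρ : (Fin n → ℝ) → ℝ) (D : ℝ → Matrix (Fin n) (Fin n) ℝ)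
    (c k : ℝ) (μ : Measure (Fin n → ℝ)) (x : Fin n → ℝ) : ENNReal :=
  ∫⁻ u, (∫⁻ t : ℝ, ENNReal.ofReal (orbitKernel ρ D c k x u t)) ∂μ

namespace IsExpandingFlow

variable {ρ : (Fin n → ℝ) → ℝ} {D : ℝ → Matrix (Fin n) (Fin n) ℝ} {a b : ℝ}

theorem measurable_lintegral_orbitKernel (h : IsExpandingFlow ρ D a b) (c k : ℝ) :
    Measurable fun p : (Fin n → ℝ) × (Fin n → ℝ) =>
      ∫⁻ t : ℝ, ENNReal.ofReal (orbitKernel ρ D c k p.1 p.2 t) := by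
  have hm : Measurable fun p : ((Fin n → ℝ) × (Fin n → ℝ)) × ℝ =>
      ENNReal.ofReal (orbitKernel ρ D c k p.1.1 p.1.2 p.2) :=
    ((h.continuous_orbitKernel c k).comp (continuous_fst.fst.prodMk
      (continuous_fst.snd.prodMk continuous_snd))).measurable.ennreal_ofReal
  exact hm.lintegral_prod_right'

theorem measurable_lintegral_orbitKernel_right (h : IsExpandingFlow ρ D a b) (c k : ℝ)
    (x : Fin n → ℝ) :
    Measurable fun u => ∫⁻ t : ℝ, ENNReal.ofReal (orbitKernel ρ D c k x u t) := by
  have hm : Measurable fun p : (Fin n → ℝ) × ℝ => ENNReal.ofReal (orbitKernel ρ D c k x p.1 p.2) :=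
    ((h.continuous_orbitKernel c k).comp (continuous_const.prodMk
      (continuous_fst.prodMk continuous_snd))).measurable.ennreal_ofReal
  exact hm.lintegral_prod_right'

theorem measurable_orbitPotential (h : IsExpandingFlow ρ D a b) (c k : ℝ)
    (μ : Measure (Fin n → ℝ)) [SFinite μ] : Measurable (orbitPotential ρ D c k μ) :=
  (h.measurable_lintegral_orbitKernel c k).lintegral_prod_right'

theorem exists_orbitPotential_le (h : IsExpandingFlow ρ D a b) {k c : ℝ} (hk : 0 < k)
    (hc : 0 < c) :
    ∃ C : ℝ, 0 < C ∧ ∀ (μ : Measure (Fin n → ℝ)) (x : Fin n → ℝ), μ Set.univ ≤ 1 →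
      orbitPotential ρ D c k μ x ≤ ENNReal.ofReal C := by
  obtain ⟨C, hC, hb⟩ := h.exists_lintegral_orbitKernel_le hk hc
  refine ⟨C, hC, fun μ x hμ => ?_⟩
  calc orbitPotential ρ D c k μ x ≤ ∫⁻ _u, ENNReal.ofReal C ∂μ :=
        lintegral_mono fun u => hb x u
    _ = ENNReal.ofReal C * μ Set.univ := by rw [lintegral_const]
    _ ≤ _ := mul_le_of_le_one_right' hμ

/-- The level set estimate in an annulus. -/
theorem exists_lintegral_levelSet_le (h : IsExpandingFlow ρ D a b) {k c : ℝ} (hk : 0 < k)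
    (hc : 0 < c) :
    ∃ C : ℝ, 0 < C ∧ ∀ (μ : Measure (Fin n → ℝ)) [SFinite μ], μ Set.univ ≤ 1 →
      ∀ (r m : ℝ), 1 ≤ r → 0 < m →
      ∫⁻ x in {x | r / 2 ≤ ρ x ∧ ρ x ≤ 2 * r ∧ ENNReal.ofReal m <
          ENNReal.ofReal (Real.exp (1 / 2 * ρ x ^ 2)) * orbitPotential ρ D c k μ x},
        ENNReal.ofReal (Real.exp (-(1 / 2 * ρ x ^ 2))) ≤ ENNReal.ofReal (C / (r * m)) := by
  have ha := h.pos_left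
  obtain ⟨L, hL, K, hK, htime⟩ := h.exists_time_in_shell
  obtain ⟨C₁, hC₁, hcov⟩ := h.exists_lintegral_comp_flow_le L
  obtain ⟨k', hk', C₂, hC₂, hshift⟩ := h.exists_lintegral_orbitKernel_flow_le (L := L) hk hc
  obtain ⟨C₃, hC₃, hshell⟩ := h.exists_lintegral_shell_le hk' hc
  -- The power 1/r arises as r · r⁻²: averaging over the time in the shell costs K r, and the speed
  -- of R along the orbit gains 4/(a r²).
  refine ⟨K * C₁ * (4 / a) * C₂ * C₃, by positivity, fun μ _ hμ r m hr hm => ?_⟩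
  have hr0 : 0 < r := by linarith
  set Ψ := orbitPotential ρ D c k μ with hΨ
  -- Φ(y) dominates Ψ along the whole orbit piece D_s y, |s| ≤ L, and does not depend on s; the
  -- price is the smaller Gaussian constant k'.
  set Φ : (Fin n → ℝ) → ENNReal := fun y => ENNReal.ofReal C₂ * orbitPotential ρ D c k' μ y with hΦ
  have hΨm : Measurable Ψ := h.measurable_orbitPotential c k μ
  have hΦΨ : ∀ y s, |s| ≤ L → Ψ (D s *ᵥ y) ≤ Φ y := fun y s hs => by
    simp only [hΦ, orbitPotential]
    rw [← lintegral_const_mul' _ _ ENNReal.ofReal_ne_top]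
    exact lintegral_mono fun u => hshift s hs y u
  set e : (Fin n → ℝ) → ENNReal := fun x => ENNReal.ofReal (Real.exp (-(1 / 2 * ρ x ^ 2))) with he
  have hρm := h.continuous_norm.measurable
  have hem : Measurable e :=
    (measurable_const.mul (hρm.pow_const 2)).neg.exp.ennreal_ofReal
  set A := {x | r / 2 ≤ ρ x ∧ ρ x ≤ 2 * r ∧ ENNReal.ofReal m <
          ENNReal.ofReal (Real.exp (1 / 2 * ρ x ^ 2)) * Ψ x} with hA
  have hAm : MeasurableSet A :=
    (measurableSet_le measurable_const hρm).inter ((measurableSet_le hρm measurable_const).inter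
      (measurableSet_lt measurable_const
        ((measurable_const.mul (hρm.pow_const 2)).exp.ennreal_ofReal.mul hΨm)))
  set S := {y | r ≤ ρ y ∧ ρ y ≤ r + 1} with hS
  have hSm : MeasurableSet S :=
    (measurableSet_le measurable_const hρm).inter (measurableSet_le hρm measurable_const)
  set H : ℝ → (Fin n → ℝ) → ENNReal := fun s y => S.indicator 1 y * A.indicator e (D s *ᵥ y)
    with hH
  have hAe : Measurable (A.indicator e) := hem.indicator hAm
  have hS1 : Measurable (S.indicator (1 : (Fin n → ℝ) → ENNReal)) := measurable_one.indicator hSm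
  have hDc : Continuous fun p : (Fin n → ℝ) × ℝ => D p.2 *ᵥ p.1 :=
    (h.continuous_flow.comp continuous_snd).matrix_mulVec continuous_fst
  have hHm : Measurable fun p : (Fin n → ℝ) × ℝ => H p.2 p.1 :=
    (hS1.comp measurable_fst).mul (hAe.comp hDc.measurable)
  have hHs : ∀ s, Measurable (H s) := fun s => hHm.comp (measurable_id.prodMk measurable_const)
  have hDc' : Continuous fun p : (Fin n → ℝ) × ℝ => D (-p.2) *ᵥ p.1 :=
    (h.continuous_flow.comp continuous_snd.neg).matrix_mulVec continuous_fst
  have hHm' : Measurable fun p : (Fin n → ℝ) × ℝ => H p.2 (D (-p.2) *ᵥ p.1) :=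
    hHm.comp (hDc'.measurable.prodMk measurable_snd)
  -- averaging over the flow
  have step1 : ∫⁻ x in A, e x ≤
      ENNReal.ofReal (K * r) * ∫⁻ x, ∫⁻ s in Set.Icc (-L) L, H s (D (-s) *ᵥ x) := by
    rw [← lintegral_indicator hAm, ← lintegral_const_mul' _ _ ENNReal.ofReal_ne_top]
    refine lintegral_mono fun x => ?_
    by_cases hx : x ∈ A
    · have hin : ∀ s, H s (D (-s) *ᵥ x) = e x * S.indicator 1 (D (-s) *ᵥ x) := fun s => by
        simp only [hH, h.flow_mulVec_neg, Set.indicator_of_mem hx, mul_comm]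
      have hind : ∀ s, S.indicator (1 : (Fin n → ℝ) → ENNReal) (D (-s) *ᵥ x)
          = {s : ℝ | r ≤ ρ (D (-s) *ᵥ x) ∧ ρ (D (-s) *ᵥ x) ≤ r + 1}.indicator 1 s := fun s => rfl
      have hxm : Measurable fun s : ℝ => D (-s) *ᵥ x :=
        ((h.continuous_flow_mulVec x).comp continuous_neg).measurable
      have hset : MeasurableSet {s : ℝ | r ≤ ρ (D (-s) *ᵥ x) ∧ ρ (D (-s) *ᵥ x) ≤ r + 1} :=
        hxm hSm
      simp only [hin, hind]
      rw [Set.indicator_of_mem hx, lintegral_const_mul' _ _ ENNReal.ofReal_ne_top,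
        lintegral_indicator_one hset, Measure.restrict_apply hset, mul_left_comm]
      exact le_mul_of_one_le_right' (htime r hr x hx.1 hx.2.1)
    · rw [Set.indicator_of_notMem hx]; exact zero_le
  -- change of variables
  have step2 : ∫⁻ x, ∫⁻ s in Set.Icc (-L) L, H s (D (-s) *ᵥ x) ≤
      ENNReal.ofReal C₁ * ∫⁻ y, ∫⁻ s in Set.Icc (-L) L, H s y := by
    rw [lintegral_lintegral_swap (f := fun x s => H s (D (-s) *ᵥ x)) hHm'.aemeasurable,
      lintegral_lintegral_swap (f := fun y s => H s y) hHm.aemeasurable,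
      ← lintegral_const_mul' _ _ ENNReal.ofReal_ne_top]
    refine setLIntegral_mono' measurableSet_Icc fun s hs => ?_
    exact hcov (-s) ⟨by linarith [hs.2], by linarith [hs.1]⟩ (H s) (hHs s)
  -- On the level set, e^{-R(D_s y)} < Ψ(D_s y)/m ≤ Φ(y)/m. The last bound is constant in s, so
  -- `lintegral_exit_le` applies with M = Φ(y)/m.
  have step3 : ∀ y, ∫⁻ s in Set.Icc (-L) L, H s y ≤
      S.indicator (fun y => ENNReal.ofReal (4 / (a * r ^ 2)) * (ENNReal.ofReal m)⁻¹ * Φ y) y := by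
    intro y
    by_cases hy : y ∈ S
    · simp only [hH, Set.indicator_of_mem hy, Pi.one_apply, one_mul]
      set J := {s : ℝ | r / 2 ≤ ρ (D s *ᵥ y) ∧
        ENNReal.ofReal (Real.exp (-(1 / 2 * ρ (D s *ᵥ y) ^ 2))) < (ENNReal.ofReal m)⁻¹ * Φ y}
        with hJ
      have hρc : Continuous fun s => ρ (D s *ᵥ y) :=
        h.continuous_norm.comp (h.continuous_flow_mulVec y)
      have hJm : MeasurableSet J := (measurableSet_le measurable_const hρc.measurable).inter
        (measurableSet_lt (continuous_const.mul (hρc.pow 2)).neg.rexp.measurable.ennreal_ofReal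
          measurable_const)
      have hm0 : ENNReal.ofReal m ≠ 0 := by simpa using hm
      calc _ ≤ ∫⁻ s in Set.Icc (-L) L, J.indicator (fun s => e (D s *ᵥ y)) s := by
            refine setLIntegral_mono' measurableSet_Icc fun s hs => ?_
            by_cases hsA : D s *ᵥ y ∈ A
            · have hsJ : s ∈ J := by
                refine ⟨hsA.1, ?_⟩
                have h1 := hsA.2.2.trans_le (mul_le_mul_right (hΦΨ y s (abs_le.2 hs))
                  (ENNReal.ofReal (Real.exp (1 / 2 * ρ (D s *ᵥ y) ^ 2))))
                rw [Real.exp_neg, ENNReal.ofReal_inv_of_pos (Real.exp_pos _), mul_comm _ (Φ y),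
                  ← div_eq_mul_inv, ENNReal.lt_div_iff_mul_lt (Or.inl hm0)
                  (Or.inl ENNReal.ofReal_ne_top), mul_comm, ← div_eq_mul_inv,
                  ENNReal.div_lt_iff (Or.inl (by simp [Real.exp_pos]))
                    (Or.inl ENNReal.ofReal_ne_top), mul_comm]
                exact h1
              rw [Set.indicator_of_mem hsA, Set.indicator_of_mem hsJ]
            · rw [Set.indicator_of_notMem hsA]; exact zero_le
        _ ≤ ∫⁻ s, J.indicator (fun s => e (D s *ᵥ y)) s := setLIntegral_le_lintegral _ _
        _ = ∫⁻ s in J, e (D s *ᵥ y) := lintegral_indicator hJm _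
        _ ≤ _ := by
            rw [mul_assoc]
            exact h.lintegral_exit_le hr0 y _
    · simp [hH, hy]
  have step4 : ∫⁻ y in S, Φ y ≤ ENNReal.ofReal (C₂ * C₃) := by
    simp only [hΦ]
    rw [lintegral_const_mul' _ _ ENNReal.ofReal_ne_top, ENNReal.ofReal_mul hC₂.le]
    gcongr
    simp only [orbitPotential]
    rw [lintegral_lintegral_swap (h.measurable_lintegral_orbitKernel c k').aemeasurable]
    calc _ ≤ ∫⁻ _u, ENNReal.ofReal C₃ ∂μ := lintegral_mono fun u => hshell r u
      _ = ENNReal.ofReal C₃ * μ Set.univ := by rw [lintegral_const]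
      _ ≤ _ := mul_le_of_le_one_right' hμ
  calc ∫⁻ x in A, e x
      ≤ ENNReal.ofReal (K * r) * (ENNReal.ofReal C₁ *
        (ENNReal.ofReal (4 / (a * r ^ 2)) * (ENNReal.ofReal m)⁻¹ * ENNReal.ofReal (C₂ * C₃))) := by
        refine step1.trans (mul_le_mul' le_rfl (step2.trans (mul_le_mul' le_rfl ?_)))
        refine (lintegral_mono step3).trans ?_
        rw [lintegral_indicator hSm, lintegral_const_mul' _ _ (ENNReal.mul_ne_top
          ENNReal.ofReal_ne_top (by simpa using hm))]
        exact mul_le_mul' le_rfl step4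
    _ = _ := by
        rw [← ENNReal.ofReal_inv_of_pos hm, ← ENNReal.ofReal_mul (by positivity),
          ← ENNReal.ofReal_mul (by positivity), ← ENNReal.ofReal_mul (by positivity),
          ← ENNReal.ofReal_mul (by positivity)]
        congr 1
        field_simp

end IsExpandingFlow

end OrnsteinUhlenbeck

/-! ### Superlevel sets on the whole space -/

namespace OrnsteinUhlenbeck

variable {n : ℕ}

namespace IsExpandingFlow

variable {ρ : (Fin n → ℝ) → ℝ} {D : ℝ → Matrix (Fin n) (Fin n) ℝ} {a b : ℝ}

/-- The level set estimate on the whole space, at the level `e^{r²/2}`. -/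
theorem exists_lintegral_superlevel_le (h : IsExpandingFlow ρ D a b) {k c C₀ : ℝ} (hk : 0 < k)
    (hc : 0 < c) (hC₀ : 0 < C₀) {q : ℕ} (hq : q ≤ 1) :
    ∃ C : ℝ, 0 < C ∧ ∀ (μ : Measure (Fin n → ℝ)) [SFinite μ], μ Set.univ ≤ 1 →
      ∀ r : ℝ, 1 ≤ r → ∃ A : Set (Fin n → ℝ), MeasurableSet A ∧
      {x | ENNReal.ofReal (Real.exp (1 / 2 * r ^ 2)) <
        ENNReal.ofReal (C₀ * (1 + ρ x) ^ q * Real.exp (1 / 2 * ρ x ^ 2)) *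
          orbitPotential ρ D c k μ x} ⊆ A ∧
      ∫⁻ x in A, ENNReal.ofReal (Real.exp (-(1 / 2 * ρ x ^ 2)))
        ≤ ENNReal.ofReal (C * r ^ q / (r * Real.exp (1 / 2 * r ^ 2))) := by
  obtain ⟨C₁, hC₁, hann⟩ := h.exists_lintegral_levelSet_le hk hc
  obtain ⟨C₂, hC₂, hbdd⟩ := h.exists_orbitPotential_le hk hc
  have hg := h.integrable_exp_neg_mul_sq_norm (k := 1 / 4) (by norm_num)
  have hg' := h.integrable_exp_neg_mul_sq_norm (k := 1 / 2) (by norm_num)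
  set I := ∫ z, Real.exp (-(1 / 4) * ρ z ^ 2) with hI
  set I' := ∫ z, Real.exp (-(1 / 2) * ρ z ^ 2) with hI'
  have hI0 : 0 ≤ I := integral_nonneg fun _ => Real.exp_nonneg _
  have hI'0 : 0 ≤ I' := integral_nonneg fun _ => Real.exp_nonneg _
  refine ⟨C₁ * C₀ * 3 ^ q + I + 4 * (C₀ * 2 ^ q * C₂) ^ 2 * I', by positivity,
    fun μ _ hμ r hr => ?_⟩
  have hr0 : 0 < r := by linarith
  have hρm := h.continuous_norm.measurable
  have hΨm := h.measurable_orbitPotential c k μ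
  set U := {x | ENNReal.ofReal (Real.exp (1 / 2 * r ^ 2)) <
        ENNReal.ofReal (C₀ * (1 + ρ x) ^ q * Real.exp (1 / 2 * ρ x ^ 2)) *
          orbitPotential ρ D c k μ x} with hU
  have hUm : MeasurableSet U := measurableSet_lt measurable_const
    ((((measurable_const.add hρm).pow_const q).const_mul C₀).mul
      ((hρm.pow_const 2).const_mul _).exp |>.ennreal_ofReal.mul hΨm)
  refine ⟨U, hUm, subset_rfl, ?_⟩
  -- On the annulus 1 + ρ ≤ 1 + 2r ≤ 3r, so the polynomial prefactor is replaced by its largest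
  -- value and m is the remaining level.
  set m := Real.exp (1 / 2 * r ^ 2) / (C₀ * (3 * r) ^ q) with hm
  have hm0 : 0 < m := by positivity
  set A₁ := {x | r / 2 ≤ ρ x ∧ ρ x ≤ 2 * r ∧ ENNReal.ofReal m <
          ENNReal.ofReal (Real.exp (1 / 2 * ρ x ^ 2)) * orbitPotential ρ D c k μ x}
  set A₂ := {x | 2 * r < ρ x}
  set A₃ := {x | x ∈ U ∧ ρ x < r / 2} with hA₃
  have hA₂m : MeasurableSet A₂ := measurableSet_lt measurable_const hρm
  have hsub : U ⊆ A₁ ∪ A₂ ∪ A₃ := by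
    intro x hx
    by_cases h1 : ρ x < r / 2
    · exact Or.inr ⟨hx, h1⟩
    by_cases h2 : 2 * r < ρ x
    · exact Or.inl (Or.inr h2)
    refine Or.inl (Or.inl ⟨not_lt.1 h1, not_lt.1 h2, ?_⟩)
    have hρ0 := h.nonneg x
    have h3 : C₀ * (1 + ρ x) ^ q * Real.exp (1 / 2 * ρ x ^ 2)
        ≤ (C₀ * (3 * r) ^ q) * Real.exp (1 / 2 * ρ x ^ 2) := by
      gcongr
      linarith [not_lt.1 h2]
    have h4 := lt_of_lt_of_le hx (mul_le_mul_left (ENNReal.ofReal_le_ofReal h3)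
      (orbitPotential ρ D c k μ x))
    rw [ENNReal.ofReal_mul (by positivity), mul_assoc] at h4
    rw [hm, ENNReal.ofReal_div_of_pos (by positivity)]
    refine ENNReal.div_lt_of_lt_mul' h4
  have b1 : ∫⁻ x in A₁, ENNReal.ofReal (Real.exp (-(1 / 2 * ρ x ^ 2))) ≤
      ENNReal.ofReal (C₁ * C₀ * 3 ^ q * r ^ q / (r * Real.exp (1 / 2 * r ^ 2))) := by
    refine (hann μ hμ r m hr hm0).trans_eq ?_
    congr 1
    rw [hm, mul_pow]
    field_simp
  have hrexp : r ≤ Real.exp (1 / 2 * r ^ 2) := by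
    have := Real.add_one_le_exp (1 / 2 * r ^ 2)
    nlinarith [sq_nonneg (r - 1)]
  have hrq : 1 ≤ r ^ q := one_le_pow₀ hr
  -- Half of ρ²/2 gives at least r² where ρ > 2r, the other half stays integrable; then e^{-r²} ≤
  -- e^{-r²/2}/r.
  have b2 : ∫⁻ x in A₂, ENNReal.ofReal (Real.exp (-(1 / 2 * ρ x ^ 2))) ≤
      ENNReal.ofReal (I * r ^ q / (r * Real.exp (1 / 2 * r ^ 2))) := by
    calc _ ≤ ∫⁻ x in A₂, ENNReal.ofReal (Real.exp (-(r ^ 2))) *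
          ENNReal.ofReal (Real.exp (-(1 / 4) * ρ x ^ 2)) := by
          refine setLIntegral_mono' hA₂m fun x hx => ?_
          rw [← ENNReal.ofReal_mul (Real.exp_nonneg _), ← Real.exp_add]
          refine ENNReal.ofReal_le_ofReal (Real.exp_le_exp.2 ?_)
          have h2 : 2 * r < ρ x := hx
          nlinarith
      _ ≤ ENNReal.ofReal (Real.exp (-(r ^ 2))) * ENNReal.ofReal I := by
          rw [lintegral_const_mul' _ _ ENNReal.ofReal_ne_top, hI,
            ofReal_integral_eq_lintegral_ofReal hg
              (Filter.Eventually.of_forall fun _ => Real.exp_nonneg _)]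
          gcongr
          exact Measure.restrict_le_self
      _ ≤ _ := by
          rw [← ENNReal.ofReal_mul (Real.exp_nonneg _)]
          refine ENNReal.ofReal_le_ofReal ?_
          rw [le_div_iff₀ (by positivity)]
          have h1 : Real.exp (-(r ^ 2)) * (Real.exp (1 / 2 * r ^ 2) * Real.exp (1 / 2 * r ^ 2))
              = 1 := by
            rw [← Real.exp_add, ← Real.exp_add]; ring_nf; exact Real.exp_zero
          calc Real.exp (-(r ^ 2)) * I * (r * Real.exp (1 / 2 * r ^ 2))
              ≤ Real.exp (-(r ^ 2)) * I * (Real.exp (1 / 2 * r ^ 2) * Real.exp (1 / 2 * r ^ 2)) := by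
                gcongr
            _ = I * (Real.exp (-(r ^ 2)) *
                  (Real.exp (1 / 2 * r ^ 2) * Real.exp (1 / 2 * r ^ 2))) := by ring
            _ = I * 1 := by rw [h1]
            _ ≤ _ := by gcongr
  -- Where ρ < r/2 the quantity is at most a constant times r^q e^{r²/8}, so a nonempty set forces
  -- e^{3r²/8} ≤ C' r^q. This makes the claimed bound at least the total mass of the Gaussian; q ≤ 1
  -- enters through r · r^q ≤ r².
  have b3 : ∫⁻ x in A₃, ENNReal.ofReal (Real.exp (-(1 / 2 * ρ x ^ 2))) ≤
      ENNReal.ofReal (4 * (C₀ * 2 ^ q * C₂) ^ 2 * I' * r ^ q / (r * Real.exp (1 / 2 * r ^ 2))) := by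
    rcases A₃.eq_empty_or_nonempty with he | ⟨x, hx, hxr⟩
    · rw [he]; simp
    have hρ0 := h.nonneg x
    have h1 : ENNReal.ofReal (Real.exp (1 / 2 * r ^ 2)) <
        ENNReal.ofReal (C₀ * 2 ^ q * C₂ * r ^ q * Real.exp (1 / 8 * r ^ 2)) := by
      refine lt_of_lt_of_le hx ?_
      calc _ ≤ ENNReal.ofReal (C₀ * (2 * r) ^ q * Real.exp (1 / 8 * r ^ 2)) * ENNReal.ofReal C₂ := by
            refine mul_le_mul' (ENNReal.ofReal_le_ofReal ?_) (hbdd μ x hμ)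
            gcongr C₀ * ?_ ^ q * ?_
            · linarith
            · exact Real.exp_le_exp.2 (by nlinarith)
        _ = _ := by
            rw [← ENNReal.ofReal_mul (by positivity)]
            congr 1; ring
    rw [ENNReal.ofReal_lt_ofReal_iff (by positivity)] at h1
    set C' := C₀ * 2 ^ q * C₂ with hC'
    have hC'0 : 0 < C' := by positivity
    have h2 : 1 ≤ 4 * C' ^ 2 * r ^ q / (r * Real.exp (1 / 2 * r ^ 2)) := by
      rw [le_div_iff₀ (by positivity), one_mul]
      have e1 : Real.exp (1 / 8 * r ^ 2) * Real.exp (3 / 8 * r ^ 2) = Real.exp (1 / 2 * r ^ 2) := by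
        rw [← Real.exp_add]; ring_nf
      have h3 : Real.exp (3 / 8 * r ^ 2) ≤ C' * r ^ q := by
        rw [← e1, mul_comm] at h1
        exact (lt_of_mul_lt_mul_right h1 (Real.exp_nonneg _)).le
      have e2 : Real.exp (1 / 2 * r ^ 2) * Real.exp (1 / 4 * r ^ 2)
          = Real.exp (3 / 8 * r ^ 2) * Real.exp (3 / 8 * r ^ 2) := by
        rw [← Real.exp_add, ← Real.exp_add]; ring_nf
      have h4 : r * r ^ q ≤ 4 * Real.exp (1 / 4 * r ^ 2) := by
        have h5 : r ^ q ≤ r := (pow_le_pow_right₀ hr hq).trans_eq (pow_one r)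
        have := Real.add_one_le_exp (1 / 4 * r ^ 2)
        nlinarith
      refine le_of_mul_le_mul_right ?_ (Real.exp_pos (1 / 4 * r ^ 2))
      calc r * Real.exp (1 / 2 * r ^ 2) * Real.exp (1 / 4 * r ^ 2)
          = r * (Real.exp (3 / 8 * r ^ 2) * Real.exp (3 / 8 * r ^ 2)) := by
            rw [mul_assoc, e2]
        _ ≤ r * ((C' * r ^ q) * (C' * r ^ q)) := by gcongr
        _ = C' ^ 2 * r ^ q * (r * r ^ q) := by ring
        _ ≤ C' ^ 2 * r ^ q * (4 * Real.exp (1 / 4 * r ^ 2)) := by gcongr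
        _ = _ := by ring
    calc _ ≤ ∫⁻ x, ENNReal.ofReal (Real.exp (-(1 / 2 * ρ x ^ 2))) := setLIntegral_le_lintegral _ _
      _ = ENNReal.ofReal I' := by
          rw [hI', ofReal_integral_eq_lintegral_ofReal hg'
              (Filter.Eventually.of_forall fun _ => Real.exp_nonneg _)]
          simp only [neg_mul]
      _ ≤ _ := by
          refine ENNReal.ofReal_le_ofReal ?_
          calc I' = 1 * I' := (one_mul _).symm
            _ ≤ _ := mul_le_mul_of_nonneg_right h2 hI'0
            _ = _ := by ring
  calc _ ≤ ∫⁻ x in A₁ ∪ A₂ ∪ A₃, ENNReal.ofReal (Real.exp (-(1 / 2 * ρ x ^ 2))) :=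
        lintegral_mono_set hsub
    _ ≤ _ := (lintegral_union_le _ _ _).trans (add_le_add ((lintegral_union_le _ _ _).trans
        (add_le_add b1 b2)) b3)
    _ = _ := by
        rw [← ENNReal.ofReal_add (by positivity) (by positivity),
          ← ENNReal.ofReal_add (by positivity) (by positivity)]
        congr 1; ring

end IsExpandingFlow

end OrnsteinUhlenbeck

/-! ### Transfer to γ_∞ and weak type (1,1) -/

namespace OrnsteinUhlenbeck

variable {n : ℕ} {Q B : Matrix (Fin n) (Fin n) ℝ}

/-- The kernel bound shared by the Riesz kernels of order one (`q = 0`) and two (`q = 1`). -/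
def IsRieszMajorized (Q B : Matrix (Fin n) (Fin n) ℝ) (c C : ℝ) (q : ℕ)
    (k : (Fin n → ℝ) → (Fin n → ℝ) → ℝ) : Prop :=
  ∀ x u, ‖k x u‖ₑ ≤ ENNReal.ofReal (C * (1 + rho Q B x) ^ q * Real.exp (quadForm Q B x)) *
    ∫⁻ t : ℝ, ENNReal.ofReal (orbitKernel (rho Q B) (flow Q B) c (1 / 8) x u t)

theorem IsStable.quadForm_eq (hB : IsStable B) (hQ : Q.PosDef) (x : Fin n → ℝ) :
    quadForm Q B x = 1 / 2 * rho Q B x ^ 2 := by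
  rw [hB.rho_sq hQ]; ring

/-- The normalizing constant of the Gaussian density of `γ_∞`. -/
noncomputable def gammaConst (Q B : Matrix (Fin n) (Fin n) ℝ) : ℝ :=
  (2 * Real.pi) ^ (-(n : ℝ) / 2) * (covarianceInf Q B).det ^ (-(1 / 2) : ℝ)

theorem IsStable.gammaConst_pos (hB : IsStable B) (hQ : Q.PosDef) : 0 < gammaConst Q B := by
  have := (hB.posDef_covarianceInf hQ).det_pos
  unfold gammaConst
  positivity

theorem rho_nonneg (x : Fin n → ℝ) : 0 ≤ rho Q B x := Real.sqrt_nonneg _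

theorem IsStable.gammaInf_apply (hB : IsStable B) (hQ : Q.PosDef) {A : Set (Fin n → ℝ)}
    (hA : MeasurableSet A) :
    gammaInf Q B A = ENNReal.ofReal (gammaConst Q B) *
      ∫⁻ x in A, ENNReal.ofReal (Real.exp (-(1 / 2 * rho Q B x ^ 2))) := by
  rw [gammaInf, withDensity_apply _ hA, ← lintegral_const_mul' _ _ ENNReal.ofReal_ne_top]
  refine lintegral_congr fun x => ?_
  rw [← ENNReal.ofReal_mul (hB.gammaConst_pos hQ).le, gammaConst, hB.quadForm_eq hQ]

theorem IsStable.exists_gammaInf_univ_le (hB : IsStable B) (hQ : Q.PosDef) :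
    ∃ C : ℝ, 0 < C ∧ gammaInf Q B Set.univ ≤ ENNReal.ofReal C := by
  obtain ⟨a, b, h⟩ := hB.isExpandingFlow hQ
  have hg := h.integrable_exp_neg_mul_sq_norm (k := 1 / 2) (by norm_num)
  have hK := hB.gammaConst_pos hQ
  have hI : 0 ≤ ∫ x, Real.exp (-(1 / 2) * rho Q B x ^ 2) :=
    integral_nonneg fun _ => Real.exp_nonneg _
  refine ⟨gammaConst Q B * ((∫ x, Real.exp (-(1 / 2) * rho Q B x ^ 2)) + 1), by positivity, ?_⟩
  rw [hB.gammaInf_apply hQ MeasurableSet.univ, ENNReal.ofReal_mul (by positivity),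
    Measure.restrict_univ]
  refine mul_le_mul' le_rfl ?_
  simp only [← neg_mul]
  rw [← ofReal_integral_eq_lintegral_ofReal hg
    (Filter.Eventually.of_forall fun _ => Real.exp_nonneg _)]
  exact ENNReal.ofReal_le_ofReal (by linarith)

instance : SFinite (gammaInf Q B) := by
  unfold gammaInf; infer_instance

/-- Here |f| is moved into the measure. For normalized f that measure has mass at most one, the only
property the potential estimates ask for. -/
theorem enorm_integral_mul_le {X : Type*} [MeasurableSpace X] {μ : Measure X} {k f : X → ℝ}
    {g : X → ENNReal} {K : ENNReal} (hK : K ≠ ⊤) (hk : ∀ u, ‖k u‖ₑ ≤ K * g u) (hg : Measurable g)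
    (hf : Integrable f μ) :
    ‖∫ u, k u * f u ∂μ‖ₑ ≤ K * ∫⁻ u, g u ∂(μ.withDensity fun u => ‖f u‖ₑ) := by
  rw [lintegral_withDensity_eq_lintegral_mul₀ hf.1.enorm hg.aemeasurable,
    ← lintegral_const_mul' _ _ hK]
  refine (enorm_integral_le_lintegral_enorm _).trans (lintegral_mono fun u => ?_)
  rw [enorm_mul, Pi.mul_apply, mul_comm ‖f u‖ₑ, ← mul_assoc]
  exact mul_le_mul' (hk u) le_rfl

theorem IsRieszMajorized.enorm_kernelOperator_le {c C : ℝ} {q : ℕ}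
    {k : (Fin n → ℝ) → (Fin n → ℝ) → ℝ} (hk : IsRieszMajorized Q B c C q k)
    {f : (Fin n → ℝ) → ℝ} (hf : Integrable f (gammaInf Q B))
    (x : Fin n → ℝ) (hm : Measurable fun u =>
      ∫⁻ t : ℝ, ENNReal.ofReal (orbitKernel (rho Q B) (flow Q B) c (1 / 8) x u t)) :
    ‖kernelOperator (gammaInf Q B) k f x‖ₑ ≤
      ENNReal.ofReal (C * (1 + rho Q B x) ^ q * Real.exp (quadForm Q B x)) *
        orbitPotential (rho Q B) (flow Q B) c (1 / 8)
          ((gammaInf Q B).withDensity fun u => ‖f u‖ₑ) x := by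
  exact enorm_integral_mul_le ENNReal.ofReal_ne_top (hk x) hm hf

/-- The level set estimate for operators whose kernel is majorized like a Riesz kernel. -/
theorem IsStable.exists_levelSet_le (hB : IsStable B) (hQ : Q.PosDef) {c C₀ : ℝ} (hc : 0 < c)
    (hC₀ : 0 < C₀) {q : ℕ} (hq : q ≤ 1) :
    ∃ C : ℝ, 0 < C ∧ ∀ k, IsRieszMajorized Q B c C₀ q k →
      ∀ f : (Fin n → ℝ) → ℝ, Integrable f (gammaInf Q B) → ∫ u, |f u| ∂(gammaInf Q B) = 1 →
      ∀ r : ℝ, 1 ≤ r →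
        gammaInf Q B {x | Real.exp (1 / 2 * r ^ 2) < |kernelOperator (gammaInf Q B) k f x|} ≤
          ENNReal.ofReal (C * r ^ q / (r * Real.exp (1 / 2 * r ^ 2))) := by
  obtain ⟨a, b, h⟩ := hB.isExpandingFlow hQ
  obtain ⟨C, hC, hlev⟩ := h.exists_lintegral_superlevel_le (k := 1 / 8) (by norm_num) hc hC₀ hq
  have hK := hB.gammaConst_pos hQ
  refine ⟨gammaConst Q B * C, by positivity, fun k hk f hf hf1 r hr => ?_⟩
  have hμ : ((gammaInf Q B).withDensity fun u => ‖f u‖ₑ) Set.univ ≤ 1 := by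
    rw [withDensity_apply _ MeasurableSet.univ, Measure.restrict_univ,
      ← ofReal_integral_norm_eq_lintegral_enorm hf]
    simp [hf1]
  obtain ⟨A, hA, hsub, hle⟩ := hlev _ hμ r hr
  have hsub' : {x | Real.exp (1 / 2 * r ^ 2) < |kernelOperator (gammaInf Q B) k f x|} ⊆ A := by
    intro x hx
    refine hsub ?_
    have h1 := hk.enorm_kernelOperator_le hf x
      (h.measurable_lintegral_orbitKernel_right c (1 / 8) x)
    rw [Real.enorm_eq_ofReal_abs] at h1
    rw [Set.mem_ofPred_eq, ← hB.quadForm_eq hQ]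
    refine lt_of_lt_of_le ?_ h1
    exact (ENNReal.ofReal_lt_ofReal_iff ((Real.exp_pos _).trans hx)).2 hx
  calc _ ≤ gammaInf Q B A := measure_mono hsub'
    _ ≤ _ := by
        rw [hB.gammaInf_apply hQ hA, mul_assoc _ C, mul_div_assoc,
          ENNReal.ofReal_mul hK.le]
        exact mul_le_mul' le_rfl hle

/-- By homogeneity one may normalize f. Levels at most 2 are trivial because γ_∞ is finite, which
accounts for 2C' in the constant; higher levels are covered by the level set estimate. -/
theorem IsStable.isWeakTypeOneOne (hB : IsStable B) (hQ : Q.PosDef) {c C₀ : ℝ} (hc : 0 < c)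
    (hC₀ : 0 < C₀) {q : ℕ} (hq : q ≤ 1) {k : (Fin n → ℝ) → (Fin n → ℝ) → ℝ}
    (hk : IsRieszMajorized Q B c C₀ q k) :
    IsWeakTypeOneOne (gammaInf Q B) (kernelOperator (gammaInf Q B) k) := by
  obtain ⟨C, hC, hlev⟩ := hB.exists_levelSet_le hQ hc hC₀ hq
  obtain ⟨C', hC', htot⟩ := hB.exists_gammaInf_univ_le hQ
  refine ⟨C + 2 * C', by positivity, fun f hf a ha => ?_⟩
  set N := ∫ u, |f u| ∂(gammaInf Q B) with hN
  have hN0 : 0 ≤ N := integral_nonneg fun _ => abs_nonneg _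
  rcases eq_or_lt_of_le hN0 with h0 | h0
  · have hf0 : f =ᵐ[gammaInf Q B] 0 := by
      have := (integral_eq_zero_iff_of_nonneg (fun u => abs_nonneg (f u)) hf.abs).1 (hN ▸ h0.symm)
      filter_upwards [this] with u hu
      simpa using hu
    have hT : ∀ x, kernelOperator (gammaInf Q B) k f x = 0 := fun x => by
      rw [kernelOperator]
      refine integral_eq_zero_of_ae ?_
      filter_upwards [hf0] with u hu
      simp [hu]
    simp [hT, ha.not_gt]
  have hg1 : ∫ u, |N⁻¹ * f u| ∂(gammaInf Q B) = 1 := by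
    simp only [abs_mul, abs_inv, abs_of_pos h0]
    rw [integral_const_mul, ← hN, inv_mul_cancel₀ h0.ne']
  have hTg : ∀ x, kernelOperator (gammaInf Q B) k f x
      = N * kernelOperator (gammaInf Q B) k (fun u => N⁻¹ * f u) x := fun x => by
    simp only [kernelOperator]
    rw [← integral_const_mul]
    congr 1
    ext u
    field_simp
  have hset : {x | a < |kernelOperator (gammaInf Q B) k f x|}
      = {x | a / N < |kernelOperator (gammaInf Q B) k (fun u => N⁻¹ * f u) x|} := by
    ext x
    simp only [Set.mem_ofPred_eq]
    rw [hTg, abs_mul, abs_of_pos h0, div_lt_iff₀' h0]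
  rw [hset]
  have hval : (C + 2 * C') / a * N = (C + 2 * C') / (a / N) := by field_simp
  rw [hval]
  have hl0 : 0 < a / N := by positivity
  rcases le_or_gt (a / N) 2 with h2 | h2
  · refine (measure_mono (Set.subset_univ _)).trans (htot.trans (ENNReal.ofReal_le_ofReal ?_))
    rw [le_div_iff₀ hl0]
    nlinarith
  -- As log 2 > 1/2, a level above 2 has the form e^{r²/2} with r ≥ 1, as the level set estimate
  -- demands.
  · have hlog : 1 / 2 ≤ Real.log (a / N) := by
      have := Real.log_two_gt_d9
      have h3 := Real.log_le_log (by norm_num) h2.le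
      linarith
    set r := Real.sqrt (2 * Real.log (a / N)) with hr
    have hr1 : 1 ≤ r := Real.le_sqrt_of_sq_le (by linarith)
    have hexp : Real.exp (1 / 2 * r ^ 2) = a / N := by
      rw [hr, Real.sq_sqrt (by linarith), ← mul_assoc]
      norm_num
      exact Real.exp_log hl0
    have := hlev k hk _ (hf.const_mul N⁻¹) hg1 r hr1
    rw [hexp] at this
    refine this.trans (ENNReal.ofReal_le_ofReal ?_)
    -- Weak type tolerates exactly one power of 1 + ρ(x): the gain 1/r must compensate r^q.
    have hrq : r ^ q ≤ r := (pow_le_pow_right₀ hr1 hq).trans_eq (pow_one r)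
    calc C * r ^ q / (r * (a / N)) ≤ C * r / (r * (a / N)) := by gcongr
      _ = C / (a / N) := by field_simp
      _ ≤ _ := by gcongr; linarith

/-! ### The Riesz kernels: majorization, measurability, absolute convergence -/

section RieszKernels

theorem enorm_setIntegral_le {F G : ℝ → ℝ} {C : ℝ} (hC : 0 ≤ C)
    (h : ∀ t, 1 < t → |F t| ≤ C * G t) :
    ‖∫ t in Set.Ioi 1, F t‖ₑ ≤ ENNReal.ofReal C * ∫⁻ t, ENNReal.ofReal (G t) := by
  refine (enorm_integral_le_lintegral_enorm _).trans ?_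
  rw [← lintegral_const_mul' _ _ ENNReal.ofReal_ne_top]
  refine le_trans (setLIntegral_mono' measurableSet_Ioi fun t ht => ?_)
    (setLIntegral_le_lintegral (Set.Ioi 1) _)
  rw [Real.enorm_eq_ofReal_abs, ← ENNReal.ofReal_mul hC]
  exact ENNReal.ofReal_le_ofReal (h t ht)

/-- Two functions appear because measurability in t is known for the explicit formula F', which
agrees with the integrand F for t > 1. -/
theorem integrableOn_of_le_mul {F F' G : ℝ → ℝ} {C : ℝ} (hC : 0 ≤ C) (hm : Measurable F')
    (heq : ∀ t, 1 < t → F t = F' t) (h : ∀ t, 1 < t → |F' t| ≤ C * G t)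
    (hG : ∫⁻ t, ENNReal.ofReal (G t) < ⊤) : IntegrableOn F (Set.Ioi 1) := by
  refine IntegrableOn.congr_fun (f := F') ?_ (fun t ht => (heq t ht).symm) measurableSet_Ioi
  refine ⟨hm.aestronglyMeasurable, ?_⟩
  calc ∫⁻ t in Set.Ioi 1, ‖F' t‖ₑ ≤ ∫⁻ t in Set.Ioi 1, ENNReal.ofReal C * ENNReal.ofReal (G t) := by
        refine setLIntegral_mono' measurableSet_Ioi fun t ht => ?_
        rw [Real.enorm_eq_ofReal_abs, ← ENNReal.ofReal_mul hC]
        exact ENNReal.ofReal_le_ofReal (h t ht)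
    _ ≤ ∫⁻ t, ENNReal.ofReal C * ENNReal.ofReal (G t) := setLIntegral_le_lintegral _ _
    _ < ⊤ := by
        rw [lintegral_const_mul' _ _ ENNReal.ofReal_ne_top]
        exact ENNReal.mul_lt_top ENNReal.ofReal_lt_top hG

theorem IsStable.rieszKernelInf₁_eq (hB : IsStable B) (hQ : Q.PosDef) (j : Fin n)
    (x u : Fin n → ℝ) : rieszKernelInf₁ Q B j x u
      = (1 / Real.sqrt Real.pi) * ∫ t : ℝ in Set.Ioi 1, rieszFormula₁ Q B j x u t := by
  rw [rieszKernelInf₁, setIntegral_congr_fun measurableSet_Ioi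
    fun t ht => hB.rieszIntegrand₁_eq hQ (le_of_lt ht) j x u]

theorem IsStable.rieszKernelInf₂_eq (hB : IsStable B) (hQ : Q.PosDef) (i j : Fin n)
    (x u : Fin n → ℝ) : rieszKernelInf₂ Q B i j x u
      = ∫ t : ℝ in Set.Ioi 1, rieszFormula₂ Q B i j x u t := by
  rw [rieszKernelInf₂, setIntegral_congr_fun measurableSet_Ioi
    fun t ht => hB.rieszIntegrand₂_eq hQ (le_of_lt ht) i j x u]

theorem IsStable.measurable_rieszKernelInf₁ (hB : IsStable B) (hQ : Q.PosDef) (j : Fin n)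
    (x : Fin n → ℝ) : Measurable (rieszKernelInf₁ Q B j x) := by
  have := (measurable_rieszFormula₁ (Q := Q) (B := B) j x).stronglyMeasurable.integral_prod_right'
    (ν := volume.restrict (Set.Ioi (1 : ℝ)))
  have h2 := this.measurable.const_mul (1 / Real.sqrt Real.pi)
  rwa [funext fun u => hB.rieszKernelInf₁_eq hQ j x u]

theorem IsStable.measurable_rieszKernelInf₂ (hB : IsStable B) (hQ : Q.PosDef) (i j : Fin n)
    (x : Fin n → ℝ) : Measurable (rieszKernelInf₂ Q B i j x) := by
  have := (measurable_rieszFormula₂ (Q := Q) (B := B) i j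
    x).stronglyMeasurable.integral_prod_right' (ν := volume.restrict (Set.Ioi (1 : ℝ)))
  rw [funext fun u => hB.rieszKernelInf₂_eq hQ i j x u]
  exact this.measurable

theorem IsStable.exists_isRieszMajorized (hB : IsStable B) (hQ : Q.PosDef) :
    ∃ c : ℝ, 0 < c ∧ ∃ C : ℝ, 0 < C ∧
      (∀ j, IsRieszMajorized Q B c C 0 (rieszKernelInf₁ Q B j)) ∧
      (∀ i j, IsRieszMajorized Q B c C 1 (rieszKernelInf₂ Q B i j)) ∧
      (∀ i j x u, IntegrableOn (rieszIntegrand₁ Q B j x u) (Set.Ioi (1 : ℝ)) ∧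
        IntegrableOn (rieszIntegrand₂ Q B i j x u) (Set.Ioi (1 : ℝ))) := by
  obtain ⟨c, hc, C, hC, hbd⟩ := hB.exists_rieszFormula_le hQ
  obtain ⟨a, b, h⟩ := hB.isExpandingFlow hQ
  obtain ⟨C₁, hC₁, hfin⟩ := h.exists_lintegral_orbitKernel_le (k := 1 / 8) (by norm_num) hc
  refine ⟨c, hc, C, hC, fun j x u => ?_, fun i j x u => ?_, fun i j x u => ⟨?_, ?_⟩⟩
  · have hπ : 1 / Real.sqrt Real.pi ≤ 1 := by
      rw [div_le_one (by positivity)]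
      exact Real.one_le_sqrt.2 (by linarith [Real.pi_gt_three])
    rw [hB.rieszKernelInf₁_eq hQ, enorm_mul, pow_zero, mul_one]
    refine (mul_le_of_le_one_left' ?_).trans
      (enorm_setIntegral_le (by positivity) fun t ht => (hbd t (le_of_lt ht) x u).1 j)
    rw [Real.enorm_eq_ofReal (by positivity)]
    exact ENNReal.ofReal_le_one.2 hπ
  · have := rho_nonneg (Q := Q) (B := B) x
    rw [hB.rieszKernelInf₂_eq hQ, pow_one]
    exact enorm_setIntegral_le (by positivity) fun t ht => (hbd t (le_of_lt ht) x u).2 i j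
  · exact integrableOn_of_le_mul (C := C * Real.exp (quadForm Q B x)) (by positivity)
      ((measurable_rieszFormula₁ j x).comp (measurable_const.prodMk measurable_id))
      (fun t ht => hB.rieszIntegrand₁_eq hQ (le_of_lt ht) j x u)
      (fun t ht => (hbd t (le_of_lt ht) x u).1 j) ((hfin x u).trans_lt ENNReal.ofReal_lt_top)
  · have := rho_nonneg (Q := Q) (B := B) x
    exact integrableOn_of_le_mul (C := C * (1 + rho Q B x) * Real.exp (quadForm Q B x))
      (by positivity) ((measurable_rieszFormula₂ i j x).comp (measurable_const.prodMk measurable_id))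
      (fun t ht => hB.rieszIntegrand₂_eq hQ (le_of_lt ht) i j x u)
      (fun t ht => (hbd t (le_of_lt ht) x u).2 i j) ((hfin x u).trans_lt ENNReal.ofReal_lt_top)

theorem IsStable.integrable_kernel_mul (hB : IsStable B) (hQ : Q.PosDef) {c C : ℝ} (hc : 0 < c)
    {q : ℕ} {k : (Fin n → ℝ) → (Fin n → ℝ) → ℝ}
    (hk : IsRieszMajorized Q B c C q k) (x : Fin n → ℝ) (hm : Measurable (k x))
    {f : (Fin n → ℝ) → ℝ} (hf : Integrable f (gammaInf Q B)) :
    Integrable (fun u => k x u * f u) (gammaInf Q B) := by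
  obtain ⟨a, b, h⟩ := hB.isExpandingFlow hQ
  obtain ⟨C₁, hC₁, hfin⟩ := h.exists_lintegral_orbitKernel_le (k := 1 / 8) (by norm_num) hc
  set K := ENNReal.ofReal (C * (1 + rho Q B x) ^ q * Real.exp (quadForm Q B x)) *
    ENNReal.ofReal C₁ with hK
  have hKt : K ≠ ⊤ := ENNReal.mul_ne_top ENNReal.ofReal_ne_top ENNReal.ofReal_ne_top
  refine hf.bdd_mul (c := K.toReal) hm.aestronglyMeasurable (Filter.Eventually.of_forall fun u => ?_)
  rw [← toReal_enorm]
  exact ENNReal.toReal_mono hKt ((hk x u).trans (mul_le_mul' le_rfl (hfin x u)))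

end RieszKernels

end OrnsteinUhlenbeck

open OrnsteinUhlenbeck in
theorem proposition7p1 {n : ℕ} (Q B : Matrix (Fin n) (Fin n) ℝ)
    (hQ : Q.PosDef)
    (hB : ∀ z : ℂ, Module.End.HasEigenvalue
      (Matrix.toLin' (B.map (fun r : ℝ => (r : ℂ)))) z → z.re < 0) :
    -- the integrals defining the two kernels converge absolutely
    (∀ (i j : Fin n) (x u : Fin n → ℝ),
      IntegrableOn (rieszIntegrand₁ Q B j x u) (Set.Ioi (1 : ℝ)) ∧
      IntegrableOn (rieszIntegrand₂ Q B i j x u) (Set.Ioi (1 : ℝ))) ∧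
    -- so do the integrals defining the two operators
    (∀ f : (Fin n → ℝ) → ℝ, Integrable f (gammaInf Q B) →
      ∀ (i j : Fin n) (x : Fin n → ℝ),
        Integrable (fun u => rieszKernelInf₁ Q B j x u * f u) (gammaInf Q B) ∧
        Integrable (fun u => rieszKernelInf₂ Q B i j x u * f u) (gammaInf Q B)) ∧
    -- the level set estimates, with a constant depending only on `n`, `Q` and `B`
    (∃ C : ℝ, 0 < C ∧
      ∀ f : (Fin n → ℝ) → ℝ, Integrable f (gammaInf Q B) → (0 ≤ᵐ[gammaInf Q B] f) →
        ∫ u, |f u| ∂(gammaInf Q B) = 1 →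
        ∀ (i j : Fin n) (a : ℝ), 2 < a →
          gammaInf Q B {x | a < ∫ u, rieszKernelInf₁ Q B j x u * f u ∂(gammaInf Q B)}
            ≤ ENNReal.ofReal (C / (a * Real.sqrt (Real.log a))) ∧
          gammaInf Q B {x | a < ∫ u, rieszKernelInf₂ Q B i j x u * f u ∂(gammaInf Q B)}
            ≤ ENNReal.ofReal (C / a)) ∧
    -- both operators are of weak type (1,1)
    (∀ i j : Fin n,
      IsWeakTypeOneOne (gammaInf Q B)
        (kernelOperator (gammaInf Q B) (rieszKernelInf₁ Q B j)) ∧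
      IsWeakTypeOneOne (gammaInf Q B)
        (kernelOperator (gammaInf Q B) (rieszKernelInf₂ Q B i j))) := by
  have hS : IsStable B := exists_norm_exp_le B hB
  obtain ⟨c, hc, C₀, hC₀, hk₁, hk₂, hint⟩ := hS.exists_isRieszMajorized hQ
  refine ⟨hint, fun f hf i j x => ⟨?_, ?_⟩, ?_, fun i j => ⟨?_, ?_⟩⟩
  · exact hS.integrable_kernel_mul hQ hc (hk₁ j) x (hS.measurable_rieszKernelInf₁ hQ j x) hf
  · exact hS.integrable_kernel_mul hQ hc (hk₂ i j) x (hS.measurable_rieszKernelInf₂ hQ i j x) hf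
  · obtain ⟨C₁, hC₁, hlev₁⟩ := hS.exists_levelSet_le hQ hc hC₀ (q := 0) (by norm_num)
    obtain ⟨C₂, hC₂, hlev₂⟩ := hS.exists_levelSet_le hQ hc hC₀ (q := 1) le_rfl
    refine ⟨C₁ + C₂, by positivity, fun f hf _ hf1 i j a ha => ?_⟩
    have ha0 : 0 < a := by linarith
    have hlog : 1 / 2 ≤ Real.log a := by
      have := Real.log_two_gt_d9
      have h3 := Real.log_le_log (by norm_num) ha.le
      linarith
    -- Then a = e^{r²/2}. The bound 1/(r a) for q = 0 gives the logarithmic gain, since r ≥ √(log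
    -- a); for q = 1 the factor r cancels.
    set r := Real.sqrt (2 * Real.log a) with hr
    have hr1 : 1 ≤ r := Real.le_sqrt_of_sq_le (by linarith)
    have hrlog : Real.sqrt (Real.log a) ≤ r := Real.sqrt_le_sqrt (by linarith)
    have hlog0 : 0 < Real.sqrt (Real.log a) := Real.sqrt_pos.2 (by linarith)
    have hexp : Real.exp (1 / 2 * r ^ 2) = a := by
      rw [hr, Real.sq_sqrt (by linarith), ← mul_assoc]
      norm_num
      exact Real.exp_log ha0
    have h1 := hlev₁ _ (hk₁ j) f hf hf1 r hr1
    have h2 := hlev₂ _ (hk₂ i j) f hf hf1 r hr1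
    rw [hexp] at h1 h2
    refine ⟨?_, ?_⟩
    · refine (measure_mono fun x hx => ?_).trans (h1.trans (ENNReal.ofReal_le_ofReal ?_))
      · exact lt_of_lt_of_le (Set.mem_ofPred_eq ▸ hx) (le_abs_self _)
      · rw [pow_zero, mul_one, mul_comm r a]
        gcongr
        linarith
    · refine (measure_mono fun x hx => ?_).trans (h2.trans (ENNReal.ofReal_le_ofReal ?_))
      · exact lt_of_lt_of_le (Set.mem_ofPred_eq ▸ hx) (le_abs_self _)
      · rw [pow_one, mul_comm C₂ r, mul_div_mul_left _ _ (by positivity)]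
        gcongr
        linarith
  · exact hS.isWeakTypeOneOne hQ hc hC₀ (Nat.zero_le 1) (hk₁ j)
  · exact hS.isWeakTypeOneOne hQ hc hC₀ le_rfl (hk₂ i j)
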